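/- Let $n\ge 0$ and let $\mathcal X$ be a smooth manifold of dimension $4n$. A null–Kähler structure on (an open subset of) $\mathcal X$ is a pair $(g,N)$ consisting of a smooth pseudo-Riemannian metric $g$ of signature $(2n,2n)$ and a smooth endomorphism $N$ of the tangent bundle of rank $2n$ such that $N^2=0$, $g(X,NY)+g(NX,Y)=0$ for all vector fields $X,Y$, and $\nabla N=0$, where $\nabla$ is the Levi-Civita connection of $g$. Let $\omega=(\omega_{ij})=\begin{pmatrix}0&\mathbb I_n\\-\mathbb I_n&0\end{pmatrix}$. (1) If $(g,N)$ is a null–Kähler structure on $\mathcal X$, then every point of $\mathcal X$ has an open neighbourhood $U$ with smooth coordinates $(x^i,y^i)$, $i=1,\dots,2n$, and a smooth function $\Theta:U\to\mathbb R$ such that on $U$ $$g=\frac12\sum_{i,j=1}^{2n}\Big(\omega_{ij}\,(dy^i\otimes dx^j+dx^j\otimes dy^i)+\frac{\partial^2\Theta}{\partial y^i\partial y^j}\,(dx^i\otimes dx^j+dx^j\otimes dx^i)\Big),\qquad N=\sum_{i=1}^{2n}dx^i\otimes\frac{\partial}{\partial y^i}.$$ (2) Conversely, for every coordinate system $(x^i,y^i)$,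 $i=1,\dots,2n$, on an open subset $U$ of $\mathcal X$ and every smooth function $\Theta:U\to\mathbb R$, the pair $(g,N)$ defined on $U$ by these formulas is a null–Kähler structure on $U$. -/

import Mathlib

open scoped Manifold ContDiff

noncomputable section

namespace NullKahler

/-- The range of the indices `i = 1, …, 2n`: the left summand holds `1, …, n`, the right summand
holds `n + 1, …, 2n`. -/
abbrev Idx (n : ℕ) : Type := Fin n ⊕ Fin n

/-- The space `ℝ²ⁿ × ℝ²ⁿ` in which the coordinates `(x, y)` take their values. -/
abbrev Coord (n : ℕ) : Type := (Idx n → ℝ) × (Idx n → ℝ)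

/-- The standard symplectic matrix, with blocks `0, 1, -1, 0` of size `n`. -/
def omega (n : ℕ) : Matrix (Idx n) (Idx n) ℝ := Matrix.fromBlocks 0 1 (-1) 0

/-- The model vector space of a manifold of dimension `4n`. -/
abbrev Model (n : ℕ) : Type := EuclideanSpace ℝ (Fin (4 * n))

section Manifold

variable {n : ℕ} {M : Type*} [TopologicalSpace M] [ChartedSpace (Model n) M]

/-- The quadratic form `v ↦ g (v, v)` of a bilinear form on a tangent space. -/
def quadForm {x : M} (b : TangentSpace (𝓡 (4 * n)) x →L[ℝ] TangentSpace (𝓡 (4 * n)) x →L[ℝ] ℝ) :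
    QuadraticForm ℝ (TangentSpace (𝓡 (4 * n)) x) :=
  LinearMap.BilinMap.toQuadraticMap b.toLinearMap₁₂

/-- The vector field `Y` is differentiable at the point `x`. -/
def DifferentiableFieldAt [IsManifold (𝓡 (4 * n)) ∞ M] (Y : ∀ x : M, TangentSpace (𝓡 (4 * n)) x) (x : M) : Prop :=
  MDifferentiableAt (𝓡 (4 * n)) ((𝓡 (4 * n)).prod 𝓘(ℝ, Model n))
    (fun z ↦ Bundle.TotalSpace.mk' (Model n) (E := fun x : M ↦ TangentSpace (𝓡 (4 * n)) x)
      z (Y z)) x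

/-- `cov` (where `cov Y x v` is `∇_v Y` at `x`) is the Levi-Civita connection of `g` over the set
`U`: a covariant derivative which is torsion-free and for which `g` is parallel. -/
structure IsLeviCivitaOn
    (g : ∀ x : M, TangentSpace (𝓡 (4 * n)) x →L[ℝ] TangentSpace (𝓡 (4 * n)) x →L[ℝ] ℝ)
    (cov : (∀ x : M, TangentSpace (𝓡 (4 * n)) x) →
      (∀ x : M, TangentSpace (𝓡 (4 * n)) x →L[ℝ] TangentSpace (𝓡 (4 * n)) x))
    [IsManifold (𝓡 (4 * n)) ∞ M] (U : Set M) : Prop where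
  isCovariantDerivativeOn : IsCovariantDerivativeOn (Model n) cov U
  torsion_free : ∀ x ∈ U, ∀ X Y : ∀ x : M, TangentSpace (𝓡 (4 * n)) x,
    DifferentiableFieldAt X x → DifferentiableFieldAt Y x →
      cov Y x (X x) - cov X x (Y x) = VectorField.mlieBracket (𝓡 (4 * n)) X Y x
  metric : ∀ x ∈ U, ∀ Y Z : ∀ x : M, TangentSpace (𝓡 (4 * n)) x,
    DifferentiableFieldAt Y x → DifferentiableFieldAt Z x → ∀ v : TangentSpace (𝓡 (4 * n)) x,
      mvfderiv (𝓡 (4 * n)) (fun z ↦ g z (Y z) (Z z)) x v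
        = g x (cov Y x v) (Z x) + g x (Y x) (cov Z x v)

/-- `(g, N)` is a null-Kähler structure over the open set `U` of the `4n`-dimensional manifold `M`:
`g` is a smooth pseudo-Riemannian metric of signature `(2n, 2n)`, and `N` is a smooth endomorphism
of the tangent bundle of rank `2n` with `N² = 0`, skew-adjoint for `g` and parallel for the
Levi-Civita connection of `g`. -/
structure IsNullKahlerOn [IsManifold (𝓡 (4 * n)) ∞ M]
    (g : ∀ x : M, TangentSpace (𝓡 (4 * n)) x →L[ℝ] TangentSpace (𝓡 (4 * n)) x →L[ℝ] ℝ)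
    (N : ∀ x : M, TangentSpace (𝓡 (4 * n)) x →L[ℝ] TangentSpace (𝓡 (4 * n)) x)
    (U : Set M) : Prop where
  smooth_metric : ContMDiffOn (𝓡 (4 * n))
    ((𝓡 (4 * n)).prod 𝓘(ℝ, Model n →L[ℝ] Model n →L[ℝ] ℝ)) ∞
    (fun x ↦ Bundle.TotalSpace.mk' (Model n →L[ℝ] Model n →L[ℝ] ℝ)
      (E := fun x : M ↦
        TangentSpace (𝓡 (4 * n)) x →L[ℝ] TangentSpace (𝓡 (4 * n)) x →L[ℝ] ℝ) x (g x)) U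
  symm : ∀ x ∈ U, ∀ v w, g x v w = g x w v
  nondegenerate : ∀ x ∈ U, ∀ v, (∀ w, g x v w = 0) → v = 0
  signature : ∀ x ∈ U, sigPos (quadForm (g x)) = 2 * n ∧ sigNeg (quadForm (g x)) = 2 * n
  smooth_endo : ContMDiffOn (𝓡 (4 * n)) ((𝓡 (4 * n)).prod 𝓘(ℝ, Model n →L[ℝ] Model n)) ∞
    (fun x ↦ Bundle.TotalSpace.mk' (Model n →L[ℝ] Model n)
      (E := fun x : M ↦ TangentSpace (𝓡 (4 * n)) x →L[ℝ] TangentSpace (𝓡 (4 * n)) x) x (N x)) U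
  sq_zero : ∀ x ∈ U, ∀ v, N x (N x v) = 0
  rank : ∀ x ∈ U, Module.finrank ℝ (LinearMap.range (N x).toLinearMap) = 2 * n
  skew : ∀ x ∈ U, ∀ v w, g x v (N x w) + g x (N x v) w = 0
  parallel : ∃ cov : (∀ x : M, TangentSpace (𝓡 (4 * n)) x) →
      (∀ x : M, TangentSpace (𝓡 (4 * n)) x →L[ℝ] TangentSpace (𝓡 (4 * n)) x),
    IsLeviCivitaOn g cov U ∧
      ∀ x ∈ U, ∀ Y : ∀ x : M, TangentSpace (𝓡 (4 * n)) x, DifferentiableFieldAt Y x →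
        ∀ v : TangentSpace (𝓡 (4 * n)) x, cov (fun z ↦ N z (Y z)) x v = N x (cov Y x v)

/-- A local coordinate system `(x, y)` on `M` with domain `φ.source`: a smooth map onto an open
subset of `ℝ²ⁿ × ℝ²ⁿ` with a smooth inverse. -/
structure IsCoordinateSystem (φ : OpenPartialHomeomorph M (Coord n)) : Prop where
  smooth : ContMDiffOn (𝓡 (4 * n)) 𝓘(ℝ, Coord n) ∞ φ φ.source
  smooth_symm : ContMDiffOn 𝓘(ℝ, Coord n) (𝓡 (4 * n)) ∞ φ.symm φ.target

variable (φ : OpenPartialHomeomorph M (Coord n))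

/-- The differential `dxⁱ` of the coordinate function `xⁱ`. -/
def dx (i : Idx n) (q : M) : TangentSpace (𝓡 (4 * n)) q →L[ℝ] ℝ :=
  mvfderiv (𝓡 (4 * n)) (fun m ↦ (φ m).1 i) q

/-- The differential `dyⁱ` of the coordinate function `yⁱ`. -/
def dy (i : Idx n) (q : M) : TangentSpace (𝓡 (4 * n)) q →L[ℝ] ℝ :=
  mvfderiv (𝓡 (4 * n)) (fun m ↦ (φ m).2 i) q

/-- The coordinate vector field `∂/∂yⁱ`. -/
def partialY (i : Idx n) (q : M) : TangentSpace (𝓡 (4 * n)) q :=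
  (mfderiv (𝓡 (4 * n)) 𝓘(ℝ, Coord n) φ q).inverse ((0, Pi.single i 1) : Coord n)

/-- The partial derivative `∂f/∂yⁱ` of a function of the coordinates. -/
def derivY (i : Idx n) (f : Coord n → ℝ) (z : Coord n) : ℝ :=
  fderiv ℝ f z (0, Pi.single i 1)

/-- The function `∂²Θ/∂yⁱ∂yʲ` on the domain of the coordinates. -/
def hessY (Θ : M → ℝ) (i j : Idx n) (q : M) : ℝ :=
  derivY i (derivY j (fun z ↦ Θ (φ.symm z))) (φ q)

/-- The symmetric tensor
`½ ∑ ω_ij (dyⁱ ⊗ dxʲ + dxʲ ⊗ dyⁱ) + ½ ∑ ∂²Θ/∂yⁱ∂yʲ (dxⁱ ⊗ dxʲ + dxʲ ⊗ dxⁱ)`. -/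
def normalMetric (Θ : M → ℝ) (q : M) :
    TangentSpace (𝓡 (4 * n)) q →L[ℝ] TangentSpace (𝓡 (4 * n)) q →L[ℝ] ℝ :=
  (1 / 2 : ℝ) • ∑ i, ∑ j, (omega n i j •
      ((dy φ i q).smulRight (dx φ j q) + (dx φ j q).smulRight (dy φ i q))
    + hessY φ Θ i j q •
      ((dx φ i q).smulRight (dx φ j q) + (dx φ j q).smulRight (dx φ i q)))

/-- The endomorphism `∑ dxⁱ ⊗ ∂/∂yⁱ`. -/
def normalEndo (q : M) : TangentSpace (𝓡 (4 * n)) q →L[ℝ] TangentSpace (𝓡 (4 * n)) q :=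
  ∑ i, (dx φ i q).smulRight (partialY φ i q)

end Manifold

end NullKahler

end

/-! The argument rests on the two-form `Ω = g (N ·, ·)`. It is skew because `N` is skew-adjoint,
closed because it is parallel for a torsion-free connection, and its kernel is `ker N`, which equals
`im N` because `N² = 0` and the rank is half of the dimension.

In suitable linear coordinates at a point the kernel becomes the second factor `y` of `ℝ²ⁿ × ℝ²ⁿ`,
and near the point it is a graph over that factor. Flowing along the kernel makes `Ω` the pullback
of a symplectic form in `x` (`exists_straightening`), and Moser's method makes that form equal to `σ
= ½ ω` (`exists_moser`, combined in `exists_darboux`). Constancy of `Ω` together with `∇Ω = 0` says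
that the `y`-directions are preserved by the connection (`christoffel_fst_eq_zero`).

This and the symmetry of the Christoffel symbols are integrability conditions in `y`. The mixed
block of `g`, read through `σ`, is the `y`-differential of a map `u (x, y)`; replacing `y` by `u`
puts `N` and the mixed block in normal form (`exists_fibre_coordinates`). The block of `g` on the
`x`-directions is then a `y`-Hessian: two applications of the Poincaré lemma in `y`, with `x` as a
parameter, give `Θ` (`exists_potential`).

For the converse the Levi-Civita connection is written down by Koszul's formula. Only third
derivatives of `Θ` along the fibres occur in the derivative of the metric, and their total symmetry
gives `∇N = 0` (`exists_christoffel`). The fibre directions form an isotropic subspace of half the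
dimension, which forces the signature.

Both flows come from the inverse function theorem on the Banach space of continuous curves
(`exists_flow`); their fields are arranged to vanish to second order at the base point, so that no
estimate on the time of existence is needed. -/

noncomputable section

namespace NullKahler

open Set Filter Topology

universe u

set_option linter.unusedSectionVars false

/-! ### Smooth calculus on spaces of continuous curves -/

section Superposition

variable {K : Type*} [TopologicalSpace K] [CompactSpace K]
  {E : Type u} [NormedAddCommGroup E] [NormedSpace ℝ E]
  {F : Type u} [NormedAddCommGroup F] [NormedSpace ℝ F]

/-- The superposition operator `γ ↦ f ∘ γ` on continuous maps. -/
def superpose (f : C(E, F)) (γ : C(K, E)) : C(K, F) := f.comp γ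

@[simp] lemma superpose_apply (f : C(E, F)) (γ : C(K, E)) (k : K) :
    superpose f γ k = f (γ k) := rfl

/-- Pointwise application of a continuous family of linear maps, as a bilinear map. -/
def pointwiseApply : C(K, E →L[ℝ] F) →L[ℝ] C(K, E) →L[ℝ] C(K, F) :=
  LinearMap.mkContinuous₂
    (LinearMap.mk₂ ℝ (fun (A : C(K, E →L[ℝ] F)) (δ : C(K, E)) ↦
        (⟨fun k ↦ A k (δ k), by fun_prop⟩ : C(K, F)))
      (by intros; ext; simp) (by intros; ext; simp) (by intros; ext; simp) (by intros; ext; simp))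
    1 (by
      intro A δ
      rw [one_mul, ContinuousMap.norm_le _ (by positivity)]
      intro k
      exact (A k).le_opNorm_of_le (δ.norm_coe_le_norm k) |>.trans
        (by gcongr; exact A.norm_coe_le_norm k))

@[simp] lemma pointwiseApply_apply (A : C(K, E →L[ℝ] F)) (δ : C(K, E)) (k : K) :
    pointwiseApply A δ k = A k (δ k) := rfl

/-- The mean value inequality at each point of `K` reduces differentiability to a bound on the
variation of `f'` near the image of `γ`, uniform over `K`. -/
lemma hasFDerivAt_superpose {f : C(E, F)} {f' : C(E, E →L[ℝ] F)}
    (hf : ∀ x, HasFDerivAt f (f' x) x) (γ : C(K, E)) :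
    HasFDerivAt (superpose f : C(K, E) → C(K, F)) (pointwiseApply (superpose f' γ)) γ := by
  rw [hasFDerivAt_iff_isLittleO, Asymptotics.isLittleO_iff]
  intro ε hε
  have hc : Continuous (superpose f' : C(K, E) → C(K, E →L[ℝ] F)) :=
    ContinuousMap.continuous_postcomp f'
  obtain ⟨r, hr, hball⟩ := Metric.continuousAt_iff.1 (hc.continuousAt (x := γ)) ε hε
  filter_upwards [Metric.ball_mem_nhds γ hr] with γ' hγ'
  rw [ContinuousMap.norm_le _ (by positivity)]
  intro k
  have hb : ∀ y ∈ Metric.ball (γ k) r, ‖f' y - f' (γ k)‖ ≤ ε := by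
    intro y hy
    -- Translating all of `γ` by a constant produces a nearby map with value `y` at `k`, so
    -- continuity of `superpose f'` at `γ` gives the uniform bound.
    have h1 : dist (γ + ContinuousMap.const K (y - γ k)) γ < r := by
      rw [dist_eq_norm, add_sub_cancel_left, ContinuousMap.norm_lt_iff _ hr]
      intro _
      simpa [dist_eq_norm] using hy
    have h2 := hball h1
    have h3 := (ContinuousMap.dist_apply_le_dist (f := superpose f' (γ + ContinuousMap.const K (y - γ k)))
      (g := superpose f' γ) k).trans_lt h2
    rw [dist_eq_norm] at h3
    simpa using h3.le
  have hk : γ' k ∈ Metric.ball (γ k) r :=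
    (ContinuousMap.dist_apply_le_dist (f := γ') (g := γ) k).trans_lt hγ'
  have := (convex_ball (γ k) r).norm_image_sub_le_of_norm_hasFDerivWithin_le'
    (fun x _ ↦ (hf x).hasFDerivWithinAt) hb (Metric.mem_ball_self hr) hk
  refine this.trans ?_
  gcongr
  exact (γ' - γ).norm_coe_le_norm k

/-- The derivative of a superposition operator is again one, for `f'`, followed by a fixed
continuous linear map; hence induction on the order, with the target space varying. -/
lemma contDiff_superpose {f : C(E, F)} (hf : ContDiff ℝ ∞ f) :
    ContDiff ℝ ∞ (superpose f : C(K, E) → C(K, F)) := by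
  rw [contDiff_infty]
  intro n
  induction n generalizing F with
  | zero =>
    exact contDiff_zero.2 (ContinuousMap.continuous_postcomp f)
  | succ n ih =>
    push_cast
    rw [contDiff_succ_iff_hasFDerivAt]
    let f' : C(E, E →L[ℝ] F) := ⟨fderiv ℝ f, hf.continuous_fderiv (by simp)⟩
    refine ⟨fun γ ↦ pointwiseApply (superpose f' γ), ?_, fun γ ↦
      hasFDerivAt_superpose (f' := f') (fun x ↦ (hf.differentiable (by simp) x).hasFDerivAt) γ⟩
    exact (pointwiseApply (K := K)).contDiff.comp
      (ih (f := f') (hf.fderiv_right (m := ∞) (by simp)))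

end Superposition

/-- Integration over the unit interval from `0` to `t`. -/
def primitive (F : Type*) [NormedAddCommGroup F] [NormedSpace ℝ F] :
    C(Icc (0 : ℝ) 1, F) →L[ℝ] C(Icc (0 : ℝ) 1, F) :=
  LinearMap.mkContinuous
    { toFun := fun γ ↦ ⟨fun t ↦ ∫ s in (0 : ℝ)..t, IccExtend zero_le_one γ s, by
        have : Continuous fun t : ℝ ↦ ∫ s in (0 : ℝ)..t, IccExtend zero_le_one γ s :=
          intervalIntegral.continuous_primitive
            (fun a b ↦ (γ.continuous.Icc_extend' (h := zero_le_one)).intervalIntegrable a b) 0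
        fun_prop⟩
      map_add' := fun γ δ ↦ by
        ext t
        exact intervalIntegral.integral_add
          ((γ.continuous.Icc_extend' (h := zero_le_one)).intervalIntegrable _ _)
          ((δ.continuous.Icc_extend' (h := zero_le_one)).intervalIntegrable _ _)
      map_smul' := fun c γ ↦ by
        ext t
        exact intervalIntegral.integral_smul c _ }
    1 (by
      intro γ
      rw [one_mul, ContinuousMap.norm_le _ (by positivity)]
      intro t
      refine (intervalIntegral.norm_integral_le_of_norm_le_const (C := ‖γ‖)
        (fun s _ ↦ γ.norm_coe_le_norm _)).trans ?_
      rw [sub_zero, abs_of_nonneg t.2.1]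
      exact mul_le_of_le_one_right (norm_nonneg _) t.2.2)

lemma primitive_apply {F : Type*} [NormedAddCommGroup F] [NormedSpace ℝ F]
    (γ : C(Icc (0 : ℝ) 1, F)) (t : Icc (0 : ℝ) 1) :
    primitive F γ t = ∫ s in (0 : ℝ)..t, IccExtend zero_le_one γ s := rfl

/-! ### Integrals depending smoothly on a parameter -/

section ParametricIntegral

variable {E : Type u} [NormedAddCommGroup E] [NormedSpace ℝ E]
  {F : Type u} [NormedAddCommGroup F] [NormedSpace ℝ F]

/-- The curve `s ↦ (s, x)` on the unit interval. -/
def timeGraph (E : Type*) [NormedAddCommGroup E] [NormedSpace ℝ E]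
    (γ : C(Icc (0 : ℝ) 1, E)) : C(Icc (0 : ℝ) 1, ℝ × E) :=
  ⟨fun s ↦ (s, γ s), by fun_prop⟩

lemma contDiff_timeGraph : ContDiff ℝ ∞ (timeGraph E) ∧
    ∀ γ, HasFDerivAt (timeGraph E)
      ((ContinuousLinearMap.inr ℝ ℝ E).compLeftContinuous ℝ (Icc (0 : ℝ) 1)) γ := by
  have h : timeGraph E = fun γ ↦ (ContinuousLinearMap.inr ℝ ℝ E).compLeftContinuous ℝ _ γ
      + (⟨fun s ↦ ((s : ℝ), (0 : E)), by fun_prop⟩ : C(Icc (0 : ℝ) 1, ℝ × E)) := by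
    funext γ
    ext s <;> simp [timeGraph]
  rw [h]
  exact ⟨(ContinuousLinearMap.contDiff _).add contDiff_const,
    fun γ ↦ (ContinuousLinearMap.hasFDerivAt _).add_const _⟩

/-- The integral is a composite: constant curve at `x`, graph over time, superposition with `f`,
primitive, evaluation at `1`. Each factor is smooth, and the chain rule gives differentiation under
the integral sign. -/
lemma contDiff_integral_unitInterval_and_fderiv {f : ℝ × E → F}
    (hf : ContDiff ℝ ∞ f) :
    ContDiff ℝ ∞ (fun x ↦ ∫ s in (0 : ℝ)..1, f (s, x)) ∧
    ∀ x a, fderiv ℝ (fun x ↦ ∫ s in (0 : ℝ)..1, f (s, x)) x a =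
      ∫ s in (0 : ℝ)..1, fderiv ℝ f (s, x) (0, a) := by
  let fc : C(ℝ × E, F) := ⟨f, hf.continuous⟩
  let fc' : C(ℝ × E, ℝ × E →L[ℝ] F) := ⟨fderiv ℝ f, hf.continuous_fderiv (by simp)⟩
  let ev : C(Icc (0 : ℝ) 1, F) →L[ℝ] F :=
    (ContinuousMap.evalCLM ℝ (⟨1, by simp⟩ : Icc (0 : ℝ) 1)).comp (primitive F)
  have key : (fun x ↦ ∫ s in (0 : ℝ)..1, f (s, x)) = fun x ↦ ev
      (superpose fc (timeGraph E (ContinuousLinearMap.const ℝ (Icc (0 : ℝ) 1) x))) := by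
    funext x
    rw [ContinuousLinearMap.comp_apply, ContinuousMap.evalCLM_apply, primitive_apply]
    refine intervalIntegral.integral_congr fun s hs ↦ ?_
    rw [uIcc_of_le zero_le_one] at hs
    rw [IccExtend_of_mem _ _ hs]
    rfl
  rw [key]
  refine ⟨ev.contDiff.comp ((contDiff_superpose hf).comp
      (contDiff_timeGraph.1.comp (ContinuousLinearMap.contDiff _))), fun x a ↦ ?_⟩
  have h2 := (contDiff_timeGraph.2 _).comp x
    ((ContinuousLinearMap.const (M := E) ℝ (Icc (0 : ℝ) 1)).hasFDerivAt)
  have h3 := ev.hasFDerivAt.comp x ((hasFDerivAt_superpose (f := fc) (f' := fc')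
    (fun x ↦ (hf.differentiable (by simp) x).hasFDerivAt) _).comp x h2)
  have h4 := congrArg (fun L ↦ L a) h3.fderiv
  refine h4.trans ?_
  simp only [ev, ContinuousLinearMap.comp_apply, ContinuousMap.evalCLM_apply, primitive_apply]
  refine intervalIntegral.integral_congr fun s hs ↦ ?_
  rw [uIcc_of_le zero_le_one] at hs
  rw [IccExtend_of_mem _ _ hs]
  simp [fc', timeGraph]

lemma contDiff_integral_unitInterval {f : ℝ × E → F}
    (hf : ContDiff ℝ ∞ f) : ContDiff ℝ ∞ (fun x ↦ ∫ s in (0 : ℝ)..1, f (s, x)) :=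
  (contDiff_integral_unitInterval_and_fderiv hf).1

lemma fderiv_integral_unitInterval {f : ℝ × E → F} (hf : ContDiff ℝ ∞ f)
    (x a : E) :
    fderiv ℝ (fun x ↦ ∫ s in (0 : ℝ)..1, f (s, x)) x a =
      ∫ s in (0 : ℝ)..1, fderiv ℝ f (s, x) (0, a) :=
  (contDiff_integral_unitInterval_and_fderiv hf).2 x a

end ParametricIntegral

/-- The inverse function theorem for maps which are smooth on an open set. -/
lemma exists_openPartialHomeomorph {B B' : Type*} [NormedAddCommGroup B] [NormedSpace ℝ B]
    [CompleteSpace B] [NormedAddCommGroup B'] [NormedSpace ℝ B'] {f : B → B'} {O : Set B}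
    (hO : IsOpen O) (hf : ContDiffOn ℝ ∞ f O) {x : B} (hx : x ∈ O)
    {f' : B ≃L[ℝ] B'} (hf' : HasFDerivAt f (f' : B →L[ℝ] B') x) :
    ∃ e : OpenPartialHomeomorph B B', x ∈ e.source ∧ e.source ⊆ O ∧ (∀ z, e z = f z) ∧
      ContDiffOn ℝ ∞ e.symm e.target := by
  have hfa : ∀ z ∈ O, ContDiffAt ℝ ∞ f z := fun z hz ↦ hf.contDiffAt (hO.mem_nhds hz)
  let e₀ := (hfa x hx).toOpenPartialHomeomorph f hf' (by simp)
  -- Invertibility of the derivative is imposed on the whole source, since the inverse must be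
  -- smooth on the whole target and not only at the image of `x`.
  let S : Set B := O ∩ fderiv ℝ f ⁻¹' range ((↑) : (B ≃L[ℝ] B') → B →L[ℝ] B')
  have hS : IsOpen S :=
    (hf.continuousOn_fderiv_of_isOpen hO (by simp)).isOpen_inter_preimage hO
      ContinuousLinearEquiv.isOpen
  refine ⟨e₀.restrOpen S hS, ?_, ?_, fun z ↦ rfl, ?_⟩
  · exact ⟨(hfa x hx).mem_toOpenPartialHomeomorph_source hf' (by simp), hx, f', hf'.fderiv.symm⟩
  · exact fun z hz ↦ hz.2.1
  · intro w hw
    have h1 := (e₀.restrOpen S hS).map_target hw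
    obtain ⟨h2, f₁, hf₁⟩ := h1.2
    refine ContDiffAt.contDiffWithinAt ?_
    refine (e₀.restrOpen S hS).contDiffAt_symm hw (f₀' := f₁) ?_ (hfa _ h2)
    rw [hf₁]
    exact ((hfa _ h2).differentiableAt (by simp)).hasFDerivAt

/-! ### Flows by the inverse function theorem on curves -/

section Flow

variable {E : Type u} [NormedAddCommGroup E] [NormedSpace ℝ E]

lemma hasDerivWithinAt_primitive [CompleteSpace E] (γ : C(Icc (0 : ℝ) 1, E)) {t : ℝ}
    (ht : t ∈ Icc (0 : ℝ) 1) :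
    HasDerivWithinAt (IccExtend zero_le_one (primitive E γ)) (γ ⟨t, ht⟩) (Icc 0 1) t := by
  have hc : Continuous (IccExtend zero_le_one γ) := γ.continuous.Icc_extend'
  have h1 : HasDerivAt (fun t : ℝ ↦ ∫ s in (0 : ℝ)..t, IccExtend zero_le_one γ s)
      (IccExtend zero_le_one γ t) t :=
    intervalIntegral.integral_hasDerivAt_right (hc.intervalIntegrable _ _)
      (hc.stronglyMeasurableAtFilter _ _) hc.continuousAt
  rw [IccExtend_of_mem _ _ ht] at h1
  refine h1.hasDerivWithinAt.congr (fun s hs ↦ ?_) ?_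
  · rw [IccExtend_of_mem _ _ hs, primitive_apply]
  · rw [IccExtend_of_mem _ _ ht, primitive_apply]

/-- Existence and smoothness of the flow of a time-dependent vector field near a point where the
field vanishes to second order, together with the equation of variations. -/
lemma exists_flow [CompleteSpace E] {V : ℝ × E → E} (hV : ContDiff ℝ ∞ V) {z₀ : E}
    (hV₀ : ∀ t ∈ Icc (0 : ℝ) 1, V (t, z₀) = 0)
    (hV₁ : ∀ t ∈ Icc (0 : ℝ) 1, ∀ a, fderiv ℝ V (t, z₀) (0, a) = 0) {W : Set E} (hW : W ∈ 𝓝 z₀) :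
    ∃ (U : Set E) (φ : ℝ → E → E), IsOpen U ∧ z₀ ∈ U ∧ (∀ t, ContDiffOn ℝ ∞ (φ t) U) ∧
      (∀ t, φ t z₀ = z₀) ∧ (∀ t, HasFDerivAt (φ t) (ContinuousLinearMap.id ℝ E) z₀) ∧
      ∀ z ∈ U, (∀ t, φ t z ∈ W) ∧ φ 0 z = z ∧
        (∀ t ∈ Icc (0 : ℝ) 1,
          HasDerivWithinAt (fun t ↦ φ t z) (V (t, φ t z)) (Icc 0 1) t) ∧
        ∀ a, fderiv ℝ (φ 0) z a = a ∧ ∀ t ∈ Icc (0 : ℝ) 1,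
          HasDerivWithinAt (fun t ↦ fderiv ℝ (φ t) z a)
            (fderiv ℝ V (t, φ t z) (0, fderiv ℝ (φ t) z a)) (Icc 0 1) t := by
  let I := Icc (0 : ℝ) 1
  let Vc : C(ℝ × E, E) := ⟨V, hV.continuous⟩
  let Vc' : C(ℝ × E, ℝ × E →L[ℝ] E) := ⟨fderiv ℝ V, hV.continuous_fderiv (by simp)⟩
  let c : E →L[ℝ] C(I, E) := ContinuousLinearMap.const ℝ I
  -- The integral curve starting at `z` is the solution of `H γ = c z`, the integral form of the
  -- differential equation.
  let H : C(I, E) → C(I, E) := fun γ ↦ γ - primitive E (superpose Vc (timeGraph E γ))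
  have hH : ContDiff ℝ ∞ H := contDiff_id.sub ((ContinuousLinearMap.contDiff _).comp
    ((contDiff_superpose hV).comp contDiff_timeGraph.1))
  let H' : C(I, E) → (C(I, E) →L[ℝ] C(I, E)) := fun γ ↦ ContinuousLinearMap.id ℝ _ -
    (primitive E).comp ((pointwiseApply (superpose Vc' (timeGraph E γ))).comp
      ((ContinuousLinearMap.inr ℝ ℝ E).compLeftContinuous ℝ I))
  have hH' : ∀ γ, HasFDerivAt H (H' γ) γ := fun γ ↦ (hasFDerivAt_id γ).sub
    ((primitive E).hasFDerivAt.comp γ ((hasFDerivAt_superpose (f := Vc) (f' := Vc')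
      (fun x ↦ (hV.differentiable (by simp) x).hasFDerivAt) _).comp γ (contDiff_timeGraph.2 γ)))
  have hc₀ : H (c z₀) = c z₀ := by
    have : superpose Vc (timeGraph E (c z₀)) = 0 := by
      ext t
      exact hV₀ t t.2
    simp only [H, this, map_zero, sub_zero]
  -- The spatial derivative of `V` vanishes along the constant curve, so the linearized integral
  -- operator drops out.
  have hc₁ : H' (c z₀) = ContinuousLinearMap.id ℝ _ := by
    have : (pointwiseApply (superpose Vc' (timeGraph E (c z₀)))).comp
      ((ContinuousLinearMap.inr ℝ ℝ E).compLeftContinuous ℝ I) = 0 := by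
      ext δ t
      exact hV₁ t t.2 (δ t)
    simp only [H', this, ContinuousLinearMap.comp_zero, sub_zero]
  have hid : HasFDerivAt H ((ContinuousLinearEquiv.refl ℝ C(I, E) : _ ≃L[ℝ] _) :
      C(I, E) →L[ℝ] C(I, E)) (c z₀) := by
    have := hH' (c z₀)
    rwa [hc₁] at this
  obtain ⟨W', hW'W, hW', hzW'⟩ := mem_nhds_iff.1 hW
  -- Curves with image in `W'` form an open set, because the interval is compact; restricting to
  -- them confines the flow to `W` at all times.
  obtain ⟨e, he₀, heO, hee, hes⟩ := exists_openPartialHomeomorph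
    (ContinuousMap.isOpen_setOfPred_mapsTo (Y := E) (isCompact_univ (X := I)) hW') hH.contDiffOn
    (x := c z₀) (fun _ _ ↦ hzW') hid
  have hez₀ : e.symm (c z₀) = c z₀ := by
    conv_lhs => rw [← hc₀, ← hee]
    exact e.left_inv he₀
  let γ : E → C(I, E) := fun z ↦ e.symm (c z)
  let U : Set E := c ⁻¹' e.target
  have hU : IsOpen U := e.open_target.preimage c.continuous
  have hzU : z₀ ∈ U := by
    have := e.map_source he₀
    rwa [hee, hc₀] at this
  have hγ : ContDiffOn ℝ ∞ γ U := hes.comp c.contDiff.contDiffOn (fun z hz ↦ hz)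
  have hγa : ∀ z ∈ U, HasFDerivAt γ (fderiv ℝ γ z) z := fun z hz ↦
    ((hγ.contDiffAt (hU.mem_nhds hz)).differentiableAt (by simp)).hasFDerivAt
  have hHγ : ∀ z ∈ U, H (γ z) = c z := fun z hz ↦ by
    rw [← hee]
    exact e.right_inv hz
  -- Differentiating `H (γ z) = c z` in `z` gives the integrated equation of variations.
  have hH'γ : ∀ z ∈ U, (H' (γ z)).comp (fderiv ℝ γ z) = c := fun z hz ↦ by
    have h1 := (hH' (γ z)).comp z (hγa z hz)
    refine h1.unique (c.hasFDerivAt.congr_of_eventuallyEq ?_)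
    filter_upwards [hU.mem_nhds hz] with w hw using hHγ w hw
  let π : ℝ → I := projIcc 0 1 zero_le_one
  let φ : ℝ → E → E := fun t z ↦ ContinuousMap.evalCLM ℝ (π t) (γ z)
  have hφ' : ∀ t, ∀ z ∈ U, HasFDerivAt (φ t)
      ((ContinuousMap.evalCLM ℝ (π t)).comp (fderiv ℝ γ z)) z :=
    fun t z hz ↦ (ContinuousLinearMap.hasFDerivAt _).comp z (hγa z hz)
  have hπ₀ : ((π 0 : I) : ℝ) = 0 := by simp [π]
  have hprim0 : ∀ δ : C(I, E), primitive E δ (π 0) = 0 := fun δ ↦ by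
    rw [primitive_apply, hπ₀, intervalIntegral.integral_same]
  have hsol : ∀ z ∈ U, γ z = c z + primitive E (superpose Vc (timeGraph E (γ z))) := fun z hz ↦ by
    rw [← hHγ z hz]
    simp [H]
  have hsol' : ∀ z ∈ U, ∀ a, fderiv ℝ γ z a = c a + primitive E (pointwiseApply
      (superpose Vc' (timeGraph E (γ z))) ((ContinuousLinearMap.inr ℝ ℝ E).compLeftContinuous ℝ I
        (fderiv ℝ γ z a))) := fun z hz a ↦ by
    have := congrArg (fun L ↦ L a) (hH'γ z hz)
    rw [← this]
    simp [H']
  have hconst : ∀ (a : E) (η : C(I, E)) (δ : C(I, E)), η = c a + primitive E δ →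
      η (π 0) = a ∧ ∀ t (ht : t ∈ I),
        HasDerivWithinAt (fun s ↦ η (π s)) (δ ⟨t, ht⟩) (Icc 0 1) t := by
    intro a η δ h
    constructor
    · rw [h, ContinuousMap.add_apply, hprim0, add_zero]
      rfl
    · intro t ht
      have := (hasDerivWithinAt_primitive δ ht).const_add a
      rw [h]
      exact this
  refine ⟨U, φ, hU, hzU, fun t ↦ (ContinuousLinearMap.contDiff _).comp_contDiffOn hγ,
    fun t ↦ ?_, fun t ↦ ?_, fun z hz ↦ ⟨fun t ↦ ?_, ?_, fun t ht ↦ ?_, fun a ↦ ⟨?_, fun t ht ↦ ?_⟩⟩⟩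
  · simp only [φ, γ, hez₀]
    rfl
  · have h1 := hH'γ z₀ hzU
    have h2 : γ z₀ = c z₀ := hez₀
    rw [h2, hc₁, ContinuousLinearMap.id_comp] at h1
    have h3 := hφ' t z₀ hzU
    rw [h1] at h3
    exact h3
  · exact hW'W (heO (e.map_target hz) (mem_univ (π t)))
  · exact (hconst z _ _ (hsol z hz)).1
  · have := (hconst z _ _ (hsol z hz)).2 t ht
    have hπ : π t = ⟨t, ht⟩ := projIcc_of_mem _ ht
    have hv : V (t, φ t z) = superpose Vc (timeGraph E (γ z)) ⟨t, ht⟩ := by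
      change V (t, γ z (π t)) = V (t, γ z ⟨t, ht⟩)
      rw [hπ]
    rw [hv]
    exact this
  · rw [(hφ' 0 z hz).fderiv]
    exact (hconst a _ _ (hsol' z hz a)).1
  · have := (hconst a _ _ (hsol' z hz a)).2 t ht
    have hπ : π t = ⟨t, ht⟩ := projIcc_of_mem _ ht
    have hfun : (fun t ↦ fderiv ℝ (φ t) z a) = fun s ↦ (fderiv ℝ γ z a) (π s) :=
      funext fun s ↦ by
        rw [(hφ' s z hz).fderiv]
        rfl
    have hv : fderiv ℝ V (t, φ t z) (0, fderiv ℝ (φ t) z a) =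
        fderiv ℝ V (t, γ z ⟨t, ht⟩) (0, fderiv ℝ γ z a ⟨t, ht⟩) := by
      rw [(hφ' t z hz).fderiv]
      change fderiv ℝ V (t, γ z (π t)) (0, fderiv ℝ γ z a (π t)) = _
      rw [hπ]
    rw [hfun, hv]
    exact this

end Flow

/-- A function which is smooth near a point agrees near this point with a smooth function. -/
lemma exists_contDiff_eventuallyEq {E F : Type*} [NormedAddCommGroup E] [NormedSpace ℝ E]
    [FiniteDimensional ℝ E] [NormedAddCommGroup F] [NormedSpace ℝ F] {f : E → F} {O : Set E}
    (hO : IsOpen O) (hf : ContDiffOn ℝ ∞ f O) {x : E} (hx : x ∈ O) :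
    ∃ f₁ : E → F, ContDiff ℝ ∞ f₁ ∧ f₁ =ᶠ[𝓝 x] f := by
  obtain ⟨r, hr, hball⟩ := Metric.isOpen_iff.1 hO x hx
  let χ : ContDiffBump x := ⟨r / 3, r / 2, by positivity, by linarith⟩
  refine ⟨fun z ↦ χ z • f z, ?_, ?_⟩
  · rw [contDiff_iff_contDiffAt]
    intro z
    by_cases hz : z ∈ Metric.ball x r
    · exact χ.contDiff.contDiffAt.smul (hf.contDiffAt (hO.mem_nhds (hball hz)))
    · have : z ∈ (tsupport χ)ᶜ := by
        rw [χ.tsupport_eq]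
        intro h
        have h1 : dist z x ≤ r / 2 := h
        exact hz (by rw [Metric.mem_ball]; linarith)
      refine contDiffAt_const (c := (0 : F)) |>.congr_of_eventuallyEq ?_
      filter_upwards [(isClosed_tsupport χ).isOpen_compl.mem_nhds this] with w hw
      rw [image_eq_zero_of_notMem_tsupport hw, zero_smul]
  · filter_upwards [χ.eventuallyEq_one] with z hz
    simp [hz]

/-! ### The Poincaré lemma along the fibres -/

section

variable {X Y W : Type u} [NormedAddCommGroup X] [NormedSpace ℝ X]
  [NormedAddCommGroup Y] [NormedSpace ℝ Y] [NormedAddCommGroup W] [NormedSpace ℝ W]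

lemma norm_prod_smul_le (x : X) (y : Y) {t : ℝ} (ht : t ∈ Icc (0 : ℝ) 1) :
    ‖(x, t • y)‖ ≤ ‖(x, y)‖ := by
  rw [Prod.norm_mk, Prod.norm_mk, norm_smul, Real.norm_of_nonneg ht.1]
  exact max_le_max le_rfl (mul_le_of_le_one_left (norm_nonneg _) ht.2)

lemma contDiff_apply_ray {B : X × Y → Y →L[ℝ] W} (hB : ContDiff ℝ ∞ B) :
    ContDiff ℝ ∞ (fun p : ℝ × (X × Y) ↦ B (p.2.1, p.1 • p.2.2) p.2.2) := by
  have : ContDiff ℝ ∞ fun p : ℝ × (X × Y) ↦ B (p.2.1, p.1 • p.2.2) :=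
    hB.comp (by fun_prop)
  exact this.clm_apply (by fun_prop)

lemma fderiv_apply_ray {B : X × Y → Y →L[ℝ] W} (hB : ContDiff ℝ ∞ B) (s : ℝ) (z a : X × Y) :
    fderiv ℝ (fun p : ℝ × (X × Y) ↦ B (p.2.1, p.1 • p.2.2) p.2.2) (s, z) (0, a) =
      fderiv ℝ B (z.1, s • z.2) (a.1, s • a.2) z.2 + B (z.1, s • z.2) a.2 := by
  have hd : Differentiable ℝ B := hB.differentiable (by simp)
  have h1 : HasFDerivAt (fun p : ℝ × (X × Y) ↦ p.2.2)
      ((ContinuousLinearMap.snd ℝ X Y).comp (ContinuousLinearMap.snd ℝ ℝ (X × Y))) (s, z) :=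
    ((ContinuousLinearMap.snd ℝ X Y).comp
      (ContinuousLinearMap.snd ℝ ℝ (X × Y))).hasFDerivAt
  have h2 : HasFDerivAt (fun p : ℝ × (X × Y) ↦ p.2.1)
      ((ContinuousLinearMap.fst ℝ X Y).comp (ContinuousLinearMap.snd ℝ ℝ (X × Y))) (s, z) :=
    ((ContinuousLinearMap.fst ℝ X Y).comp
      (ContinuousLinearMap.snd ℝ ℝ (X × Y))).hasFDerivAt
  have h3 := (h2.prodMk (hasFDerivAt_fst.smul h1))
  have h4 := ((hd (z.1, s • z.2)).hasFDerivAt.comp (s, z) h3).clm_apply h1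
  have := congrArg (fun L ↦ L (0, a)) h4.fderiv
  refine this.trans ?_
  simp [add_comm]

/-- This total derivative is the integrand of the homotopy formula once the symmetry of the
derivative of `B` has been used; integrating it leaves the boundary term `B z b`. -/
lemma hasDerivAt_smul_apply_ray {B : X × Y → Y →L[ℝ] W} (hB : ContDiff ℝ ∞ B) (z : X × Y) (b : Y)
    (s : ℝ) : HasDerivAt (fun s : ℝ ↦ s • B (z.1, s • z.2) b)
        (s • fderiv ℝ B (z.1, s • z.2) (0, z.2) b + B (z.1, s • z.2) b) s := by
  have h1 : HasDerivAt (fun s : ℝ ↦ ((z.1, s • z.2) : X × Y)) (0, z.2) s := by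
    have := (hasDerivAt_const s z.1).prodMk ((hasDerivAt_id' s).smul_const z.2)
    rwa [one_smul] at this
  have h2 : HasDerivAt (fun s : ℝ ↦ B (z.1, s • z.2) b)
      (fderiv ℝ B (z.1, s • z.2) (0, z.2) b) s := by
    have h3 := (hB.differentiable (by simp) (z.1, s • z.2)).hasFDerivAt.comp_hasDerivAt s h1
    exact (ContinuousLinearMap.apply ℝ W b).hasFDerivAt.comp_hasDerivAt s h3
  have h4 := (hasDerivAt_id' s).smul h2
  rwa [one_smul] at h4

/-- The Poincaré lemma for one-forms in the variable `y`, depending on a parameter `x`. -/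
lemma exists_primitive_of_symmetric [FiniteDimensional ℝ X] [FiniteDimensional ℝ Y]
    [CompleteSpace W] {B : X × Y → Y →L[ℝ] W} {O : Set (X × Y)} (hO : IsOpen O)
    (h0 : (0 : X × Y) ∈ O) (hB : ContDiffOn ℝ ∞ B O)
    (hsymm : ∀ z ∈ O, ∀ b b', fderiv ℝ B z (0, b) b' = fderiv ℝ B z (0, b') b) :
    ∃ u : X × Y → W, ContDiff ℝ ∞ u ∧ (∀ x, u (x, 0) = 0) ∧
      ∀ᶠ z in 𝓝 0, ∀ b, fderiv ℝ u z (0, b) = B z b := by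
  obtain ⟨B₁, hB₁, hev⟩ := exists_contDiff_eventuallyEq hO hB h0
  obtain ⟨r, hr, hball⟩ := Metric.eventually_nhds_iff_ball.1
    ((hev.eventuallyEq_nhds.and hev).and (hO.mem_nhds h0))
  -- The primitive is the integral of the one-form along the ray from `(x, 0)` to `(x, y)`. The
  -- globally smooth `B₁` replaces `B`, with which it agrees near the origin.
  let f : ℝ × (X × Y) → W := fun p ↦ B₁ (p.2.1, p.1 • p.2.2) p.2.2
  have hf : ContDiff ℝ ∞ f := contDiff_apply_ray hB₁
  refine ⟨fun z ↦ ∫ s in (0 : ℝ)..1, f (s, z), contDiff_integral_unitInterval hf, fun x ↦ ?_, ?_⟩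
  · simp [f]
  · filter_upwards [Metric.ball_mem_nhds 0 hr] with z hz b
    rw [fderiv_integral_unitInterval hf]
    have hmem : ∀ s ∈ Icc (0 : ℝ) 1, ((z.1, s • z.2) : X × Y) ∈ Metric.ball 0 r := fun s hs ↦ by
      rw [mem_ball_zero_iff] at hz ⊢
      exact (norm_prod_smul_le z.1 z.2 hs).trans_lt hz
    have hcongr : ∀ s ∈ uIcc (0 : ℝ) 1, fderiv ℝ f (s, z) (0, (0, b)) =
        s • fderiv ℝ B₁ (z.1, s • z.2) (0, z.2) b + B₁ (z.1, s • z.2) b := by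
      intro s hs
      rw [uIcc_of_le zero_le_one] at hs
      obtain ⟨⟨he, -⟩, hzO⟩ := hball _ (hmem s hs)
      have h5 := hsymm _ hzO b z.2
      rw [← he.fderiv_eq] at h5
      have h6 : ((0, s • b) : X × Y) = s • (0, b) := by simp
      rw [fderiv_apply_ray hB₁, h6, map_smul, _root_.smul_apply, h5]
    rw [intervalIntegral.integral_congr hcongr,
      intervalIntegral.integral_eq_sub_of_hasDerivAt (fun s _ ↦ hasDerivAt_smul_apply_ray hB₁ z b s)]
    · simp [(hball z hz).1.2]
    · refine ContinuousOn.intervalIntegrable ?_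
      refine ContinuousOn.congr (f := fun s ↦ fderiv ℝ f (s, z) (0, (0, b))) ?_
        fun s hs ↦ (hcongr s hs).symm
      have := hf.continuous_fderiv (by simp)
      fun_prop

end

/-! ### Differentiating bilinear forms along curves -/

section

variable {Z : Type*} [NormedAddCommGroup Z] [NormedSpace ℝ Z]

/-- The fderiv of a family of bilinear forms, evaluated. -/
lemma hasFDerivAt_bilin_apply {Ω : Z → Z →L[ℝ] Z →L[ℝ] ℝ} {z : Z}
    (hΩ : DifferentiableAt ℝ Ω z) (a b : Z) :
    HasFDerivAt (fun z ↦ Ω z a b) (((fderiv ℝ Ω z).flip a).flip b) z := by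
  have h := (hΩ.hasFDerivAt.clm_apply (hasFDerivAt_const a z)).clm_apply (hasFDerivAt_const b z)
  refine h.congr_fderiv ?_
  ext w
  simp

lemma hasDerivWithinAt_bilin {P : Type*} [NormedAddCommGroup P] [NormedSpace ℝ P]
    {Ω : P → Z →L[ℝ] Z →L[ℝ] ℝ} {c : ℝ → P} {c' : P} {δ ε : ℝ → Z} {δ' ε' : Z} {S : Set ℝ} {t : ℝ}
    (hΩ : DifferentiableAt ℝ Ω (c t)) (hc : HasDerivWithinAt c c' S t)
    (hδ : HasDerivWithinAt δ δ' S t) (hε : HasDerivWithinAt ε ε' S t) :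
    HasDerivWithinAt (fun t ↦ Ω (c t) (δ t) (ε t))
      (fderiv ℝ Ω (c t) c' (δ t) (ε t) + Ω (c t) δ' (ε t) + Ω (c t) (δ t) ε') S t := by
  have h1 := HasFDerivAt.comp_hasDerivWithinAt (l := Ω) t hΩ.hasFDerivAt hc
  have h2 := (h1.clm_apply hδ).clm_apply hε
  simp only [Function.comp_apply, _root_.add_apply] at h2
  exact h2

lemma fderiv_bilin_skew {Ω : Z → Z →L[ℝ] Z →L[ℝ] ℝ} {O : Set Z} (hO : IsOpen O)
    (hΩ : ContDiffOn ℝ ∞ Ω O) (halt : ∀ z ∈ O, ∀ a b, Ω z a b = -Ω z b a)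
    {z : Z} (hz : z ∈ O) (w a b : Z) : fderiv ℝ Ω z w a b = -fderiv ℝ Ω z w b a := by
  have hd : DifferentiableAt ℝ Ω z := (hΩ.contDiffAt (hO.mem_nhds hz)).differentiableAt (by simp)
  have h1 := hasFDerivAt_bilin_apply hd a b
  have h2 := (hasFDerivAt_bilin_apply hd b a).neg
  have h3 : (fun z ↦ Ω z a b) =ᶠ[𝓝 z] -fun z ↦ Ω z b a := by
    filter_upwards [hO.mem_nhds hz] with y hy using halt y hy a b
  have := congrArg (fun L ↦ L w) (h1.unique (h2.congr_of_eventuallyEq h3))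
  simpa using this

lemma eq_of_hasDerivWithinAt_zero {e : ℝ → ℝ}
    (he : ∀ t ∈ Icc (0 : ℝ) 1, HasDerivWithinAt e 0 (Icc 0 1) t) : e 1 = e 0 := by
  refine constant_of_derivWithin_zero (fun t ht ↦ (he t ht).differentiableWithinAt)
    (fun t ht ↦ ?_) 1 (by simp)
  have ht' : t ∈ Icc (0 : ℝ) 1 := ⟨ht.1, ht.2.le⟩
  exact (he t ht').derivWithin (uniqueDiffOn_Icc zero_lt_one t ht')

end

/-! ### Straightening the kernel of a closed two-form -/

section

variable {X Y : Type u} [NormedAddCommGroup X] [NormedSpace ℝ X] [FiniteDimensional ℝ X]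
  [NormedAddCommGroup Y] [NormedSpace ℝ Y] [FiniteDimensional ℝ Y]

/-- A closed two-form whose kernel contains the graph of `F` over the second factor is, up to a
diffeomorphism, the pullback of a two-form on the first factor. -/
lemma exists_straightening {Ω : X × Y → X × Y →L[ℝ] X × Y →L[ℝ] ℝ} {F : X × Y → Y →L[ℝ] X}
    {O : Set (X × Y)} (hO : IsOpen O) (h0 : (0 : X × Y) ∈ O) (hΩ : ContDiffOn ℝ ∞ Ω O)
    (halt : ∀ z ∈ O, ∀ a b, Ω z a b = -Ω z b a)
    (hclosed : ∀ z ∈ O, ∀ a b c,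
      fderiv ℝ Ω z a b c + fderiv ℝ Ω z b c a + fderiv ℝ Ω z c a b = 0)
    (hF : ContDiffOn ℝ ∞ F O) (hF0 : F 0 = 0) (hker : ∀ z ∈ O, ∀ b v, Ω z (F z b, b) v = 0) :
    ∃ (U : Set (X × Y)) (f : X × Y → X × Y), IsOpen U ∧ 0 ∈ U ∧ ContDiffOn ℝ ∞ f U ∧ f 0 = 0 ∧
      HasFDerivAt f (ContinuousLinearMap.id ℝ (X × Y)) 0 ∧ ∀ z ∈ U, f z ∈ O ∧ (z.1, 0) ∈ O ∧
        ∀ a b, Ω (f z) (fderiv ℝ f z a) (fderiv ℝ f z b) = Ω (z.1, 0) (a.1, 0) (b.1, 0) := by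
  obtain ⟨F₁, hF₁, hev⟩ := exists_contDiff_eventuallyEq hO hF h0
  obtain ⟨r, hr, hball⟩ := Metric.eventually_nhds_iff_ball.1 (hev.and (hO.mem_nhds h0))
  have hd : Differentiable ℝ F₁ := hF₁.differentiable (by simp)
  -- The kernel is followed along the ray `t • y`. Scaling the fibre variable by time keeps `y`
  -- fixed under the flow, and `F 0 = 0` together with the factor `y` makes the field vanish to
  -- second order at the origin.
  let V : ℝ × (X × Y) → X × Y := fun p ↦ (F₁ (p.2.1, p.1 • p.2.2) p.2.2, 0)
  have hV : ContDiff ℝ ∞ V :=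
    (contDiff_apply_ray hF₁).prodMk contDiff_const
  have hV' : ∀ (s : ℝ) (z : X × Y) (a : X × Y), fderiv ℝ V (s, z) (0, a) =
      (fderiv ℝ F₁ (z.1, s • z.2) (a.1, s • a.2) z.2 + F₁ (z.1, s • z.2) a.2, 0) := by
    intro s z a
    have h1 := (((contDiff_apply_ray hF₁).differentiable (by simp) (s, z)).hasFDerivAt).prodMk
      (hasFDerivAt_const (0 : Y) (s, z))
    have h2 := congrArg (fun L ↦ L (0, a)) h1.fderiv
    refine h2.trans ?_
    rw [ContinuousLinearMap.prod_apply, fderiv_apply_ray hF₁]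
    rfl
  have hF₁0 : F₁ 0 = 0 := hev.self_of_nhds.trans hF0
  obtain ⟨U, φ, hU, h0U, hφ, hφ0, hφ0', hflow⟩ := exists_flow hV (z₀ := 0)
    (fun t _ ↦ by simp [V])
    (fun t _ a ↦ by
      rw [hV']
      have : ((0 : X × Y).1, t • (0 : X × Y).2) = 0 := by simp
      rw [this, hF₁0]
      simp) (Metric.ball_mem_nhds 0 hr)
  refine ⟨U, φ 1, hU, h0U, hφ 1, hφ0 1, hφ0' 1, fun z hz ↦ ?_⟩
  obtain ⟨hW, hz0, hdt, hvar⟩ := hflow z hz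
  refine ⟨(hball _ (hW 1)).2, ?_, fun a b ↦ ?_⟩
  · refine (hball _ ?_).2
    have h1 := hW 0
    rw [hz0, mem_ball_zero_iff] at h1
    rw [mem_ball_zero_iff]
    simpa using (norm_prod_smul_le z.1 z.2 (t := 0) (by simp)).trans_lt h1
  -- the second components of the flow and of its differential do not depend on time
  have hconst : ∀ (η : ℝ → X × Y) (v : ℝ → X), (∀ t ∈ Icc (0 : ℝ) 1,
      HasDerivWithinAt η (v t, 0) (Icc 0 1) t) → ∀ t ∈ Icc (0 : ℝ) 1, (η t).2 = (η 0).2 := by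
    intro η v h t ht
    have h2 : ∀ t ∈ Icc (0 : ℝ) 1, HasDerivWithinAt (fun t ↦ (η t).2) 0 (Icc 0 1) t :=
      fun t ht ↦ (ContinuousLinearMap.snd ℝ X Y).hasFDerivAt.comp_hasDerivWithinAt t (h t ht)
    exact constant_of_derivWithin_zero (fun t ht ↦ (h2 t ht).differentiableWithinAt)
      (fun t ht ↦ (h2 t ⟨ht.1, ht.2.le⟩).derivWithin
        (uniqueDiffOn_Icc zero_lt_one t ⟨ht.1, ht.2.le⟩)) t ht
  have hz2 : ∀ t ∈ Icc (0 : ℝ) 1, (φ t z).2 = z.2 := fun t ht ↦ by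
    rw [hconst _ _ hdt t ht, hz0]
  have ha2 : ∀ a, ∀ t ∈ Icc (0 : ℝ) 1, (fderiv ℝ (φ t) z a).2 = a.2 := fun a t ht ↦ by
    have := hconst (fun t ↦ fderiv ℝ (φ t) z a) _
      (fun t ht ↦ by
        have := (hvar a).2 t ht
        rwa [hV'] at this) t ht
    rw [this, (hvar a).1]
  -- The curve `c` is tangent to the kernel and joins `(z.1, 0)` to `φ 1 z`; `δ a` is its variation
  -- when the starting point moves along `a`.
  let c : ℝ → X × Y := fun t ↦ ((φ t z).1, t • z.2)
  let δ : X × Y → ℝ → X × Y := fun a t ↦ ((fderiv ℝ (φ t) z a).1, t • a.2)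
  have hcball : ∀ t ∈ Icc (0 : ℝ) 1, c t ∈ Metric.ball 0 r := fun t ht ↦ by
    have h1 := hW t
    rw [mem_ball_zero_iff] at h1 ⊢
    refine lt_of_le_of_lt ?_ h1
    have := norm_prod_smul_le (φ t z).1 (φ t z).2 ht
    rw [hz2 t ht] at this
    refine this.trans_eq ?_
    rw [← hz2 t ht]
  have hsmul : ∀ (y : Y) (t : ℝ), HasDerivWithinAt (fun t : ℝ ↦ t • y) y (Icc 0 1) t :=
    fun y t ↦ by simpa using ((hasDerivAt_id t).smul_const y).hasDerivWithinAt
  have hc : ∀ t ∈ Icc (0 : ℝ) 1, HasDerivWithinAt c (F₁ (c t) z.2, z.2) (Icc 0 1) t := by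
    intro t ht
    have h1 := (ContinuousLinearMap.fst ℝ X Y).hasFDerivAt.comp_hasDerivWithinAt t (hdt t ht)
    refine (h1.prodMk (hsmul z.2 t)).congr_deriv ?_
    simp [V, c, hz2 t ht]
  have hδ : ∀ a, ∀ t ∈ Icc (0 : ℝ) 1, HasDerivWithinAt (δ a)
      (fderiv ℝ F₁ (c t) (δ a t) z.2 + F₁ (c t) a.2, a.2) (Icc 0 1) t := by
    intro a t ht
    have h1 := (ContinuousLinearMap.fst ℝ X Y).hasFDerivAt.comp_hasDerivWithinAt t
      ((hvar a).2 t ht)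
    refine (h1.prodMk (hsmul a.2 t)).congr_deriv ?_
    simp [hV', c, δ, hz2 t ht, ha2 a t ht]
  -- differentiating the kernel condition
  have hΩd : ∀ z ∈ O, DifferentiableAt ℝ Ω z := fun z hz ↦
    (hΩ.contDiffAt (hO.mem_nhds hz)).differentiableAt (by simp)
  have hker₁ : ∀ z ∈ Metric.ball (0 : X × Y) r, ∀ b v, Ω z (F₁ z b, b) v = 0 := fun z hz b v ↦ by
    rw [(hball z hz).1]
    exact hker z (hball z hz).2 b v
  have hdker : ∀ z ∈ Metric.ball (0 : X × Y) r, ∀ w b v,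
      fderiv ℝ Ω z w (F₁ z b, b) v + Ω z (fderiv ℝ F₁ z w b, 0) v = 0 := by
    intro z hz w b v
    have h1 := ((hΩd z (hball z hz).2).hasFDerivAt.clm_apply
      (((hd z).hasFDerivAt.clm_apply (hasFDerivAt_const b z)).prodMk
        (hasFDerivAt_const b z))).clm_apply (hasFDerivAt_const v z)
    have h2 : (fun z ↦ Ω z (F₁ z b, b) v) =ᶠ[𝓝 z] fun _ ↦ 0 := by
      filter_upwards [Metric.isOpen_ball.mem_nhds hz] with y hy using hker₁ y hy b v
    have := congrArg (fun L ↦ L w) (h1.unique ((hasFDerivAt_const 0 z).congr_of_eventuallyEq h2))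
    simpa [add_comm] using this
  -- Cartan's formula in disguise: closedness trades the derivative of `Ω` along `c'` for
  -- derivatives along the two variations, and these cancel against the differentiated kernel
  -- condition.
  have hmain : ∀ t ∈ Icc (0 : ℝ) 1,
      HasDerivWithinAt (fun t ↦ Ω (c t) (δ a t) (δ b t)) 0 (Icc 0 1) t := by
    intro t ht
    have hcO := (hball _ (hcball t ht)).2
    refine (hasDerivWithinAt_bilin (hΩd _ hcO) (hc t ht) (hδ a t ht) (hδ b t ht)).congr_deriv ?_
    have split : ∀ a, ((fderiv ℝ F₁ (c t) (δ a t) z.2 + F₁ (c t) a.2, a.2) : X × Y) =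
        (fderiv ℝ F₁ (c t) (δ a t) z.2, 0) + (F₁ (c t) a.2, a.2) := fun a ↦ by simp
    have e1 := hdker _ (hcball t ht) (δ a t) z.2 (δ b t)
    have e2 := hdker _ (hcball t ht) (δ b t) z.2 (δ a t)
    have e3 := hclosed _ hcO (F₁ (c t) z.2, z.2) (δ a t) (δ b t)
    have e4 := fderiv_bilin_skew hO hΩ halt hcO (δ a t) (F₁ (c t) z.2, z.2) (δ b t)
    have e5 := halt _ hcO (δ a t) ((fderiv ℝ F₁ (c t) (δ b t) z.2, 0) + (F₁ (c t) b.2, b.2))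
    have e6 := hker₁ _ (hcball t ht) a.2 (δ b t)
    have e7 := hker₁ _ (hcball t ht) b.2 (δ a t)
    rw [split a, split b, e5]
    simp only [map_add, _root_.add_apply]
    linarith
  have := eq_of_hasDerivWithinAt_zero hmain
  have hone : ∀ a, δ a 1 = fderiv ℝ (φ 1) z a := fun a ↦
    Prod.ext rfl (by simp [δ, ha2 a 1 (by simp)])
  have hc1 : c 1 = φ 1 z := Prod.ext rfl (by simp [c, hz2 1 (by simp)])
  have hzero : ∀ a, δ a 0 = (a.1, 0) := fun a ↦ by simp [δ, (hvar a).1]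
  have hc0 : c 0 = (z.1, 0) := by simp [c, hz0]
  simpa only [hone, hc1, hzero, hc0] using this

end

/-! ### The Poincaré lemma for two-forms and Moser's method -/

section

variable {X : Type u} [NormedAddCommGroup X] [NormedSpace ℝ X] [FiniteDimensional ℝ X]

/-- The square of `s` comes from scaling both arguments of the two-form under the contraction to the
origin; integrating this derivative over the unit interval recovers `Δ x a b`. -/
lemma hasDerivAt_sq_smul_ray {Δ : X → X →L[ℝ] X →L[ℝ] ℝ} (hΔ : ContDiff ℝ ∞ Δ) (x a b : X)
    (s : ℝ) : HasDerivAt (fun s : ℝ ↦ s ^ 2 * Δ (s • x) a b)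
      (2 * s * Δ (s • x) a b + s ^ 2 * fderiv ℝ Δ (s • x) x a b) s := by
  have h1 : HasDerivAt (fun s : ℝ ↦ s • x) x s := by
    simpa using (hasDerivAt_id' s).smul_const x
  have h2 : HasDerivAt (fun s : ℝ ↦ Δ (s • x) a b)
      (((fderiv ℝ Δ (s • x)).flip a).flip b x) s :=
    HasFDerivAt.comp_hasDerivAt (l := fun z ↦ Δ z a b) s
      (hasFDerivAt_bilin_apply (hΔ.differentiable (by simp) (s • x)) a b) h1
  have h3 : HasDerivAt (fun s : ℝ ↦ s ^ 2) (2 * s) s := by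
    simpa using hasDerivAt_pow 2 s
  exact h3.mul h2

lemma hasFDerivAt_const_add_smul {G : Type*} [NormedAddCommGroup G] [NormedSpace ℝ G] (c : G)
    {Δ : X → G} (hΔ : Differentiable ℝ Δ) (p : ℝ × X) :
    HasFDerivAt (fun p : ℝ × X ↦ c + p.1 • Δ p.2)
      (p.1 • (fderiv ℝ Δ p.2).comp (ContinuousLinearMap.snd ℝ ℝ X) +
        (ContinuousLinearMap.fst ℝ ℝ X).smulRight (Δ p.2)) p :=
  ((hasFDerivAt_fst (p := p)).smul (HasFDerivAt.comp (g := Δ) p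
      (hΔ p.2).hasFDerivAt hasFDerivAt_snd)).const_add _

lemma contDiff_radial {Δ : X → X →L[ℝ] X →L[ℝ] ℝ} (hΔ : ContDiff ℝ ∞ Δ) :
    ContDiff ℝ ∞ fun p : ℝ × X ↦ p.1 • Δ (p.1 • p.2) p.2 := by
  have : ContDiff ℝ ∞ fun p : ℝ × X ↦ Δ (p.1 • p.2) := hΔ.comp (by fun_prop)
  exact contDiff_fst.smul (this.clm_apply contDiff_snd)

lemma fderiv_radial {Δ : X → X →L[ℝ] X →L[ℝ] ℝ} (hΔ : ContDiff ℝ ∞ Δ) (s : ℝ) (x a b : X) :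
    fderiv ℝ (fun p : ℝ × X ↦ p.1 • Δ (p.1 • p.2) p.2) (s, x) (0, a) b =
      s ^ 2 * fderiv ℝ Δ (s • x) a x b + s * Δ (s • x) a b := by
  have h1 : HasFDerivAt (fun p : ℝ × X ↦ p.1 • p.2) _ (s, x) :=
    (hasFDerivAt_fst (𝕜 := ℝ) (p := (s, x))).smul (hasFDerivAt_snd (p := (s, x)))
  have h2 := HasFDerivAt.comp (g := Δ) (s, x)
    (hΔ.differentiable (by simp) ((s, x).1 • (s, x).2)).hasFDerivAt h1
  have h3 := h2.clm_apply (hasFDerivAt_snd (p := (s, x)))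
  have h4 := (hasFDerivAt_fst (p := (s, x))).smul h3
  have h5 := congrArg (fun L ↦ L (0, a) b) h4.fderiv
  refine h5.trans ?_
  simp
  ring

/-- The Poincaré lemma for two-forms. -/
lemma exists_primitive_of_closed {Δ : X → X →L[ℝ] X →L[ℝ] ℝ} (hΔ : ContDiff ℝ ∞ Δ)
    (hΔ0 : Δ 0 = 0) {r : ℝ}
    (hskew : ∀ x ∈ Metric.ball (0 : X) r, ∀ w a b, fderiv ℝ Δ x w a b = -fderiv ℝ Δ x w b a)
    (halt : ∀ x ∈ Metric.ball (0 : X) r, ∀ a b, Δ x a b = -Δ x b a)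
    (hclosed : ∀ x ∈ Metric.ball (0 : X) r, ∀ a b c,
      fderiv ℝ Δ x a b c + fderiv ℝ Δ x b c a + fderiv ℝ Δ x c a b = 0) :
    ∃ α : X → X →L[ℝ] ℝ, ContDiff ℝ ∞ α ∧ α 0 = 0 ∧ fderiv ℝ α 0 = 0 ∧
      ∀ x ∈ Metric.ball (0 : X) r, ∀ a b, fderiv ℝ α x a b - fderiv ℝ α x b a = Δ x a b := by
  -- The radial homotopy operator. Since `Δ 0 = 0`, the resulting `α` vanishes to second order, as
  -- the flow lemma will require.
  let f : ℝ × X → X →L[ℝ] ℝ := fun p ↦ p.1 • Δ (p.1 • p.2) p.2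
  have hf : ContDiff ℝ ∞ f := contDiff_radial hΔ
  have hcont : ∀ x a, Continuous fun s : ℝ ↦ fderiv ℝ f (s, x) (0, a) := fun x a ↦ by
    have := hf.continuous_fderiv (by simp)
    fun_prop
  have hval : ∀ x a b, fderiv ℝ (fun x ↦ ∫ s in (0 : ℝ)..1, f (s, x)) x a b =
      ∫ s in (0 : ℝ)..1, fderiv ℝ f (s, x) (0, a) b := by
    intro x a b
    rw [fderiv_integral_unitInterval hf, ContinuousLinearMap.intervalIntegral_apply]
    exact (hcont x a).intervalIntegrable _ _
  refine ⟨fun x ↦ ∫ s in (0 : ℝ)..1, f (s, x), contDiff_integral_unitInterval hf, ?_, ?_, ?_⟩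
  · simp [f]
  · ext a b
    rw [hval]
    have : ∀ s : ℝ, fderiv ℝ f (s, 0) (0, a) b = 0 := fun s ↦ by
      rw [fderiv_radial hΔ]
      simp [hΔ0]
    simp [this]
  · intro x hx a b
    have hmem : ∀ s ∈ Icc (0 : ℝ) 1, s • x ∈ Metric.ball (0 : X) r := fun s hs ↦ by
      rw [mem_ball_zero_iff] at hx ⊢
      rw [norm_smul, Real.norm_of_nonneg hs.1]
      exact (mul_le_of_le_one_left (norm_nonneg _) hs.2).trans_lt hx
    have hc : ∀ a b, IntervalIntegrable (fun s ↦ fderiv ℝ f (s, x) (0, a) b)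
        MeasureTheory.volume 0 1 := fun a b ↦
      ((hcont x a).clm_apply continuous_const).intervalIntegrable _ _
    rw [hval, hval, ← intervalIntegral.integral_sub (hc a b) (hc b a)]
    -- Closedness turns the antisymmetrized derivatives into the derivative along `x`.
    have hcongr : ∀ s ∈ uIcc (0 : ℝ) 1,
        fderiv ℝ f (s, x) (0, a) b - fderiv ℝ f (s, x) (0, b) a =
          2 * s * Δ (s • x) a b + s ^ 2 * fderiv ℝ Δ (s • x) x a b := by
      intro s hs
      rw [uIcc_of_le zero_le_one] at hs
      rw [fderiv_radial hΔ, fderiv_radial hΔ, halt _ (hmem s hs) b a]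
      have e1 := hclosed _ (hmem s hs) x a b
      have e2 := hskew _ (hmem s hs) a b x
      linear_combination s ^ 2 * e2 - s ^ 2 * e1
    rw [intervalIntegral.integral_congr hcongr,
      intervalIntegral.integral_eq_sub_of_hasDerivAt
        (fun s _ ↦ hasDerivAt_sq_smul_ray hΔ x a b s)]
    · simp
    · exact ((hc a b).sub (hc b a)).congr fun s hs ↦ hcongr s (uIoc_subset_uIcc hs)

/-- A bundled inverse of continuous endomorphisms, smooth everywhere and correct near `1`. -/
lemma exists_smooth_inverse (X : Type u) [NormedAddCommGroup X] [NormedSpace ℝ X]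
    [FiniteDimensional ℝ X] : ∃ inv : (X →L[ℝ] X) → (X →L[ℝ] X), ContDiff ℝ ∞ inv ∧
      ∀ᶠ A in 𝓝 1, ∀ v, A (inv A v) = v ∧ inv A (A v) = v := by
  -- Inversion is cut off to a globally smooth map because `exists_flow` takes a vector field smooth
  -- on the whole space.
  obtain ⟨inv, hinv, hev⟩ := exists_contDiff_eventuallyEq (E := X →L[ℝ] X)
    (f := Ring.inverse) (O := {A | IsUnit A}) Units.isOpen
    (fun A hA ↦ by
      obtain ⟨u, rfl⟩ := hA
      exact (contDiffAt_ringInverse ℝ u).contDiffWithinAt) (x := 1) isUnit_one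
  refine ⟨inv, hinv, ?_⟩
  filter_upwards [hev, Units.isOpen.mem_nhds (isUnit_one (M := X →L[ℝ] X))] with A hA hu v
  rw [hA, ← mul_apply_eq_comp, ← mul_apply_eq_comp,
    Ring.mul_inverse_cancel _ hu, Ring.inverse_mul_cancel _ hu]
  exact ⟨rfl, rfl⟩

set_option maxHeartbeats 1000000 in
/-- Darboux's theorem in Moser's form: a symplectic form is, up to a diffeomorphism, constant near
a point. -/
lemma exists_moser {Ω : X → X →L[ℝ] X →L[ℝ] ℝ} {O : Set X} (hO : IsOpen O) (h0 : (0 : X) ∈ O)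
    (hΩ : ContDiffOn ℝ ∞ Ω O) (halt : ∀ z ∈ O, ∀ a b, Ω z a b = -Ω z b a)
    (hclosed : ∀ z ∈ O, ∀ a b c,
      fderiv ℝ Ω z a b c + fderiv ℝ Ω z b c a + fderiv ℝ Ω z c a b = 0)
    (hnd : ∀ v, (∀ w, Ω 0 v w = 0) → v = 0) :
    ∃ (U : Set X) (f : X → X), IsOpen U ∧ 0 ∈ U ∧ ContDiffOn ℝ ∞ f U ∧ f 0 = 0 ∧
      HasFDerivAt f (ContinuousLinearMap.id ℝ X) 0 ∧ ∀ z ∈ U, f z ∈ O ∧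
        ∀ a b, Ω (f z) (fderiv ℝ f z a) (fderiv ℝ f z b) = Ω 0 a b := by
  obtain ⟨Ω₁, hΩ₁, hev⟩ := exists_contDiff_eventuallyEq hO hΩ h0
  obtain ⟨r, hr, hball⟩ := Metric.eventually_nhds_iff_ball.1
    ((hev.eventuallyEq_nhds.and hev).and (hO.mem_nhds h0))
  have hval : ∀ x ∈ Metric.ball (0 : X) r, Ω₁ x = Ω x := fun x hx ↦ (hball x hx).1.2
  have hΩ₁0 : Ω₁ 0 = Ω 0 := hval 0 (Metric.mem_ball_self hr)
  let Δ : X → X →L[ℝ] X →L[ℝ] ℝ := fun x ↦ Ω₁ x - Ω₁ 0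
  have hΔ : ContDiff ℝ ∞ Δ := hΩ₁.sub contDiff_const
  have hΔ' : ∀ x ∈ Metric.ball (0 : X) r, fderiv ℝ Δ x = fderiv ℝ Ω x := fun x hx ↦ by
    have : fderiv ℝ Δ x = fderiv ℝ Ω₁ x :=
      ((hΩ₁.differentiable (by simp) x).hasFDerivAt.sub_const (Ω₁ 0)).fderiv
    rw [this]
    exact (hball x hx).1.1.fderiv_eq
  have hskew : ∀ x ∈ Metric.ball (0 : X) r, ∀ w a b, fderiv ℝ Δ x w a b = -fderiv ℝ Δ x w b a :=
    fun x hx w a b ↦ by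
      rw [hΔ' x hx]
      exact fderiv_bilin_skew hO hΩ halt (hball x hx).2 w a b
  have hΔclosed : ∀ x ∈ Metric.ball (0 : X) r, ∀ a b c,
      fderiv ℝ Δ x a b c + fderiv ℝ Δ x b c a + fderiv ℝ Δ x c a b = 0 := fun x hx ↦ by
    rw [hΔ' x hx]
    exact hclosed x (hball x hx).2
  obtain ⟨α, hα, hα0, hα0', hdα⟩ := exists_primitive_of_closed hΔ (by ext; simp [Δ]) hskew
    (fun x hx a b ↦ by
      simp only [Δ, _root_.sub_apply]
      rw [hval x hx, hΩ₁0, halt x (hball x hx).2 a b, halt 0 h0 a b]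
      ring) hΔclosed
  -- the musical isomorphism of the form at the origin
  have hinj : Function.Injective (Ω 0) := by
    rw [injective_iff_map_eq_zero]
    exact fun v hv ↦ hnd v fun w ↦ by rw [hv]; rfl
  have hfin : Module.finrank ℝ X = Module.finrank ℝ (X →L[ℝ] ℝ) := by
    rw [← (LinearMap.toContinuousLinearMap (𝕜 := ℝ) (E := X) (F' := ℝ)).finrank_eq]
    exact (Subspace.dual_finrank_eq (K := ℝ) (V := X)).symm
  let J : X ≃L[ℝ] (X →L[ℝ] ℝ) :=
    (LinearEquiv.ofInjectiveOfFinrankEq (Ω 0).toLinearMap hinj hfin).toContinuousLinearEquiv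
  have hJ : ∀ v, J v = Ω 0 v := fun v ↦ rfl
  have hJs : ∀ ξ v, Ω 0 (J.symm ξ) v = ξ v := fun ξ v ↦ by rw [← hJ, J.apply_symm_apply]
  obtain ⟨inv, hinv, hinv1⟩ := exists_smooth_inverse X
  obtain ⟨ε, hε, hinvball⟩ := Metric.eventually_nhds_iff_ball.1 hinv1
  -- Under `J`, the interpolating form `Ω 0 + t Δ` becomes `1 + t S`, which is close to `1` near the
  -- origin for every `t` in the unit interval because `S 0 = 0`.
  let S : X → X →L[ℝ] X := fun x ↦ (J.symm : (X →L[ℝ] ℝ) →L[ℝ] X).comp (Δ x)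
  have hS : ContDiff ℝ ∞ S := contDiff_const.clm_comp hΔ
  let β : X → X := fun x ↦ J.symm (α x)
  have hβ : ContDiff ℝ ∞ β := J.symm.contDiff.comp hα
  have hβ0 : β 0 = 0 := by simp [β, hα0]
  have hβ0' : HasFDerivAt β (0 : X →L[ℝ] X) 0 := by
    have := (hα.differentiable (by simp) 0).hasFDerivAt
    rw [hα0'] at this
    have h := (J.symm : (X →L[ℝ] ℝ) →L[ℝ] X).hasFDerivAt.comp 0 this
    rwa [ContinuousLinearMap.comp_zero] at h
  -- Moser's field, determined by contracting with the interpolating form to get `-α`. It vanishes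
  -- to second order at the origin because `α` does.
  let V : ℝ × X → X := fun p ↦ -inv (1 + p.1 • S p.2) (β p.2)
  have hA : ContDiff ℝ ∞ fun p : ℝ × X ↦ inv (1 + p.1 • S p.2) :=
    hinv.comp (contDiff_const.add (contDiff_fst.smul (hS.comp contDiff_snd)))
  have hV : ContDiff ℝ ∞ V := (hA.clm_apply (hβ.comp contDiff_snd)).neg
  have hW : Metric.ball (0 : X) r ∩ S ⁻¹' Metric.ball 0 ε ∈ 𝓝 0 := by
    refine inter_mem (Metric.ball_mem_nhds 0 hr) (hS.continuous.continuousAt.preimage_mem_nhds ?_)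
    have : S 0 = 0 := by simp [S, Δ]
    rw [this]
    exact Metric.ball_mem_nhds 0 hε
  have hcontract : ∀ t ∈ Icc (0 : ℝ) 1, ∀ x ∈ S ⁻¹' Metric.ball 0 ε, ∀ v,
      Ω₁ 0 (V (t, x)) v + t * Δ x (V (t, x)) v = -α x v := by
    intro t ht x hx v
    have h1 : (1 : X →L[ℝ] X) + t • S x ∈ Metric.ball 1 ε := by
      rw [mem_ball_iff_norm, add_sub_cancel_left, norm_smul, Real.norm_of_nonneg ht.1]
      have : ‖S x‖ < ε := by simpa using hx
      exact (mul_le_of_le_one_left (norm_nonneg _) ht.2).trans_lt this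
    have h2 := (hinvball _ h1 (β x)).1
    have h3 : (1 + t • S x) (V (t, x)) = -β x := by
      simp only [V, map_neg, h2]
    have h4 := congrArg (fun u ↦ J u v) h3
    simp only [_root_.add_apply, _root_.smul_apply, one_apply_eq_self, map_add, map_smul, S, β,
      ContinuousLinearMap.comp_apply, ContinuousLinearEquiv.coe_coe, map_neg,
      _root_.neg_apply, smul_eq_mul, hJ, hJs] at h4
    rw [hΩ₁0]
    exact h4
  obtain ⟨U, φ, hU, h0U, hφ, hφ0, hφ0', hflow⟩ := exists_flow hV (z₀ := 0)
    (fun t _ ↦ by simp [V, hβ0])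
    (fun t _ a ↦ by
      have h1 := ((hA.differentiable (by simp) (t, 0)).hasFDerivAt.clm_apply
        (HasFDerivAt.comp (g := β) (t, (0 : X)) hβ0' hasFDerivAt_snd)).neg
      have := congrArg (fun L ↦ L (0, a)) h1.fderiv
      refine this.trans ?_
      simp [hβ0]) hW
  refine ⟨U, φ 1, hU, h0U, hφ 1, hφ0 1, hφ0' 1, fun z hz ↦ ?_⟩
  obtain ⟨hmem, hz0, hdt, hvar⟩ := hflow z hz
  refine ⟨(hball _ (hmem 1).1).2, fun a b ↦ ?_⟩
  let Ωt : ℝ × X → X →L[ℝ] X →L[ℝ] ℝ := fun p ↦ Ω₁ 0 + p.1 • Δ p.2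
  have hΩt : ∀ p, HasFDerivAt Ωt (p.1 • (fderiv ℝ Δ p.2).comp (ContinuousLinearMap.snd ℝ ℝ X) +
      (ContinuousLinearMap.fst ℝ ℝ X).smulRight (Δ p.2)) p := fun p ↦
    hasFDerivAt_const_add_smul _ (hΔ.differentiable (by simp)) p
  -- The contraction identity `hcontract` differentiated in the direction `w`, via the line `s ↦ x +
  -- s • w`.
  have hdcontract : ∀ t ∈ Icc (0 : ℝ) 1, ∀ x ∈ S ⁻¹' Metric.ball 0 ε, ∀ w v,
      t * fderiv ℝ Δ x w (V (t, x)) v + Ωt (t, x) (fderiv ℝ V (t, x) (0, w)) v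
        = -fderiv ℝ α x w v := by
    intro t ht x hx w v
    have hline : HasDerivAt (fun s : ℝ ↦ x + s • w) w 0 := by
      simpa using ((hasDerivAt_id (0 : ℝ)).smul_const w).const_add x
    have hx0 : x + (0 : ℝ) • w = x := by simp
    have hp : HasDerivAt (fun s : ℝ ↦ (t, x + s • w)) ((0 : ℝ), w) 0 :=
      (hasDerivAt_const _ _).prodMk hline
    have h1 : HasDerivAt (fun s : ℝ ↦ V (t, x + s • w)) (fderiv ℝ V (t, x) (0, w)) 0 := by
      have := HasFDerivAt.comp_hasDerivAt (l := V) (0 : ℝ)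
        (hV.differentiable (by simp) (t, x + (0 : ℝ) • w)).hasFDerivAt hp
      rw [hx0] at this
      exact this
    have h2 := hasDerivWithinAt_bilin (Ω := Ωt) (c := fun s : ℝ ↦ (t, x + s • w)) (t := 0)
      (hΩt _).differentiableAt (hp.hasDerivWithinAt (s := univ)) (h1.hasDerivWithinAt)
      (hasDerivWithinAt_const (0 : ℝ) univ v)
    rw [hasDerivWithinAt_univ] at h2
    have h3 : HasDerivAt (fun s : ℝ ↦ -α (x + s • w) v) (-fderiv ℝ α x w v) 0 := by
      have h4 := HasFDerivAt.comp_hasDerivAt (l := α) (0 : ℝ)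
        (hα.differentiable (by simp) (x + (0 : ℝ) • w)).hasFDerivAt hline
      rw [hx0] at h4
      exact ((ContinuousLinearMap.apply ℝ ℝ v).hasFDerivAt.comp_hasDerivAt (0 : ℝ) h4).neg
    have h5 : (fun s : ℝ ↦ Ωt (t, x + s • w) (V (t, x + s • w)) v) =ᶠ[𝓝 0]
        fun s ↦ -α (x + s • w) v := by
      have hopen : IsOpen (S ⁻¹' Metric.ball 0 ε) := Metric.isOpen_ball.preimage hS.continuous
      have : ∀ᶠ s in 𝓝 (0 : ℝ), x + s • w ∈ S ⁻¹' Metric.ball 0 ε :=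
        hline.continuousAt.eventually (by
          change S ⁻¹' Metric.ball 0 ε ∈ 𝓝 (x + (0 : ℝ) • w)
          rw [hx0]
          exact hopen.mem_nhds hx)
      filter_upwards [this] with s hs
      exact hcontract t ht _ hs v
    have h6 := (h3.congr_of_eventuallyEq h5).unique h2
    rw [h6]
    simp [(hΩt _).fderiv]
  -- The explicit time derivative contributes `Δ = dα` and transport by the flow contributes `-dα`,
  -- so the pulled-back form is constant in time.
  have hmain : ∀ t ∈ Icc (0 : ℝ) 1, HasDerivWithinAt (fun t ↦ Ωt (t, φ t z)
      (fderiv ℝ (φ t) z a) (fderiv ℝ (φ t) z b)) 0 (Icc 0 1) t := by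
    intro t ht
    have hp : HasDerivWithinAt (fun t ↦ (t, φ t z)) (1, V (t, φ t z)) (Icc 0 1) t :=
      (hasDerivWithinAt_id t _).prodMk (hdt t ht)
    refine (hasDerivWithinAt_bilin (Ω := Ωt) (hΩt _).differentiableAt hp ((hvar a).2 t ht)
      ((hvar b).2 t ht)).congr_deriv ?_
    have hxr := (hmem t).1
    have hxε := (hmem t).2
    have hΔalt : ∀ a b, Δ (φ t z) a b = -Δ (φ t z) b a := fun a b ↦ by
      simp only [Δ, _root_.sub_apply]
      rw [hval _ hxr, hΩ₁0, halt _ (hball _ hxr).2 a b, halt 0 h0 a b]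
      ring
    have hΩalt : ∀ a b, Ωt (t, φ t z) a b = -Ωt (t, φ t z) b a := fun a b ↦ by
      simp only [Ωt, _root_.add_apply, _root_.smul_apply, smul_eq_mul]
      rw [hΔalt a b, hΩ₁0, halt 0 h0 a b]
      ring
    set da := fderiv ℝ (φ t) z a
    set db := fderiv ℝ (φ t) z b
    have e1 := hdcontract t ht _ hxε da db
    have e2 := hdcontract t ht _ hxε db da
    have e3 := hΔclosed _ hxr (V (t, φ t z)) da db
    have e4 := hskew _ hxr da (V (t, φ t z)) db
    have e5 := hdα _ hxr da db
    rw [hΩalt da]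
    simp only [(hΩt _).fderiv, _root_.add_apply, _root_.smul_apply,
      ContinuousLinearMap.comp_apply, ContinuousLinearMap.coe_snd',
      ContinuousLinearMap.smulRight_apply, ContinuousLinearMap.coe_fst', one_smul, smul_eq_mul]
    linear_combination e1 - e2 + t * e3 - t * e4 - e5
  have h1 := eq_of_hasDerivWithinAt_zero hmain
  have h2 : Ωt (1, φ 1 z) = Ω (φ 1 z) := by
    rw [← hval _ (hmem 1).1]
    ext a b
    simp [Ωt, Δ]
  have h3 : Ωt (0, φ 0 z) = Ω 0 := by
    ext a b
    simp [Ωt, hΩ₁0]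
  rw [h2, h3, (hvar a).1, (hvar b).1] at h1
  exact h1

end

/-! ### Null-Kähler structures on open sets of a vector space -/

/-- The bundled data of a null-Kähler structure on an open subset of a vector space: the metric `G`,
the endomorphism `N`, and at every point the Christoffel symbols of a torsion-free connection
for which `G` and the two-form `G (N ·, ·)` are parallel. -/
structure LocalNullKahler {Z : Type*} [NormedAddCommGroup Z] [NormedSpace ℝ Z]
    (G : Z → Z →L[ℝ] Z →L[ℝ] ℝ) (N : Z → Z →L[ℝ] Z) (O : Set Z) : Prop where
  isOpen : IsOpen O
  smooth_metric : ContDiffOn ℝ ∞ G O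
  smooth_form : ContDiffOn ℝ ∞ (fun z ↦ (G z).comp (N z)) O
  symm : ∀ z ∈ O, ∀ v w, G z v w = G z w v
  nondegenerate : ∀ z ∈ O, ∀ v, (∀ w, G z v w = 0) → v = 0
  sq_zero : ∀ z ∈ O, ∀ v, N z (N z v) = 0
  skew : ∀ z ∈ O, ∀ v w, G z v (N z w) + G z (N z v) w = 0
  christoffel : ∀ z ∈ O, ∃ Γ : Z → Z → Z, (∀ v w, Γ v w = Γ w v) ∧
    (∀ v w u, fderiv ℝ G z v w u = G z (Γ v w) u + G z w (Γ v u)) ∧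
    ∀ v w u, fderiv ℝ (fun z ↦ (G z).comp (N z)) z v w u =
      G z (N z (Γ v w)) u + G z (N z w) (Γ v u)

/-- The musical isomorphism of a nondegenerate bilinear form. -/
def musical {Z : Type*} [NormedAddCommGroup Z] [NormedSpace ℝ Z] [FiniteDimensional ℝ Z]
    (b : Z →L[ℝ] Z →L[ℝ] ℝ) (hb : ∀ v, (∀ w, b v w = 0) → v = 0) : Z ≃L[ℝ] (Z →L[ℝ] ℝ) :=
  (LinearEquiv.ofInjectiveOfFinrankEq b.toLinearMap
    ((injective_iff_map_eq_zero _).2 fun v hv ↦ hb v fun w ↦ congrArg (fun L ↦ L w) hv)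
    ((Subspace.dual_finrank_eq (K := ℝ) (V := Z)).symm.trans
      (LinearMap.toContinuousLinearMap (𝕜 := ℝ) (E := Z) (F' := ℝ)).finrank_eq)).toContinuousLinearEquiv

section

variable {Z : Type*} [NormedAddCommGroup Z] [NormedSpace ℝ Z] [FiniteDimensional ℝ Z]
  (b : Z →L[ℝ] Z →L[ℝ] ℝ) (hb : ∀ v, (∀ w, b v w = 0) → v = 0)

lemma musical_coe : (musical b hb : Z →L[ℝ] Z →L[ℝ] ℝ) = b := rfl

lemma apply_musical_symm (ξ : Z →L[ℝ] ℝ) : b ((musical b hb).symm ξ) = ξ :=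
  (musical b hb).apply_symm_apply ξ

end

section

variable {Z E F : Type*} [NormedAddCommGroup Z] [NormedSpace ℝ Z] [NormedAddCommGroup E]
  [NormedSpace ℝ E] [NormedAddCommGroup F] [NormedSpace ℝ F]

lemma contDiffOn_clm_image (L : E →L[ℝ] F) {f : Z → E} {O : Set Z} (hf : ContDiffOn ℝ ∞ f O) :
    ContDiffOn ℝ ∞ (fun z ↦ L (f z)) O :=
  L.contDiff.comp_contDiffOn hf

lemma fderiv_clm_image (L : E →L[ℝ] F) {f : Z → E} {z : Z} (hf : DifferentiableAt ℝ f z) (v : Z) :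
    fderiv ℝ (fun z ↦ L (f z)) z v = L (fderiv ℝ f z v) := by
  have := L.hasFDerivAt.comp z hf.hasFDerivAt
  rw [HasFDerivAt.fderiv (f := fun z ↦ L (f z)) this]
  rfl

/-- The pullback of bilinear forms by a pair of linear maps. -/
def pullbackBilin [FiniteDimensional ℝ Z] [FiniteDimensional ℝ E] (i j : E →L[ℝ] Z) :
    (Z →L[ℝ] Z →L[ℝ] ℝ) →L[ℝ] (E →L[ℝ] E →L[ℝ] ℝ) :=
  LinearMap.toContinuousLinearMap (𝕜 := ℝ) (E := Z →L[ℝ] Z →L[ℝ] ℝ) (F' := E →L[ℝ] E →L[ℝ] ℝ)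
    { toFun := fun b ↦ b.bilinearComp i j
      map_add' := fun _ _ ↦ rfl
      map_smul' := fun _ _ ↦ rfl }

end

namespace LocalNullKahler

section

variable {Z : Type*} [NormedAddCommGroup Z] [NormedSpace ℝ Z]
  {G : Z → Z →L[ℝ] Z →L[ℝ] ℝ} {N : Z → Z →L[ℝ] Z} {O : Set Z} (h : LocalNullKahler G N O)

include h

lemma form_skew {z : Z} (hz : z ∈ O) (v w : Z) : G z (N z v) w = -G z (N z w) v := by
  have h1 := h.skew z hz v w
  rw [h.symm z hz v] at h1
  linarith

/-- A parallel skew form is closed for a torsion-free connection: in the cyclic sum the Christoffel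
terms cancel in pairs by the symmetry of `Γ`. -/
lemma form_closed {z : Z} (hz : z ∈ O) (a b c : Z) :
    fderiv ℝ (fun z ↦ (G z).comp (N z)) z a b c + fderiv ℝ (fun z ↦ (G z).comp (N z)) z b c a +
      fderiv ℝ (fun z ↦ (G z).comp (N z)) z c a b = 0 := by
  obtain ⟨Γ, hΓ, -, hd⟩ := h.christoffel z hz
  rw [hd, hd, hd, h.form_skew hz b, h.form_skew hz c, h.form_skew hz a, hΓ b a, hΓ c a, hΓ c b]
  ring

/-- `N` is recovered from the form by inverting `G`, and inversion is smooth at invertible maps. -/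
lemma smooth_endo [FiniteDimensional ℝ Z] : ContDiffOn ℝ ∞ N O := by
  have key : ∀ z ∈ O, N z = ((G z).inverse).comp ((G z).comp (N z)) := by
    intro z hz
    ext v
    simp only [ContinuousLinearMap.comp_apply]
    rw [← musical_coe (G z) (h.nondegenerate z hz), ContinuousLinearMap.inverse_equiv]
    exact ((musical (G z) (h.nondegenerate z hz)).symm_apply_apply _).symm
  refine ContDiffOn.congr ?_ key
  refine ContDiffOn.clm_comp ?_ h.smooth_form
  intro z hz
  have h1 := (contDiffAt_map_inverse (n := ∞) (musical (G z) (h.nondegenerate z hz)))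
  rw [musical_coe] at h1
  exact h1.comp_contDiffWithinAt z (h.smooth_metric z hz)

end

section

variable {X : Type} [NormedAddCommGroup X] [NormedSpace ℝ X] [FiniteDimensional ℝ X]
  {G : X × X → X × X →L[ℝ] X × X →L[ℝ] ℝ} {N : X × X → X × X →L[ℝ] X × X} {O : Set (X × X)}
  {σ : X →L[ℝ] X →L[ℝ] ℝ}

/-- Near a point, the kernel of the two-form is the graph of a smooth family of linear maps. -/
lemma exists_kernel_graph (h : LocalNullKahler G N O) (h0 : (0 : X × X) ∈ O)
    (hN0 : ∀ v, N 0 v = (0, v.1)) :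
    ∃ (O' : Set (X × X)) (F : X × X → X →L[ℝ] X), IsOpen O' ∧ 0 ∈ O' ∧ O' ⊆ O ∧
      ContDiffOn ℝ ∞ F O' ∧ F 0 = 0 ∧ ∀ z ∈ O', ∀ b v, G z (N z (F z b, b)) v = 0 := by
  obtain ⟨inv, hinv, hev⟩ := exists_smooth_inverse X
  let i : X →L[ℝ] X × X := ContinuousLinearMap.inl ℝ X X
  -- `A` and `B` are the two components of `N` on the first factor. The image of this factor is the
  -- graph of `A ∘ B⁻¹` over the second one, and `N² = 0` puts it in the kernel.
  let A : X × X → X →L[ℝ] X := fun z ↦ (ContinuousLinearMap.fst ℝ X X).comp ((N z).comp i)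
  let B : X × X → X →L[ℝ] X := fun z ↦ (ContinuousLinearMap.snd ℝ X X).comp ((N z).comp i)
  have hN := h.smooth_endo
  have hA : ContDiffOn ℝ ∞ A O := contDiffOn_const.clm_comp (hN.clm_comp contDiffOn_const)
  have hB : ContDiffOn ℝ ∞ B O := contDiffOn_const.clm_comp (hN.clm_comp contDiffOn_const)
  have hA0 : A 0 = 0 := by
    ext v
    simp [A, hN0]
  have hB0 : B 0 = 1 := by
    ext v
    simp [B, hN0, i]
  have hBc : ContinuousAt B 0 := hB.continuousOn.continuousAt (h.isOpen.mem_nhds h0)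
  have hgood : ∀ᶠ z in 𝓝 0, z ∈ O ∧ ∀ v, B z (inv (B z) v) = v := by
    have hOn : ∀ᶠ z in 𝓝 0, z ∈ O := h.isOpen.mem_nhds h0
    refine hOn.and ?_
    have := hBc.eventually (by rw [hB0]; exact hev)
    filter_upwards [this] with z hz v using (hz v).1
  obtain ⟨O', hsub, hO', h0'⟩ := eventually_nhds_iff.1 hgood
  refine ⟨O', fun z ↦ (A z).comp (inv (B z)), hO', h0', fun z hz ↦ (hsub z hz).1, ?_, ?_, ?_⟩
  · have hsub' : O' ⊆ O := fun z hz ↦ (hsub z hz).1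
    exact (hA.mono hsub').clm_comp (hinv.comp_contDiffOn (hB.mono hsub'))
  · simp [hA0]
  · intro z hz b v
    have h1 : ((A z).comp (inv (B z)) b, b) = N z (inv (B z) b, 0) := by
      refine Prod.ext rfl ?_
      exact ((hsub z hz).2 b).symm
    rw [h1, h.sq_zero z (hsub z hz).1]
    simp

/-- There are local coordinates in which the two-form of a null-Kähler structure is the pullback
of a constant symplectic form on the first factor. -/
lemma exists_darboux (h : LocalNullKahler G N O) (h0 : (0 : X × X) ∈ O)
    (hσ : ∀ v, (∀ w, σ v w = 0) → v = 0) (hN0 : ∀ v, N 0 v = (0, v.1))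
    (hG0 : ∀ b v, G 0 (0, b) v = σ b v.1) :
    ∃ (U : Set (X × X)) (f : X × X → X × X), IsOpen U ∧ 0 ∈ U ∧ ContDiffOn ℝ ∞ f U ∧ f 0 = 0 ∧
      HasFDerivAt f (ContinuousLinearMap.id ℝ (X × X)) 0 ∧ ∀ z ∈ U, f z ∈ O ∧
        ∀ a b, G (f z) (N (f z) (fderiv ℝ f z a)) (fderiv ℝ f z b) = σ a.1 b.1 := by
  obtain ⟨O', F, hO', h0', hsub, hF, hF0, hker⟩ := h.exists_kernel_graph h0 hN0
  let Ω : X × X → X × X →L[ℝ] X × X →L[ℝ] ℝ := fun z ↦ (G z).comp (N z)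
  have hΩ : ContDiffOn ℝ ∞ Ω O' := h.smooth_form.mono hsub
  obtain ⟨U₁, f₁, hU₁, h0U₁, hf₁, hf₁0, hf₁0', hf₁U⟩ := exists_straightening (Ω := Ω) hO' h0' hΩ
    (fun z hz ↦ h.form_skew (hsub hz)) (fun z hz ↦ h.form_closed (hsub hz)) hF hF0 hker
  let i : X →L[ℝ] X × X := ContinuousLinearMap.inl ℝ X X
  -- The form restricted to the slice `y = 0`. After straightening the whole form is its pullback,
  -- and it is nondegenerate at the origin because `τ 0 = σ`.
  let τ : X → X →L[ℝ] X →L[ℝ] ℝ := fun x ↦ pullbackBilin i i (Ω (i x))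
  have hO'' : IsOpen (i ⁻¹' O') := hO'.preimage i.continuous
  have hτs : ContDiffOn ℝ ∞ τ (i ⁻¹' O') :=
    contDiffOn_clm_image _ (hΩ.comp i.contDiff.contDiffOn (fun _ hx ↦ hx))
  have hτd : ∀ x ∈ i ⁻¹' O', ∀ a b c,
      fderiv ℝ τ x a b c = fderiv ℝ Ω (x, 0) (a, 0) (b, 0) (c, 0) := by
    intro x hx a b c
    have h1 : HasFDerivAt Ω (fderiv ℝ Ω (i x)) (i x) :=
      ((hΩ.contDiffAt (hO'.mem_nhds hx)).differentiableAt (by simp)).hasFDerivAt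
    have h2 := HasFDerivAt.comp (g := Ω) x h1 i.hasFDerivAt
    have h3 := fderiv_clm_image (F := X →L[ℝ] X →L[ℝ] ℝ) (pullbackBilin i i) (f := fun x ↦ Ω (i x)) h2.differentiableAt a
    rw [HasFDerivAt.fderiv (f := fun x ↦ Ω (i x)) h2] at h3
    exact congrArg (fun L ↦ L b c) h3
  have hτ0 : τ 0 = σ := by
    ext a b
    have : G 0 (N 0 (a, 0)) (b, 0) = σ a b := by rw [hN0, hG0]
    exact this
  obtain ⟨U₂, f₂, hU₂, h0U₂, hf₂, hf₂0, hf₂0', hf₂U⟩ := exists_moser hO'' h0' hτs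
    (fun x hx a b ↦ h.form_skew (hsub hx) _ _)
    (fun x hx a b c ↦ by
      rw [hτd x hx, hτd x hx, hτd x hx]
      exact h.form_closed (hsub hx) _ _ _) (by rwa [hτ0])
  -- Moser's diffeomorphism acts on the base only, so it is compatible with the pullback from the
  -- first factor.
  let k : X × X → X × X := fun z ↦ (f₂ z.1, z.2)
  have hfst : IsOpen (Prod.fst ⁻¹' U₂ : Set (X × X)) := hU₂.preimage continuous_fst
  have hk : ContDiffOn ℝ ∞ k (Prod.fst ⁻¹' U₂) :=
    (hf₂.comp contDiffOn_fst (fun _ hz ↦ hz)).prodMk contDiffOn_snd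
  have hk' : ∀ z ∈ (Prod.fst ⁻¹' U₂ : Set (X × X)), HasFDerivAt k
      (((fderiv ℝ f₂ z.1).comp (ContinuousLinearMap.fst ℝ X X)).prod
        (ContinuousLinearMap.snd ℝ X X)) z := fun z hz ↦
    (HasFDerivAt.comp (g := f₂) z ((hf₂.contDiffAt (hU₂.mem_nhds hz)).differentiableAt
      (by simp)).hasFDerivAt hasFDerivAt_fst).prodMk hasFDerivAt_snd
  have hk0 : k 0 = 0 := by simp [k, hf₂0]
  have hk0' : HasFDerivAt k (ContinuousLinearMap.id ℝ (X × X)) 0 := by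
    refine (hk' 0 h0U₂).congr_fderiv ?_
    have : fderiv ℝ f₂ (0 : X × X).1 = ContinuousLinearMap.id ℝ X := hf₂0'.fderiv
    rw [this]
    rfl
  refine ⟨Prod.fst ⁻¹' U₂ ∩ k ⁻¹' U₁, f₁ ∘ k, hk.continuousOn.isOpen_inter_preimage hfst hU₁,
    ⟨h0U₂, by simpa [hk0] using h0U₁⟩,
    hf₁.comp (hk.mono inter_subset_left) (fun z hz ↦ hz.2), by simp [hk0, hf₁0], ?_, ?_⟩
  · have : HasFDerivAt f₁ (ContinuousLinearMap.id ℝ (X × X)) (k 0) := by rwa [hk0]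
    exact this.comp 0 hk0'
  · rintro z ⟨hz₂, hz₁⟩
    obtain ⟨hm, -, hf⟩ := hf₁U _ hz₁
    refine ⟨hsub hm, fun a b ↦ ?_⟩
    have h1 : HasFDerivAt f₁ (fderiv ℝ f₁ (k z)) (k z) :=
      ((hf₁.contDiffAt (hU₁.mem_nhds hz₁)).differentiableAt (by simp)).hasFDerivAt
    rw [(h1.comp z (hk' z hz₂)).fderiv]
    refine (hf _ _).trans ?_
    have h2 := (hf₂U _ hz₂).2 a.1 b.1
    rw [hτ0] at h2
    exact h2

/-! ### Fibre coordinates and the potential -/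

section Adapted

/-- The covariant derivatives of vector fields in the second factor stay in this factor. -/
lemma christoffel_fst_eq_zero (h : LocalNullKahler G N O) (hσ : ∀ v, (∀ w, σ v w = 0) → v = 0)
    (hΩ : ∀ z ∈ O, ∀ a b, G z (N z a) b = σ a.1 b.1) {z : X × X} (hz : z ∈ O) :
    ∃ Γ : X × X → X × X → X × X, (∀ v w, Γ v w = Γ w v) ∧
      (∀ v w u, fderiv ℝ G z v w u = G z (Γ v w) u + G z w (Γ v u)) ∧
      (∀ v w u, σ (Γ v w).1 u.1 + σ w.1 (Γ v u).1 = 0) ∧ ∀ v b, (Γ v (0, b)).1 = 0 := by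
  obtain ⟨Γ, hΓ, hG, hF⟩ := h.christoffel z hz
  -- The form has constant coefficients, so its derivative vanishes and only the Christoffel terms
  -- of `∇Ω = 0` remain. For `w = (0, b)` the second term is zero as well.
  have hconst : ∀ v w u, σ (Γ v w).1 u.1 + σ w.1 (Γ v u).1 = 0 := by
    intro v w u
    have h1 : (fun z ↦ (G z).comp (N z)) =ᶠ[𝓝 z] fun _ ↦ (G z).comp (N z) := by
      filter_upwards [h.isOpen.mem_nhds hz] with y hy
      refine ContinuousLinearMap.ext fun a ↦ ContinuousLinearMap.ext fun b ↦ ?_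
      simp only [ContinuousLinearMap.comp_apply]
      rw [hΩ y hy, hΩ z hz]
    have h2 := hF v w u
    rw [h1.fderiv_eq, hΩ z hz, hΩ z hz] at h2
    simpa using h2.symm
  refine ⟨Γ, hΓ, hG, hconst, fun v b ↦ hσ _ fun w ↦ ?_⟩
  have := hconst v (0, b) (w, 0)
  simpa using this

/-- Change of the coordinates of the second factor which brings the endomorphism to its normal
form. -/
lemma exists_fibre_coordinates (h : LocalNullKahler G N O) (h0 : (0 : X × X) ∈ O)
    (hσ : ∀ v, (∀ w, σ v w = 0) → v = 0) (hΩ : ∀ z ∈ O, ∀ a b, G z (N z a) b = σ a.1 b.1) :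
    ∃ (U : Set (X × X)) (κ : X × X → X × X) (κ' : (X × X) ≃L[ℝ] (X × X)), IsOpen U ∧ 0 ∈ U ∧
      U ⊆ O ∧ ContDiffOn ℝ ∞ κ U ∧ κ 0 = 0 ∧ HasFDerivAt κ (κ' : X × X →L[ℝ] X × X) 0 ∧
      ∀ z ∈ U, (∀ v, (fderiv ℝ κ z v).1 = v.1) ∧
        (∀ b v, G z (0, b) v = σ (fderiv ℝ κ z (0, b)).2 v.1) ∧
        ∀ w, fderiv ℝ κ z (N z w) = (0, w.1) := by
  have hN1 : ∀ z ∈ O, ∀ v, (N z v).1 = 0 := fun z hz v ↦ hσ _ fun w ↦ by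
    have h1 := hΩ z hz (N z v) (w, 0)
    rw [h.sq_zero z hz] at h1
    simpa using h1.symm
  have hsurj : ∀ z ∈ O, ∀ b : X, ∃ a : X, N z (a, 0) = (0, b) := by
    intro z hz b
    let K : X →ₗ[ℝ] X := ((ContinuousLinearMap.snd ℝ X X).comp ((N z).comp
      (ContinuousLinearMap.inl ℝ X X))).toLinearMap
    have hK : Function.Injective K := by
      rw [injective_iff_map_eq_zero]
      intro a ha
      refine hσ a fun w ↦ ?_
      have h1 : N z (a, 0) = 0 := Prod.ext (hN1 z hz _) ha
      have h2 := hΩ z hz (a, 0) (w, 0)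
      rw [h1] at h2
      simpa using h2.symm
    obtain ⟨a, ha⟩ := LinearMap.surjective_of_injective hK b
    exact ⟨a, Prod.ext (hN1 z hz _) ha⟩
  -- Every vertical vector is of the form `N (a, 0)`, so pairing with it is pairing through `σ`,
  -- which sees only first components.
  have hnull : ∀ z ∈ O, ∀ b v, G z (0, b) v = G z (0, b) (v.1, 0) := by
    intro z hz b v
    obtain ⟨a, ha⟩ := hsurj z hz b
    rw [← ha, hΩ z hz, hΩ z hz]
  let J := musical σ hσ
  have hJ : ∀ ξ v, σ (J.symm ξ) v = ξ v := fun ξ v ↦ by rw [apply_musical_symm]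
  let i : X →L[ℝ] X × X := ContinuousLinearMap.inl ℝ X X
  let j : X →L[ℝ] X × X := ContinuousLinearMap.inr ℝ X X
  let L : (X × X →L[ℝ] X × X →L[ℝ] ℝ) →L[ℝ] (X →L[ℝ] X) :=
    (ContinuousLinearMap.compL ℝ X (X →L[ℝ] ℝ) X (J.symm : (X →L[ℝ] ℝ) →L[ℝ] X)).comp
      (pullbackBilin j i)
  have hL : ∀ (A : X × X →L[ℝ] X × X →L[ℝ] ℝ) b a, σ (L A b) a = A (0, b) (a, 0) :=
    fun A b a ↦ (hJ (pullbackBilin j i A b) a :)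
  -- The mixed block of the metric, read as an endomorphism through `σ`: it has to be the
  -- `y`-derivative of the new fibre coordinate.
  let B : X × X → X →L[ℝ] X := fun z ↦ L (G z)
  have hB : ContDiffOn ℝ ∞ B O := contDiffOn_clm_image L h.smooth_metric
  have hBd : ∀ z ∈ O, ∀ v, fderiv ℝ B z v = L (fderiv ℝ G z v) := fun z hz v ↦
    fderiv_clm_image L ((h.smooth_metric.contDiffAt
      (h.isOpen.mem_nhds hz)).differentiableAt (by simp)) v
  have hinj : ∀ x y, (∀ w, σ x w = σ y w) → x = y := fun x y hxy ↦ by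
    rw [← sub_eq_zero]
    exact hσ _ fun w ↦ by simp [hxy w]
  -- In the derivative of the mixed block, one Christoffel term pairs two vertical vectors and
  -- vanishes; the other contains `Γ (0, b) (0, b')`, which is symmetric.
  have hBsymm : ∀ z ∈ O, ∀ b b', fderiv ℝ B z (0, b) b' = fderiv ℝ B z (0, b') b := by
    intro z hz b b'
    obtain ⟨Γ, hΓ, hG, -, hΓ0⟩ := h.christoffel_fst_eq_zero hσ hΩ hz
    have hzero : ∀ b b' w, G z (0, b') (Γ (0, b) w) = 0 := fun b b' w ↦ by
      rw [hnull z hz, hΓ, hΓ0]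
      exact map_zero _
    refine hinj _ _ fun w ↦ ?_
    rw [hBd z hz, hBd z hz, hL, hL, hG, hG, hzero, hzero, hΓ]
  obtain ⟨u, hu, hu0, hev⟩ := exists_primitive_of_symmetric h.isOpen h0 hB hBsymm
  have hud : ∀ z, HasFDerivAt u (fderiv ℝ u z) z :=
    fun z ↦ (hu.differentiable (by simp) z).hasFDerivAt
  let κ : X × X → X × X := fun z ↦ (z.1, u z)
  have hκ : ∀ z, HasFDerivAt κ ((ContinuousLinearMap.fst ℝ X X).prod (fderiv ℝ u z)) z :=
    fun z ↦ hasFDerivAt_fst.prodMk (hud z)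
  have hinj0 : Function.Injective
      ((ContinuousLinearMap.fst ℝ X X).prod (fderiv ℝ u 0)).toLinearMap := by
    rw [injective_iff_map_eq_zero]
    rintro ⟨a, b⟩ hab
    have ha : a = 0 := congrArg Prod.fst hab
    have hb : fderiv ℝ u 0 (a, b) = 0 := congrArg Prod.snd hab
    subst ha
    rw [hev.self_of_nhds] at hb
    have hb' : (0, b) = (0 : X × X) := h.nondegenerate 0 h0 _ fun w ↦ by
      rw [hnull 0 h0, ← hL (G 0) b w.1]
      change σ (B 0 b) w.1 = 0
      rw [hb]
      simp
    exact hb'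
  obtain ⟨U, hU, hUo, h0U⟩ := eventually_nhds_iff.1
    (hev.and (h.isOpen.mem_nhds h0 : ∀ᶠ z in 𝓝 0, z ∈ O))
  refine ⟨U, κ, (LinearEquiv.ofInjectiveEndo _ hinj0).toContinuousLinearEquiv, hUo, h0U,
    fun z hz ↦ (hU z hz).2, (contDiff_fst.prodMk hu).contDiffOn, Prod.ext rfl (hu0 0),
    hκ 0, fun z hz ↦ ?_⟩
  have hG : ∀ b v, G z (0, b) v = σ (fderiv ℝ κ z (0, b)).2 v.1 := by
    intro b v
    rw [hnull z (hU z hz).2, ← hL, (hκ z).fderiv]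
    change _ = σ (fderiv ℝ u z (0, b)) v.1
    rw [(hU z hz).1]
  have hfst : ∀ v, (fderiv ℝ κ z v).1 = v.1 := fun v ↦ by
    rw [(hκ z).fderiv]
    rfl
  refine ⟨hfst, hG, fun w ↦ ?_⟩
  have hw : N z w = (0, (N z w).2) := Prod.ext (hN1 z (hU z hz).2 w) rfl
  -- The second component is tested against `σ`: the mixed-block formula for `N z w` and the normal
  -- form of the two-form give the same value.
  refine Prod.ext (by rw [hfst, hN1 z (hU z hz).2]) (hinj _ _ fun v ↦ ?_)
  have h1 := hG (N z w).2 (v, 0)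
  rw [← hw, hΩ z (hU z hz).2] at h1
  exact h1.symm

/-- When the endomorphism is in normal form, the remaining part of the metric is the Hessian of a
function along the second factor. -/
lemma exists_potential (h : LocalNullKahler G N O) (h0 : (0 : X × X) ∈ O)
    (hσ : ∀ v, (∀ w, σ v w = 0) → v = 0) (hσ' : ∀ v w, σ v w = -σ w v)
    (hN : ∀ z ∈ O, ∀ v, N z v = (0, v.1)) (hG : ∀ z ∈ O, ∀ b v, G z (0, b) v = σ b v.1) :
    ∃ Θ : X × X → ℝ, ContDiff ℝ ∞ Θ ∧ ∀ᶠ z in 𝓝 0, ∀ a b,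
      fderiv ℝ (fun w ↦ fderiv ℝ Θ w (0, b)) z (0, a) = G z (a, 0) (b, 0) := by
  have hΩ : ∀ z ∈ O, ∀ a b, G z (N z a) b = σ a.1 b.1 := fun z hz a b ↦ by
    rw [hN z hz, hG z hz]
  let i : X →L[ℝ] X × X := ContinuousLinearMap.inl ℝ X X
  let B : X × X → X →L[ℝ] X →L[ℝ] ℝ := fun z ↦ pullbackBilin i i (G z)
  have hB : ContDiffOn ℝ ∞ B O := contDiffOn_clm_image _ h.smooth_metric
  have hGd : ∀ z ∈ O, HasFDerivAt G (fderiv ℝ G z) z := fun z hz ↦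
    ((h.smooth_metric.contDiffAt (h.isOpen.mem_nhds hz)).differentiableAt (by simp)).hasFDerivAt
  have hBd : ∀ z ∈ O, ∀ v a b, fderiv ℝ B z v a b = fderiv ℝ G z v (a, 0) (b, 0) := by
    intro z hz v a b
    have h1 := fderiv_clm_image (F := X →L[ℝ] X →L[ℝ] ℝ) (pullbackBilin i i) (f := G) (hGd z hz).differentiableAt v
    exact congrArg (fun L : X →L[ℝ] X →L[ℝ] ℝ ↦ L a b) h1
  have hBsymm : ∀ z ∈ O, ∀ b b', fderiv ℝ B z (0, b) b' = fderiv ℝ B z (0, b') b := by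
    intro z hz b b'
    obtain ⟨Γ, hΓ, hdG, hc, hΓ0⟩ := h.christoffel_fst_eq_zero hσ hΩ hz
    -- `G ((0, c), Γ (a, b))` is totally symmetric in `a, b, c`
    have hS : ∀ a b c : X, σ c (Γ (a, 0) (b, 0)).1 = σ b (Γ (a, 0) (c, 0)).1 := fun a b c ↦ by
      have h1 := hc (a, 0) (b, 0) (c, 0)
      have h2 := hσ' (Γ (a, 0) (b, 0)).1 c
      simp only at h1
      linarith
    -- The mixed coefficient is now the constant `σ c b`, so its derivative along `(a, 0)` is zero
    -- and metric compatibility relates the two Christoffel terms.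
    have hmix : ∀ a b c : X, G z (Γ (0, c) (a, 0)) (b, 0) = -σ c (Γ (a, 0) (b, 0)).1 := by
      intro a b c
      have h1 : (fun z ↦ G z (0, c) (b, 0)) =ᶠ[𝓝 z] fun _ ↦ σ c b := by
        filter_upwards [h.isOpen.mem_nhds hz] with y hy using hG y hy c (b, 0)
      have h2 := (hasFDerivAt_bilin_apply (hGd z hz).differentiableAt (0, c) (b, 0)).unique
        ((hasFDerivAt_const (σ c b) z).congr_of_eventuallyEq h1)
      have h3 : fderiv ℝ G z (a, 0) (0, c) (b, 0) = 0 := congrArg (fun L ↦ L (a, 0)) h2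
      rw [hdG, hG z hz, hΓ] at h3
      linarith
    ext c
    have h1 : ∀ b b' : X, fderiv ℝ B z (0, b) b' c = -2 * σ b (Γ (b', 0) (c, 0)).1 := by
      intro b b'
      rw [hBd z hz, hdG, hmix, h.symm z hz (b', 0), hmix, hΓ (c, 0) (b', 0)]
      ring
    rw [h1, h1, hΓ (b', 0), hΓ (b, 0), hS c b' b]
  obtain ⟨η, hη, -, hηd⟩ := exists_primitive_of_symmetric h.isOpen h0 hB hBsymm
  obtain ⟨O', hO', hO'o, h0'⟩ := eventually_nhds_iff.1
    (hηd.and (h.isOpen.mem_nhds h0 : ∀ᶠ z in 𝓝 0, z ∈ O))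
  -- The `y`-derivative of `η` is the block of `G` on the first factor, and symmetry of `G` is
  -- exactly the integrability condition for `η`.
  obtain ⟨Θ, hΘ, -, hΘd⟩ := exists_primitive_of_symmetric (B := η) hO'o h0' hη.contDiffOn
    (fun z hz b b' ↦ by
      rw [(hO' z hz).1, (hO' z hz).1]
      exact h.symm z (hO' z hz).2 _ _)
  refine ⟨Θ, hΘ, ?_⟩
  filter_upwards [hΘd.eventually_nhds, hηd] with z hz hz' a b
  have h1 : (fun w ↦ fderiv ℝ Θ w (0, b)) =ᶠ[𝓝 z] fun w ↦ η w b := by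
    filter_upwards [hz] with w hw using hw b
  rw [h1.fderiv_eq]
  have h2 : HasFDerivAt (fun w ↦ η w b) ((fderiv ℝ η z).flip b) z := by
    have := (hη.differentiable (by simp) z).hasFDerivAt.clm_apply (hasFDerivAt_const b z)
    simpa using this
  rw [h2.fderiv, ContinuousLinearMap.flip_apply, hz']
  rfl

end Adapted

end

end LocalNullKahler

/-! ### Linear algebra at a point -/

section Symplectic

/-- A skew form of rank at least `2 n` admits `k ≤ n` orthogonal hyperbolic pairs. -/
lemma exists_hyperbolic_pairs {V : Type*} [AddCommGroup V] [Module ℝ V] [FiniteDimensional ℝ V]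
    (b : V →ₗ[ℝ] V →ₗ[ℝ] ℝ) (hb : ∀ v w, b v w = -b w v) {n : ℕ}
    (hrank : Module.finrank ℝ V = Module.finrank ℝ (LinearMap.ker b) + 2 * n) (k : ℕ)
    (hk : k ≤ n) : ∃ e f : Fin k → V, (∀ i j, b (e i) (e j) = 0) ∧ (∀ i j, b (f i) (f j) = 0) ∧
      ∀ i j, b (e i) (f j) = if i = j then 1 / 2 else 0 := by
  induction k with
  | zero => exact ⟨Fin.elim0, Fin.elim0, fun i ↦ i.elim0, fun i ↦ i.elim0, fun i ↦ i.elim0⟩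
  | succ k ih =>
    obtain ⟨e, f, hee, hff, hef⟩ := ih (by omega)
    -- Projection onto the orthogonal of the pairs found so far; the factors `2` compensate `b (e i)
    -- (f i) = 1 / 2`.
    let P : V → V := fun w ↦ w - ∑ j, (2 * b w (f j)) • e j + ∑ j, (2 * b w (e j)) • f j
    have hPe : ∀ w i, b (P w) (e i) = 0 := fun w i ↦ by
      simp [P, hee, hb (f _) (e _), hef]
      ring
    have hPf : ∀ w i, b (P w) (f i) = 0 := fun w i ↦ by
      simp [P, hff, hef]
      ring
    have hP : ∀ w w', b (P w) w' = b (P w) (P w') := fun w w' ↦ by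
      have : P w' = w' - ∑ j, (2 * b w' (f j)) • e j + ∑ j, (2 * b w' (e j)) • f j := rfl
      have hpe := hPe w
      have hpf := hPf w
      generalize P w = q at hpe hpf ⊢
      rw [this]
      simp [hpe, hpf]
    -- Otherwise `V` would be spanned by the `2 k` vectors and `ker b`, against the rank hypothesis
    -- since `k < n`.
    have hex : ∃ w w', b (P w) (P w') ≠ 0 := by
      by_contra! hcon
      have htop : (⊤ : Submodule ℝ V) ≤
          Submodule.span ℝ (range (Sum.elim e f)) ⊔ LinearMap.ker b := by
        intro w _
        have h1 : P w ∈ LinearMap.ker b := by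
          rw [LinearMap.mem_ker]
          ext w'
          rw [hP, hcon]
          rfl
        have h2 : w = (∑ j, (2 * b w (f j)) • e j - ∑ j, (2 * b w (e j)) • f j) + P w := by
          simp only [P]
          abel
        rw [h2]
        refine Submodule.add_mem_sup (Submodule.sub_mem _ ?_ ?_) h1
        · exact Submodule.sum_mem _ fun j _ ↦ Submodule.smul_mem _ _
            (Submodule.subset_span ⟨Sum.inl j, rfl⟩)
        · exact Submodule.sum_mem _ fun j _ ↦ Submodule.smul_mem _ _
            (Submodule.subset_span ⟨Sum.inr j, rfl⟩)
      have h3 := Submodule.finrank_mono htop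
      rw [finrank_top] at h3
      have h4 := Submodule.finrank_add_le_finrank_add_finrank
        (Submodule.span ℝ (range (Sum.elim e f))) (LinearMap.ker b)
      have h5 := finrank_range_le_card (R := ℝ) (Sum.elim e f)
      rw [Fintype.card_sum, Fintype.card_fin] at h5
      change Module.finrank ℝ (Submodule.span ℝ (range (Sum.elim e f))) ≤ _ at h5
      omega
    obtain ⟨w, w', hw⟩ := hex
    have hself : ∀ v, b v v = 0 := fun v ↦ by linarith [hb v v]
    refine ⟨Fin.cons (P w) e, Fin.cons ((1 / (2 * b (P w) (P w'))) • P w') f, ?_, ?_, ?_⟩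
    · intro i j
      refine Fin.cases ?_ (fun i ↦ ?_) i <;> refine Fin.cases ?_ (fun j ↦ ?_) j
      · simp [hself]
      · simp [hPe]
      · simp [hb (e i), hPe]
      · simp [hee]
    · intro i j
      refine Fin.cases ?_ (fun i ↦ ?_) i <;> refine Fin.cases ?_ (fun j ↦ ?_) j
      · simp [hself]
      · simp [hPf]
      · simp [hb (f i), hPf]
      · simp [hff]
    · intro i j
      refine Fin.cases ?_ (fun i ↦ ?_) i <;> refine Fin.cases ?_ (fun j ↦ ?_) j
      · simp
        field_simp
      · simp [hPf, (Fin.succ_ne_zero j).symm]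
      · simp [hb (e i), hPe]
      · simp [hef]

variable (n : ℕ)

/-- The symplectic form `½ ω` on `ℝ²ⁿ`. -/
def halfOmega : (Idx n → ℝ) →L[ℝ] (Idx n → ℝ) →L[ℝ] ℝ :=
  ∑ i, ∑ j, (1 / 2 * omega n i j) • (ContinuousLinearMap.proj (R := ℝ) (φ := fun _ ↦ ℝ) i).smulRight
    (ContinuousLinearMap.proj (R := ℝ) (φ := fun _ : Idx n ↦ ℝ) j)

variable {n}

lemma halfOmega_apply (a b : Idx n → ℝ) :
    halfOmega n a b = 1 / 2 * ∑ i, ∑ j, omega n i j * (a i * b j) := by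
  simp only [halfOmega, _root_.sum_apply, _root_.smul_apply, ContinuousLinearMap.smulRight_apply,
    ContinuousLinearMap.proj_apply, smul_eq_mul, Finset.mul_sum, mul_assoc]

lemma halfOmega_apply' (a b : Idx n → ℝ) :
    halfOmega n a b = 1 / 2 * ∑ i, (a (Sum.inl i) * b (Sum.inr i) - a (Sum.inr i) * b (Sum.inl i)) := by
  rw [halfOmega_apply]
  simp [omega, Fintype.sum_sum_type, Matrix.one_apply, sub_eq_add_neg, Finset.sum_add_distrib]
  exact add_comm _ _

lemma halfOmega_skew (a b : Idx n → ℝ) : halfOmega n a b = -halfOmega n b a := by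
  rw [halfOmega_apply', halfOmega_apply', ← mul_neg, ← Finset.sum_neg_distrib]
  congr 1
  exact Finset.sum_congr rfl fun i _ ↦ by ring

lemma halfOmega_nondegenerate (a : Idx n → ℝ) (h : ∀ b, halfOmega n a b = 0) : a = 0 := by
  funext i
  rcases i with i | i
  · have := h (Pi.single (Sum.inr i) 1)
    rw [halfOmega_apply'] at this
    simpa [Pi.single_apply] using this
  · have := h (Pi.single (Sum.inl i) 1)
    rw [halfOmega_apply'] at this
    simpa [Pi.single_apply] using this

/-- Linear coordinates in which a null-Kähler structure has the normal form at a point. -/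
lemma exists_adapted_coordinates {Z : Type*} [NormedAddCommGroup Z] [NormedSpace ℝ Z]
    [FiniteDimensional ℝ Z] (hZ : Module.finrank ℝ Z = 4 * n) (g : Z →L[ℝ] Z →L[ℝ] ℝ)
    (N : Z →L[ℝ] Z) (symm : ∀ v w, g v w = g w v) (nd : ∀ v, (∀ w, g v w = 0) → v = 0)
    (sq : ∀ v, N (N v) = 0) (rank : Module.finrank ℝ (LinearMap.range N.toLinearMap) = 2 * n)
    (skew : ∀ v w, g v (N w) + g (N v) w = 0) :
    ∃ A : Z ≃L[ℝ] Coord n, (∀ v, A (N v) = (0, (A v).1)) ∧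
      ∀ b v, g (A.symm (0, b)) v = halfOmega n b (A v).1 := by
  let Ω : Z →ₗ[ℝ] Z →ₗ[ℝ] ℝ := (g.comp N).toLinearMap₁₂
  have hΩ : ∀ v w, Ω v w = g (N v) w := fun v w ↦ rfl
  have hΩskew : ∀ v w, Ω v w = -Ω w v := fun v w ↦ by
    rw [hΩ, hΩ, symm (N w)]
    linarith [skew v w]
  have hker : LinearMap.ker Ω = LinearMap.ker N.toLinearMap := by
    ext v
    rw [LinearMap.mem_ker, LinearMap.mem_ker]
    constructor
    · intro h
      exact nd _ fun w ↦ congrArg (fun L ↦ L w) h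
    · intro h
      ext w
      have : N v = 0 := h
      simp [hΩ, this]
  have hrk := LinearMap.finrank_range_add_finrank_ker N.toLinearMap
  obtain ⟨e, f, hee, hff, hef⟩ := exists_hyperbolic_pairs Ω hΩskew (n := n)
    (by rw [hker]; omega) n le_rfl
  let E : (Idx n → ℝ) →ₗ[ℝ] Z := Fintype.linearCombination ℝ (Sum.elim e f)
  have hE : ∀ a b, g (N (E a)) (E b) = halfOmega n a b := by
    intro a b
    rw [← hΩ, halfOmega_apply']
    simp [E, Fintype.linearCombination_apply, Fintype.sum_sum_type, hee, hff, hef,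
      hΩskew (f _) (e _), Finset.mul_sum, Finset.sum_sub_distrib, mul_sub]
    rw [sub_eq_add_neg]
    congr 1
    · exact Finset.sum_congr rfl fun i _ ↦ by ring
    · exact congrArg Neg.neg (Finset.sum_congr rfl fun i _ ↦ by ring)
  -- `E` spans a complement of `ker N` by hyperbolic pairs for `Ω`. Using `N ∘ E` on the second
  -- factor makes `N` the shift `(a, b) ↦ (0, a)` and the mixed pairing `½ ω`; the image of `N` is
  -- isotropic by `hNN`.
  let K : Coord n →ₗ[ℝ] Z := E.coprod (N.toLinearMap.comp E)
  have hK : ∀ a b, K (a, b) = E a + N (E b) := fun a b ↦ rfl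
  have hNN : ∀ v w, g (N v) (N w) = 0 := fun v w ↦ by
    have := skew (N v) w
    rw [sq] at this
    simpa using this
  have hinj : Function.Injective K := by
    rw [injective_iff_map_eq_zero]
    rintro ⟨a, b⟩ hab
    rw [hK] at hab
    have ha : a = 0 := halfOmega_nondegenerate a fun c ↦ by
      rw [halfOmega_skew, ← hE]
      have h1 : g (N (E c)) (E a + N (E b)) = 0 := by rw [hab, map_zero]
      rw [map_add, hNN, add_zero] at h1
      rw [h1, neg_zero]
    have hb : b = 0 := halfOmega_nondegenerate b fun c ↦ by
      rw [← hE]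
      rw [ha, map_zero, zero_add] at hab
      rw [hab]
      simp
    rw [ha, hb]
    rfl
  have hdim : Module.finrank ℝ (Coord n) = Module.finrank ℝ Z := by
    rw [hZ]
    simp
    ring
  let A : Z ≃L[ℝ] Coord n := (LinearEquiv.ofInjectiveOfFinrankEq K hinj hdim).toContinuousLinearEquiv.symm
  have hA : ∀ z, A.symm z = K z := fun z ↦ rfl
  have hv : ∀ v, v = E (A v).1 + N (E (A v).2) := fun v ↦ by
    rw [← hK, ← hA]
    simp
  refine ⟨A, fun v ↦ ?_, fun b v ↦ ?_⟩
  · rw [← A.symm.injective.eq_iff, A.symm_apply_apply, hA, hK, map_zero, zero_add]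
    conv_lhs => rw [hv v, map_add, sq, add_zero]
  · rw [hA, hK, map_zero, zero_add]
    conv_lhs => rw [hv v, map_add, hNN, add_zero, hE]

end Symplectic

end NullKahler

end

noncomputable section

namespace NullKahler

open Set Filter Topology Bundle

set_option linter.unusedSectionVars false

lemma two_le_infty : (2 : WithTop ℕ∞) ≤ ∞ := by
  exact WithTop.coe_le_coe.2 (le_top : (2 : ℕ∞) ≤ ⊤)

/-! ### Vector fields and tensors in coordinates on a manifold -/

section Coordinates

variable {n : ℕ} {M : Type*} [TopologicalSpace M] [ChartedSpace (Model n) M]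

/-- The differential of a coordinate system. -/
def coordDiff (φ : OpenPartialHomeomorph M (Coord n)) (q : M) :
    TangentSpace (𝓡 (4 * n)) q →L[ℝ] Coord n :=
  mfderiv (𝓡 (4 * n)) 𝓘(ℝ, Coord n) φ q

/-- The vector at `q` with given components in a coordinate system. -/
def coordLift (φ : OpenPartialHomeomorph M (Coord n)) (q : M) :
    Coord n →L[ℝ] TangentSpace (𝓡 (4 * n)) q :=
  (mfderiv (𝓡 (4 * n)) 𝓘(ℝ, Coord n) φ q).inverse

/-- The components of a vector field in a coordinate system. -/
def coordField (φ : OpenPartialHomeomorph M (Coord n))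
    (Y : ∀ q : M, TangentSpace (𝓡 (4 * n)) q) (z : Coord n) : Coord n :=
  coordDiff φ (φ.symm z) (Y (φ.symm z))

/-- The vector field with given components in a coordinate system. -/
def liftField (φ : OpenPartialHomeomorph M (Coord n)) (w : Coord n → Coord n) (q : M) :
    TangentSpace (𝓡 (4 * n)) q :=
  coordLift φ q (w (φ q))

variable {φ : OpenPartialHomeomorph M (Coord n)}

namespace IsCoordinateSystem

lemma contMDiffAt (h : IsCoordinateSystem φ) {q : M} (hq : q ∈ φ.source) :
    ContMDiffAt (𝓡 (4 * n)) 𝓘(ℝ, Coord n) ∞ φ q :=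
  h.smooth.contMDiffAt (φ.open_source.mem_nhds hq)

lemma contMDiffAt_symm (h : IsCoordinateSystem φ) {z : Coord n} (hz : z ∈ φ.target) :
    ContMDiffAt 𝓘(ℝ, Coord n) (𝓡 (4 * n)) ∞ φ.symm z :=
  h.smooth_symm.contMDiffAt (φ.open_target.mem_nhds hz)

lemma mdifferentiable (h : IsCoordinateSystem φ) :
    φ.MDifferentiable (𝓡 (4 * n)) 𝓘(ℝ, Coord n) :=
  ⟨h.smooth.mdifferentiableOn (by simp), h.smooth_symm.mdifferentiableOn (by simp)⟩

lemma isInvertible (h : IsCoordinateSystem φ) {q : M} (hq : q ∈ φ.source) :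
    (mfderiv (𝓡 (4 * n)) 𝓘(ℝ, Coord n) φ q).IsInvertible :=
  ⟨h.mdifferentiable.mfderiv hq, rfl⟩

lemma coordDiff_coordLift (h : IsCoordinateSystem φ) {q : M} (hq : q ∈ φ.source) (v : Coord n) :
    coordDiff φ q (coordLift φ q v) = v :=
  (h.isInvertible hq).self_apply_inverse v

lemma coordLift_coordDiff (h : IsCoordinateSystem φ) {q : M} (hq : q ∈ φ.source)
    (v : TangentSpace (𝓡 (4 * n)) q) : coordLift φ q (coordDiff φ q v) = v :=
  (h.isInvertible hq).inverse_apply_self v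

lemma inverse_mfderiv_symm (h : IsCoordinateSystem φ) {z : Coord n} (hz : z ∈ φ.target) :
    (mfderiv 𝓘(ℝ, Coord n) (𝓡 (4 * n)) φ.symm z).inverse = coordDiff φ (φ.symm z) := by
  have h1 := h.mdifferentiable.symm_comp_deriv (φ.map_target hz)
  have h2 := h.mdifferentiable.comp_symm_deriv hz
  rw [φ.right_inv hz] at h1
  exact ContinuousLinearMap.inverse_eq h1 h2

/-- The bridge through which regularity and bracket results for pulled-back vector fields apply to
components. -/
lemma mpullback_symm (h : IsCoordinateSystem φ) {z : Coord n} (hz : z ∈ φ.target)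
    (Y : ∀ q : M, TangentSpace (𝓡 (4 * n)) q) :
    VectorField.mpullback 𝓘(ℝ, Coord n) (𝓡 (4 * n)) φ.symm Y z = coordField φ Y z := by
  rw [VectorField.mpullback_apply, h.inverse_mfderiv_symm hz]
  rfl

lemma isInvertible_symm (h : IsCoordinateSystem φ) {z : Coord n} (hz : z ∈ φ.target) :
    (mfderiv 𝓘(ℝ, Coord n) (𝓡 (4 * n)) φ.symm z).IsInvertible :=
  ⟨h.mdifferentiable.symm.mfderiv hz, rfl⟩

variable [IsManifold (𝓡 (4 * n)) ∞ M]

lemma contMDiffAt_liftField (h : IsCoordinateSystem φ) {q : M} (hq : q ∈ φ.source)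
    {w : Coord n → Coord n} (hw : ContDiffAt ℝ ∞ w (φ q)) :
    ContMDiffAt (𝓡 (4 * n)) ((𝓡 (4 * n)).prod 𝓘(ℝ, Model n)) ∞
      (fun z ↦ TotalSpace.mk' (Model n) (E := fun x : M ↦ TangentSpace (𝓡 (4 * n)) x)
        z (liftField φ w z)) q := by
  have := ContMDiffAt.mpullback_vectorField_preimage (I := 𝓡 (4 * n)) (I' := 𝓘(ℝ, Coord n))
    (V := fun z ↦ w z) (f := φ) (x₀ := q) (m := ∞) (n := ∞)
    (contMDiffAt_vectorSpace_iff_contDiffAt.2 hw) (h.contMDiffAt hq) (h.isInvertible hq) (by simp)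
  exact this

lemma contDiffAt_coordField (h : IsCoordinateSystem φ) {z : Coord n} (hz : z ∈ φ.target)
    {Y : ∀ q : M, TangentSpace (𝓡 (4 * n)) q}
    (hY : ContMDiffAt (𝓡 (4 * n)) ((𝓡 (4 * n)).prod 𝓘(ℝ, Model n)) ∞
      (fun z ↦ TotalSpace.mk' (Model n) (E := fun x : M ↦ TangentSpace (𝓡 (4 * n)) x)
        z (Y z)) (φ.symm z)) :
    ContDiffAt ℝ ∞ (coordField φ Y) z := by
  have := ContMDiffAt.mpullback_vectorField_preimage (I' := 𝓡 (4 * n)) (I := 𝓘(ℝ, Coord n))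
    (V := Y) (f := φ.symm) (x₀ := z) (m := ∞) (n := ∞)
    hY (h.contMDiffAt_symm hz) (h.isInvertible_symm hz) (by simp)
  refine (contMDiffAt_vectorSpace_iff_contDiffAt.1 this).congr_of_eventuallyEq ?_
  filter_upwards [φ.open_target.mem_nhds hz] with y hy using (h.mpullback_symm hy Y).symm

lemma differentiableAt_coordField (h : IsCoordinateSystem φ) {z : Coord n} (hz : z ∈ φ.target)
    {Y : ∀ q : M, TangentSpace (𝓡 (4 * n)) q} (hY : DifferentiableFieldAt Y (φ.symm z)) :
    DifferentiableAt ℝ (coordField φ Y) z := by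
  have := MDifferentiableAt.mpullback_vectorField (I' := 𝓡 (4 * n)) (I := 𝓘(ℝ, Coord n))
    (V := Y) (f := φ.symm) (x₀ := z) (n := ∞)
    hY (h.contMDiffAt_symm hz) (h.isInvertible_symm hz) two_le_infty
  have h2 := (((contMDiff_snd_tangentBundle_modelSpace (n := 1) (Coord n)
    𝓘(ℝ, Coord n)).contMDiffAt.mdifferentiableAt one_ne_zero).comp z this).differentiableAt
  refine h2.congr_of_eventuallyEq ?_
  filter_upwards [φ.open_target.mem_nhds hz] with y hy using (h.mpullback_symm hy Y).symm

/-- The Lie bracket is natural under pullback by `φ.symm`, and in the vector space it is the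
difference of the two directional derivatives. -/
lemma mlieBracket_eq (h : IsCoordinateSystem φ) {q : M} (hq : q ∈ φ.source)
    {X Y : ∀ q : M, TangentSpace (𝓡 (4 * n)) q} (hX : DifferentiableFieldAt X q)
    (hY : DifferentiableFieldAt Y q) :
    coordDiff φ q (VectorField.mlieBracket (𝓡 (4 * n)) X Y q)
      = fderiv ℝ (coordField φ Y) (φ q) (coordField φ X (φ q))
        - fderiv ℝ (coordField φ X) (φ q) (coordField φ Y (φ q)) := by
  have hz := φ.map_source hq
  have : IsManifold (𝓡 (4 * n)) (minSmoothness ℝ 2) M := by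
    rw [minSmoothness_of_isRCLikeNormedField]; infer_instance
  have : IsManifold (𝓡 (4 * n)) (minSmoothness ℝ 3) M := by
    rw [minSmoothness_of_isRCLikeNormedField]; infer_instance
  have : IsManifold 𝓘(ℝ, Coord n) (minSmoothness ℝ 2) (Coord n) := by
    rw [minSmoothness_of_isRCLikeNormedField]; infer_instance
  have : IsManifold 𝓘(ℝ, Coord n) (minSmoothness ℝ 3) (Coord n) := by
    rw [minSmoothness_of_isRCLikeNormedField]; infer_instance
  have hX' : DifferentiableFieldAt X (φ.symm (φ q)) := by rwa [φ.left_inv hq]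
  have hY' : DifferentiableFieldAt Y (φ.symm (φ q)) := by rwa [φ.left_inv hq]
  have key := VectorField.mpullback_mlieBracket (I' := 𝓡 (4 * n)) (I := 𝓘(ℝ, Coord n))
    (f := φ.symm) (x₀ := φ q) (n := ∞) (V := X) (W := Y)
    hX' hY' (h.contMDiffAt_symm hz)
    (by rw [minSmoothness_of_isRCLikeNormedField]; exact two_le_infty)
  rw [h.mpullback_symm hz, coordField, φ.left_inv hq] at key
  rw [key, ← VectorField.mlieBracketWithin_univ,
    VectorField.mlieBracketWithin_eq_lieBracketWithin]
  have hX'' : VectorField.mpullback 𝓘(ℝ, Coord n) (𝓡 (4 * n)) φ.symm X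
      =ᶠ[𝓝 (φ q)] coordField φ X := by
    filter_upwards [φ.open_target.mem_nhds hz] with y hy using h.mpullback_symm hy X
  have hY'' : VectorField.mpullback 𝓘(ℝ, Coord n) (𝓡 (4 * n)) φ.symm Y
      =ᶠ[𝓝 (φ q)] coordField φ Y := by
    filter_upwards [φ.open_target.mem_nhds hz] with y hy using h.mpullback_symm hy Y
  refine (congrFun VectorField.lieBracketWithin_univ (φ q)).trans ?_
  exact Filter.EventuallyEq.lieBracket_vectorField_eq hX'' hY''

lemma coordField_liftField (h : IsCoordinateSystem φ) {z : Coord n} (hz : z ∈ φ.target)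
    (w : Coord n → Coord n) : coordField φ (liftField φ w) z = w z := by
  rw [coordField, liftField, h.coordDiff_coordLift (φ.map_target hz), φ.right_inv hz]

lemma _root_.NullKahler.coordField_apply {q : M} (hq : q ∈ φ.source)
    (Y : ∀ q : M, TangentSpace (𝓡 (4 * n)) q) :
    coordField φ Y (φ q) = coordDiff φ q (Y q) := by
  rw [coordField, φ.left_inv hq]

lemma differentiableAt_comp_symm (h : IsCoordinateSystem φ) {q : M} (hq : q ∈ φ.source)
    {f : M → ℝ} (hf : MDifferentiableAt (𝓡 (4 * n)) 𝓘(ℝ, ℝ) f q) :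
    DifferentiableAt ℝ (fun z ↦ f (φ.symm z)) (φ q) := by
  rw [← φ.left_inv hq] at hf
  exact (hf.comp (φ q) (h.mdifferentiable.mdifferentiableAt_symm
    (φ.map_source hq))).differentiableAt

lemma mvfderiv_eq (h : IsCoordinateSystem φ) {q : M} (hq : q ∈ φ.source)
    {f : M → ℝ} (hf : DifferentiableAt ℝ (fun z ↦ f (φ.symm z)) (φ q))
    (v : TangentSpace (𝓡 (4 * n)) q) :
    mvfderiv (𝓡 (4 * n)) f q v = fderiv ℝ (fun z ↦ f (φ.symm z)) (φ q) (coordDiff φ q v) := by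
  have h1 := (hf.mdifferentiableAt.hasMFDerivAt.comp q
    (h.mdifferentiable.mdifferentiableAt hq).hasMFDerivAt).congr_of_eventuallyEq
    (f₁ := f) (by
      filter_upwards [φ.open_source.mem_nhds hq] with y hy
      simp [φ.left_inv hy])
  rw [mvfderiv, h1.mfderiv, mfderiv_eq_fderiv]
  rfl

end IsCoordinateSystem

end Coordinates

section Coordinates

variable {n : ℕ} {M : Type*} [TopologicalSpace M] [ChartedSpace (Model n) M]
  {φ : OpenPartialHomeomorph M (Coord n)} [IsManifold (𝓡 (4 * n)) ∞ M]

namespace IsCoordinateSystem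

/-- Smoothness of a homomorphism-valued section can be tested on the coordinate frame: the local
frame of the tangent trivialization expands in it with smooth coefficients, and a linear map on a
finite-dimensional space is determined by a basis. -/
lemma contMDiffAt_hom_section {F : Type*} [NormedAddCommGroup F] [NormedSpace ℝ F]
    {E : M → Type*} [∀ x, AddCommGroup (E x)] [∀ x, Module ℝ (E x)]
    [TopologicalSpace (TotalSpace F E)] [∀ x, TopologicalSpace (E x)]
    [∀ x, IsTopologicalAddGroup (E x)] [∀ x, ContinuousSMul ℝ (E x)]
    [FiberBundle F E] [VectorBundle ℝ F E] [ContMDiffVectorBundle ∞ F E (𝓡 (4 * n))]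
    (h : IsCoordinateSystem φ) {q : M} (hq : q ∈ φ.source)
    {A : ∀ x : M, TangentSpace (𝓡 (4 * n)) x →L[ℝ] E x}
    (hA : ∀ v : Coord n, ContMDiffAt (𝓡 (4 * n)) ((𝓡 (4 * n)).prod 𝓘(ℝ, F)) ∞
      (fun x ↦ TotalSpace.mk' F x (A x (coordLift φ x v))) q) :
    ContMDiffAt (𝓡 (4 * n)) ((𝓡 (4 * n)).prod 𝓘(ℝ, Model n →L[ℝ] F)) ∞
      (fun x ↦ TotalSpace.mk' (Model n →L[ℝ] F)
        (E := fun x : M ↦ TangentSpace (𝓡 (4 * n)) x →L[ℝ] E x) x (A x)) q := by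
  rw [contMDiffAt_hom_bundle]
  refine ⟨contMDiffAt_id, ?_⟩
  let b := Module.finBasis ℝ (Model n)
  let c := Module.finBasis ℝ (Coord n)
  set C : M → (Model n →L[ℝ] F) := fun x ↦ ContinuousLinearMap.inCoordinates (Model n)
    (fun x : M ↦ TangentSpace (𝓡 (4 * n)) x) F E q x q x (A x) with hC
  have hCe : ∀ x, C x = ∑ i, ContinuousLinearMap.smulRightL ℝ (Model n) F
      (LinearMap.toContinuousLinearMap (b.coord i)) (C x (b i)) := by
    intro x
    ext v
    conv_lhs => rw [← b.sum_repr v, map_sum]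
    rw [_root_.sum_apply]
    exact Finset.sum_congr rfl fun i _ ↦ map_smul _ _ _
  have hv : ∀ v, ContMDiffAt (𝓡 (4 * n)) 𝓘(ℝ, F) ∞ (fun x ↦ C x v) q := by
    intro v
    set e₁ := trivializationAt (Model n) (fun x : M ↦ TangentSpace (𝓡 (4 * n)) x) q
    have hq₁ : q ∈ e₁.baseSet := mem_baseSet_trivializationAt _ _ q
    have hS : ContMDiffAt (𝓡 (4 * n)) ((𝓡 (4 * n)).prod 𝓘(ℝ, Model n)) ∞
        (fun x ↦ TotalSpace.mk' (Model n) (E := fun x : M ↦ TangentSpace (𝓡 (4 * n)) x)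
          x (e₁.symmL ℝ x v)) q := by
      refine (contMDiffAt_section _).2 ?_
      refine (contMDiffAt_const (c := v)).congr_of_eventuallyEq ?_
      filter_upwards [e₁.open_baseSet.mem_nhds hq₁] with x hx
      rw [← e₁.continuousLinearMapAt_apply_of_mem (R := ℝ) hx,
        e₁.continuousLinearMapAt_symmL hx]
    have hS' := h.contDiffAt_coordField (φ.map_source hq) (by rwa [φ.left_inv hq])
    have hAS : ContMDiffAt (𝓡 (4 * n)) ((𝓡 (4 * n)).prod 𝓘(ℝ, F)) ∞
      (fun x ↦ TotalSpace.mk' F x (∑ i, (c.coord i (coordField φ (fun x ↦ e₁.symmL ℝ x v) (φ x))) •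
        A x (coordLift φ x (c i)))) q := by
      refine ContMDiffAt.sum_section fun i _ ↦ ContMDiffAt.smul_section ?_ (hA (c i))
      exact ((LinearMap.toContinuousLinearMap (c.coord i)).contDiff.contDiffAt.comp _
        hS').contMDiffAt.comp q (h.contMDiffAt hq)
    refine ((contMDiffAt_section _).1 hAS).congr_of_eventuallyEq ?_
    filter_upwards [(trivializationAt F E q).open_baseSet.mem_nhds
      (mem_baseSet_trivializationAt F E q), φ.open_source.mem_nhds hq] with x hx hxs
    rw [hC]
    simp only [ContinuousLinearMap.inCoordinates, ContinuousLinearMap.comp_apply]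
    rw [(trivializationAt F E q).continuousLinearMapAt_apply_of_mem (R := ℝ) hx]
    congr 2
    rw [← h.coordLift_coordDiff hxs (e₁.symmL ℝ x v),
      ← c.sum_repr (coordDiff φ x (e₁.symmL ℝ x v))]
    simp only [map_sum, map_smul]
    simp_rw [coordField_apply hxs]
    rfl
  have : C = fun x ↦ ∑ i, ContinuousLinearMap.smulRightL ℝ (Model n) F
      (LinearMap.toContinuousLinearMap (b.coord i)) (C x (b i)) := funext hCe
  rw [this]
  refine ContMDiffAt.sum fun i _ ↦ ?_
  exact (ContinuousLinearMap.smulRightL ℝ (Model n) F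
      (LinearMap.toContinuousLinearMap (b.coord i))).contMDiff.contMDiffAt.comp q (hv (b i))

end IsCoordinateSystem

end Coordinates

/-! ### From the manifold to local null-Kähler data -/

section Coordinates

variable {n : ℕ} {M : Type*} [TopologicalSpace M] [ChartedSpace (Model n) M]
  {φ : OpenPartialHomeomorph M (Coord n)} [IsManifold (𝓡 (4 * n)) ∞ M]

/-- The components of a bilinear form in a coordinate system. -/
def coordMetric (φ : OpenPartialHomeomorph M (Coord n))
    (g : ∀ x : M, TangentSpace (𝓡 (4 * n)) x →L[ℝ] TangentSpace (𝓡 (4 * n)) x →L[ℝ] ℝ)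
    (z : Coord n) : Coord n →L[ℝ] Coord n →L[ℝ] ℝ :=
  letI b : Model n →L[ℝ] Model n →L[ℝ] ℝ := g (φ.symm z)
  letI L : Coord n →L[ℝ] Model n := coordLift φ (φ.symm z)
  b.bilinearComp L L

/-- The components of an endomorphism of the tangent bundle in a coordinate system. -/
def coordEndo (φ : OpenPartialHomeomorph M (Coord n))
    (N : ∀ x : M, TangentSpace (𝓡 (4 * n)) x →L[ℝ] TangentSpace (𝓡 (4 * n)) x)
    (z : Coord n) : Coord n →L[ℝ] Coord n :=
  (coordDiff φ (φ.symm z)).comp ((N (φ.symm z)).comp (coordLift φ (φ.symm z)))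

lemma coordMetric_apply
    (g : ∀ x : M, TangentSpace (𝓡 (4 * n)) x →L[ℝ] TangentSpace (𝓡 (4 * n)) x →L[ℝ] ℝ)
    (z v w : Coord n) : coordMetric φ g z v w
      = g (φ.symm z) (coordLift φ (φ.symm z) v) (coordLift φ (φ.symm z) w) := rfl

lemma coordEndo_apply
    (N : ∀ x : M, TangentSpace (𝓡 (4 * n)) x →L[ℝ] TangentSpace (𝓡 (4 * n)) x)
    (z v : Coord n) : coordEndo φ N z v
      = coordDiff φ (φ.symm z) (N (φ.symm z) (coordLift φ (φ.symm z) v)) := rfl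

namespace IsCoordinateSystem

/-- All conditions are read off on coordinate fields, those with constant components. -/
lemma localNullKahler (h : IsCoordinateSystem φ)
    {g : ∀ x : M, TangentSpace (𝓡 (4 * n)) x →L[ℝ] TangentSpace (𝓡 (4 * n)) x →L[ℝ] ℝ}
    {N : ∀ x : M, TangentSpace (𝓡 (4 * n)) x →L[ℝ] TangentSpace (𝓡 (4 * n)) x}
    (hK : IsNullKahlerOn g N univ) :
    LocalNullKahler (coordMetric φ g) (coordEndo φ N) φ.target := by
  obtain ⟨cov, hcov, hpar⟩ := hK.parallel
  have hE : ∀ (v : Coord n) (q), q ∈ φ.source → ContMDiffAt (𝓡 (4 * n)) ((𝓡 (4 * n)).prod 𝓘(ℝ, Model n)) ∞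
      (fun z ↦ TotalSpace.mk' (Model n) (E := fun x : M ↦ TangentSpace (𝓡 (4 * n)) x)
        z (coordLift φ z v)) q := fun v q hq ↦
    h.contMDiffAt_liftField hq (w := fun _ ↦ v) contDiffAt_const
  have hNE : ∀ (v : Coord n) (q), q ∈ φ.source → ContMDiffAt (𝓡 (4 * n)) ((𝓡 (4 * n)).prod 𝓘(ℝ, Model n)) ∞
      (fun z ↦ TotalSpace.mk' (Model n) (E := fun x : M ↦ TangentSpace (𝓡 (4 * n)) x)
        z (N z (coordLift φ z v))) q := fun v q hq ↦
    (hK.smooth_endo.contMDiffAt univ_mem).clm_bundle_apply (hE v q hq)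
  have hg : ∀ (Y Z : ∀ x : M, TangentSpace (𝓡 (4 * n)) x) (q), 
      ContMDiffAt (𝓡 (4 * n)) ((𝓡 (4 * n)).prod 𝓘(ℝ, Model n)) ∞
      (fun z ↦ TotalSpace.mk' (Model n) (E := fun x : M ↦ TangentSpace (𝓡 (4 * n)) x)
        z (Y z)) q → ContMDiffAt (𝓡 (4 * n)) ((𝓡 (4 * n)).prod 𝓘(ℝ, Model n)) ∞
      (fun z ↦ TotalSpace.mk' (Model n) (E := fun x : M ↦ TangentSpace (𝓡 (4 * n)) x)
        z (Z z)) q → ContMDiffAt (𝓡 (4 * n)) 𝓘(ℝ, ℝ) ∞ (fun x ↦ g x (Y x) (Z x)) q := by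
    intro Y Z q hY hZ
    have := ContMDiffAt.clm_bundle_apply₂ (F₁ := Model n) (F₂ := Model n) (F₃ := ℝ)
      (E₃ := Bundle.Trivial M ℝ)
      (hK.smooth_metric.contMDiffAt (x := q) univ_mem) hY hZ
    simp only [contMDiffAt_totalSpace] at this
    exact this.2
  have hform : ∀ z ∈ φ.target, ∀ v w, (coordMetric φ g z).comp (coordEndo φ N z) v w
      = g (φ.symm z) (N (φ.symm z) (coordLift φ (φ.symm z) v)) (coordLift φ (φ.symm z) w) := by
    intro z hz v w
    rw [ContinuousLinearMap.comp_apply, coordMetric_apply, coordEndo_apply,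
      h.coordLift_coordDiff (φ.map_target hz)]
  have hsm : ContDiffOn ℝ ∞ (coordMetric φ g) φ.target := by
    refine contDiffOn_clm_apply.2 fun v ↦ contDiffOn_clm_apply.2 fun w z hz ↦ ?_
    have hq := φ.map_target hz
    exact ((hg _ _ _ (hE v _ hq) (hE w _ hq)).comp z
      (h.contMDiffAt_symm hz)).contDiffAt.contDiffWithinAt
  have hsf : ContDiffOn ℝ ∞ (fun z ↦ (coordMetric φ g z).comp (coordEndo φ N z)) φ.target := by
    refine contDiffOn_clm_apply.2 fun v ↦ contDiffOn_clm_apply.2 fun w ↦ ?_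
    refine ContDiffOn.congr (fun z hz ↦ ?_) (fun z hz ↦ hform z hz v w)
    have hq := φ.map_target hz
    exact ((hg _ _ _ (hNE v _ hq) (hE w _ hq)).comp z
      (h.contMDiffAt_symm hz)).contDiffAt.contDiffWithinAt
  refine ⟨φ.open_target, hsm, hsf, fun z _ v w ↦ hK.symm _ (mem_univ _) _ _, ?_, ?_, ?_, ?_⟩
  · intro z hz v hv
    have hq := φ.map_target hz
    have := hK.nondegenerate (φ.symm z) (mem_univ _) (coordLift φ (φ.symm z) v) fun w ↦ by
      simpa [coordMetric_apply, h.coordLift_coordDiff hq] using hv (coordDiff φ (φ.symm z) w)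
    rw [← h.coordDiff_coordLift hq v, this, map_zero]
  · intro z hz v
    have hq := φ.map_target hz
    rw [coordEndo_apply, coordEndo_apply, h.coordLift_coordDiff hq, hK.sq_zero _ (mem_univ _),
      map_zero]
  · intro z hz v w
    have hq := φ.map_target hz
    rw [coordMetric_apply, coordMetric_apply, coordEndo_apply, coordEndo_apply,
      h.coordLift_coordDiff hq, h.coordLift_coordDiff hq]
    exact hK.skew _ (mem_univ _) _ _
  · intro z hz
    set q := φ.symm z with hqz
    have hq : q ∈ φ.source := φ.map_target hz
    have hzq : φ q = z := φ.right_inv hz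
    have hEd : ∀ v, DifferentiableFieldAt (liftField φ fun _ ↦ v) q := fun v ↦
      (hE v q hq).mdifferentiableAt (by simp)
    have hNEd : ∀ v, DifferentiableFieldAt (fun z ↦ N z (liftField φ (fun _ ↦ v) z)) q := fun v ↦
      (hNE v q hq).mdifferentiableAt (by simp)
    have happ : ∀ (B : Coord n → Coord n →L[ℝ] Coord n →L[ℝ] ℝ), ContDiffOn ℝ ∞ B φ.target →
        ∀ v w u, fderiv ℝ B z v w u = fderiv ℝ (fun z ↦ B z w u) z v := by
      intro B hB v w u
      rw [(hasFDerivAt_bilin_apply ((hB.contDiffAt (φ.open_target.mem_nhds hz)).differentiableAt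
        (by simp)) w u).fderiv]
      rfl
    -- The Christoffel symbols are the components of the covariant derivatives of coordinate fields.
    -- They are symmetric because these fields commute.
    refine ⟨fun v w ↦ coordDiff φ q (cov (liftField φ fun _ ↦ w) q (coordLift φ q v)), ?_, ?_, ?_⟩
    · intro v w
      have h1 := hcov.torsion_free q (mem_univ _) _ _ (hEd v) (hEd w)
      have h2 := h.mlieBracket_eq hq (hEd v) (hEd w)
      have h3 : ∀ v : Coord n, fderiv ℝ (coordField φ (liftField φ fun _ ↦ v)) (φ q) = 0 := by
        intro v
        have : coordField φ (liftField φ fun _ ↦ v) =ᶠ[𝓝 (φ q)] fun _ ↦ v := by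
          filter_upwards [φ.open_target.mem_nhds (φ.map_source hq)] with y hy
            using h.coordField_liftField hy _
        rw [this.fderiv_eq, fderiv_const_apply]
      rw [h3, h3, ← h1, map_sub] at h2
      exact sub_eq_zero.1 (by simpa [liftField] using h2)
    · intro v w u
      have h1 := hcov.metric q (mem_univ _) _ _ (hEd w) (hEd u) (coordLift φ q v)
      simp only [liftField] at h1
      rw [h.mvfderiv_eq hq (h.differentiableAt_comp_symm hq
        ((hg _ _ q (hE w q hq) (hE u q hq)).mdifferentiableAt (by simp))),
        h.coordDiff_coordLift hq, hzq] at h1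
      rw [happ _ hsm, coordMetric_apply, coordMetric_apply, ← hqz, h.coordLift_coordDiff hq,
        h.coordLift_coordDiff hq]
      exact h1
    · intro v w u
      -- Metric compatibility for `N E_w` and `E_u`, where `E_w` and `E_u` are the coordinate
      -- fields, combined with `∇ (N E_w) = N ∇ E_w`, is parallelism of the two-form.
      have h1 := hcov.metric q (mem_univ _) _ _ (hNEd w) (hEd u) (coordLift φ q v)
      rw [hpar q (mem_univ _) _ (hEd w)] at h1
      simp only [liftField] at h1
      rw [h.mvfderiv_eq hq (h.differentiableAt_comp_symm hq
        ((hg _ _ q (hNE w q hq) (hE u q hq)).mdifferentiableAt (by simp))),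
        h.coordDiff_coordLift hq, hzq] at h1
      rw [happ _ hsf, coordMetric_apply, coordMetric_apply, coordEndo_apply, coordEndo_apply,
        ← hqz, h.coordLift_coordDiff hq,
        h.coordLift_coordDiff hq, h.coordLift_coordDiff hq, h.coordLift_coordDiff hq, ← h1]
      have h2 : (fun y ↦ (coordMetric φ g y).comp (coordEndo φ N y) w u) =ᶠ[𝓝 z] fun y ↦
          g (φ.symm y) (N (φ.symm y) (coordLift φ (φ.symm y) w)) (coordLift φ (φ.symm y) u) := by
        filter_upwards [φ.open_target.mem_nhds hz] with y hy using hform y hy w u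
      rw [h2.fderiv_eq]

end IsCoordinateSystem

end Coordinates

/-! ### Changes of coordinates and existence of normal coordinates -/

section Coordinates

variable {n : ℕ} {M : Type*} [TopologicalSpace M] [ChartedSpace (Model n) M]
  [IsManifold (𝓡 (4 * n)) ∞ M] {ψ : OpenPartialHomeomorph M (Coord n)} {e : OpenPartialHomeomorph (Coord n) (Coord n)}

lemma fderiv_symm_fderiv {B B' : Type*} [NormedAddCommGroup B] [NormedSpace ℝ B]
    [NormedAddCommGroup B'] [NormedSpace ℝ B'] {e : OpenPartialHomeomorph B B'}
    (he : ContDiffOn ℝ ∞ e e.source) (he' : ContDiffOn ℝ ∞ e.symm e.target) {z : B}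
    (hz : z ∈ e.source) (v : B) : fderiv ℝ e.symm (e z) (fderiv ℝ e z v) = v := by
  have h1 := ((he.contDiffAt (e.open_source.mem_nhds hz)).differentiableAt (by simp)).hasFDerivAt
  have h2 := ((he'.contDiffAt (e.open_target.mem_nhds (e.map_source hz))).differentiableAt
    (by simp)).hasFDerivAt
  have h3 := (h2.comp z h1).congr_of_eventuallyEq (f₁ := id) (by
    filter_upwards [e.open_source.mem_nhds hz] with y hy using (e.left_inv hy).symm)
  exact congrArg (fun L : B →L[ℝ] B ↦ L v) (h3.unique (hasFDerivAt_id z))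

namespace IsCoordinateSystem

lemma trans (h : IsCoordinateSystem ψ) (he : ContDiffOn ℝ ∞ e e.source)
    (he' : ContDiffOn ℝ ∞ e.symm e.target) : IsCoordinateSystem (ψ.trans e) := by
  refine ⟨?_, ?_⟩
  · rw [OpenPartialHomeomorph.trans_source]
    exact he.contMDiffOn.comp (h.smooth.mono inter_subset_left) (fun q hq ↦ hq.2)
  · rw [OpenPartialHomeomorph.trans_target]
    exact h.smooth_symm.comp (he'.contMDiffOn.mono inter_subset_left) (fun q hq ↦ hq.2)

lemma coordDiff_trans (h : IsCoordinateSystem ψ) (he : ContDiffOn ℝ ∞ e e.source) {q : M}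
    (hq : q ∈ ψ.source) (hq' : ψ q ∈ e.source) (v : TangentSpace (𝓡 (4 * n)) q) :
    coordDiff (ψ.trans e) q v = fderiv ℝ e (ψ q) (coordDiff ψ q v) := by
  have h1 := ((he.contDiffAt (e.open_source.mem_nhds hq')).differentiableAt
    (by simp)).mdifferentiableAt
  have h2 := mfderiv_comp q h1 (h.mdifferentiable.mdifferentiableAt hq)
  rw [mfderiv_eq_fderiv] at h2
  exact congrArg (fun L : TangentSpace (𝓡 (4 * n)) q →L[ℝ] Coord n ↦ L v) h2

lemma coordLift_trans (h : IsCoordinateSystem ψ) (he : ContDiffOn ℝ ∞ e e.source)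
    (he' : ContDiffOn ℝ ∞ e.symm e.target) {q : M}
    (hq : q ∈ ψ.source) (hq' : ψ q ∈ e.source) (v : Coord n) :
    coordLift (ψ.trans e) q (fderiv ℝ e (ψ q) v) = coordLift ψ q v := by
  have h1 := h.coordDiff_trans he hq hq' (coordLift ψ q v)
  rw [h.coordDiff_coordLift hq] at h1
  rw [← h1, (h.trans he he').coordLift_coordDiff (by simpa using ⟨hq, hq'⟩)]

lemma coordMetric_trans (h : IsCoordinateSystem ψ) (he : ContDiffOn ℝ ∞ e e.source)
    (he' : ContDiffOn ℝ ∞ e.symm e.target)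
    (g : ∀ x : M, TangentSpace (𝓡 (4 * n)) x →L[ℝ] TangentSpace (𝓡 (4 * n)) x →L[ℝ] ℝ)
    {z : Coord n} (hz : z ∈ ψ.target) (hz' : z ∈ e.source) (v w : Coord n) :
    coordMetric (ψ.trans e) g (e z) (fderiv ℝ e z v) (fderiv ℝ e z w)
      = coordMetric ψ g z v w := by
  have h1 := h.coordLift_trans he he' (ψ.map_target hz) (by rwa [ψ.right_inv hz])
  rw [ψ.right_inv hz] at h1
  have h2 : (ψ.trans e).symm (e z) = ψ.symm z := by simp [e.left_inv hz']
  rw [coordMetric_apply, coordMetric_apply, h2, h1, h1]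

lemma coordEndo_trans (h : IsCoordinateSystem ψ) (he : ContDiffOn ℝ ∞ e e.source)
    (he' : ContDiffOn ℝ ∞ e.symm e.target)
    (N : ∀ x : M, TangentSpace (𝓡 (4 * n)) x →L[ℝ] TangentSpace (𝓡 (4 * n)) x)
    {z : Coord n} (hz : z ∈ ψ.target) (hz' : z ∈ e.source) (v : Coord n) :
    coordEndo (ψ.trans e) N (e z) (fderiv ℝ e z v) = fderiv ℝ e z (coordEndo ψ N z v) := by
  have hq' : ψ (ψ.symm z) ∈ e.source := by rwa [ψ.right_inv hz]
  have h1 := h.coordLift_trans he he' (ψ.map_target hz) hq'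
  have h3 := h.coordDiff_trans he (ψ.map_target hz) hq'
  rw [ψ.right_inv hz] at h1 h3
  have h2 : (ψ.trans e).symm (e z) = ψ.symm z := by simp [e.left_inv hz']
  rw [coordEndo_apply, coordEndo_apply, h2, h1, h3]

lemma finrank_range_coordEndo (h : IsCoordinateSystem ψ)
    (N : ∀ x : M, TangentSpace (𝓡 (4 * n)) x →L[ℝ] TangentSpace (𝓡 (4 * n)) x)
    {z : Coord n} (hz : z ∈ ψ.target) :
    Module.finrank ℝ (LinearMap.range (coordEndo ψ N z).toLinearMap)
      = Module.finrank ℝ (LinearMap.range (N (ψ.symm z)).toLinearMap) := by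
  have hq := ψ.map_target hz
  let D : TangentSpace (𝓡 (4 * n)) (ψ.symm z) ≃ₗ[ℝ] Coord n :=
    { (coordDiff ψ (ψ.symm z)).toLinearMap with
      invFun := coordLift ψ (ψ.symm z)
      left_inv := h.coordLift_coordDiff hq
      right_inv := h.coordDiff_coordLift hq }
  have : LinearMap.range (coordEndo ψ N z).toLinearMap
      = (LinearMap.range (N (ψ.symm z)).toLinearMap).map D.toLinearMap := by
    ext w
    constructor
    · rintro ⟨v, rfl⟩
      exact ⟨_, ⟨coordLift ψ (ψ.symm z) v, rfl⟩, rfl⟩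
    · rintro ⟨_, ⟨v, rfl⟩, rfl⟩
      refine ⟨coordDiff ψ (ψ.symm z) v, ?_⟩
      change coordEndo ψ N z _ = coordDiff ψ (ψ.symm z) (N (ψ.symm z) v)
      rw [coordEndo_apply, h.coordLift_coordDiff hq]
  rw [this]
  exact LinearEquiv.finrank_map_eq D _

end IsCoordinateSystem

lemma exists_centred_coordinates (p : M) : ∃ ψ : OpenPartialHomeomorph M (Coord n),
    IsCoordinateSystem ψ ∧ p ∈ ψ.source ∧ ψ p = 0 := by
  let T : Model n ≃L[ℝ] Coord n := ContinuousLinearEquiv.ofFinrankEq (by simp; ring)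
  let c := chartAt (Model n) p
  let a : Model n ≃ₜ Coord n := (Homeomorph.addRight (-c p)).trans T.toHomeomorph
  have ha : ContDiff ℝ ∞ a := T.contDiff.comp (contDiff_id.add contDiff_const)
  have ha' : ContDiff ℝ ∞ a.symm := (T.symm.contDiff).add contDiff_const
  refine ⟨c.trans a.toOpenPartialHomeomorph, ⟨?_, ?_⟩, ?_, ?_⟩
  · have hs : (c.trans a.toOpenPartialHomeomorph).source = c.source := by simp
    rw [hs]
    exact ha.contMDiff.comp_contMDiffOn contMDiffOn_chart
  · exact contMDiffOn_chart_symm.comp ha'.contMDiff.contMDiffOn (fun z hz ↦ by simpa using hz)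
  · simp [c]
  · simp [a, c]

/-- The local changes are composed with a centred chart in turn: linear adaptation at the point,
Darboux, fibre coordinates, and a final shrinking to where the Hessian identity holds. The
null-Kähler conditions are read again in each new chart, so no transformation law for Christoffel
symbols is needed. -/
lemma exists_normal_coordinates
    {g : ∀ x : M, TangentSpace (𝓡 (4 * n)) x →L[ℝ] TangentSpace (𝓡 (4 * n)) x →L[ℝ] ℝ}
    {N : ∀ x : M, TangentSpace (𝓡 (4 * n)) x →L[ℝ] TangentSpace (𝓡 (4 * n)) x}
    (hK : IsNullKahlerOn g N univ) (p : M) :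
    ∃ (φ : OpenPartialHomeomorph M (Coord n)) (Θ : Coord n → ℝ), IsCoordinateSystem φ ∧
      p ∈ φ.source ∧ ContDiff ℝ ∞ Θ ∧ ∀ z ∈ φ.target,
        (∀ v, coordEndo φ N z v = (0, v.1)) ∧
        (∀ b v, coordMetric φ g z (0, b) v = halfOmega n b v.1) ∧
        ∀ a b, fderiv ℝ (fun w ↦ fderiv ℝ Θ w (0, b)) z (0, a)
          = coordMetric φ g z (a, 0) (b, 0) := by
  obtain ⟨ψ₀, h₀, hp₀, hψ₀⟩ := exists_centred_coordinates (n := n) p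
  have ht₀ : (0 : Coord n) ∈ ψ₀.target := hψ₀ ▸ ψ₀.map_source hp₀
  have hK₀ := h₀.localNullKahler hK
  -- coordinates adapted at the point
  obtain ⟨ψ₁, h₁, hp₁, hψ₁, hN₁, hG₁⟩ : ∃ ψ : OpenPartialHomeomorph M (Coord n),
      IsCoordinateSystem ψ ∧ p ∈ ψ.source ∧ ψ p = 0 ∧ (∀ v, coordEndo ψ N 0 v = (0, v.1)) ∧
        ∀ b v, coordMetric ψ g 0 (0, b) v = halfOmega n b v.1 := by
    have hrank : Module.finrank ℝ (LinearMap.range (coordEndo ψ₀ N 0).toLinearMap) = 2 * n := by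
      rw [h₀.finrank_range_coordEndo N ht₀]
      exact hK.rank _ (mem_univ _)
    obtain ⟨A, hA, hA'⟩ := exists_adapted_coordinates (n := n) (Z := Coord n) (by simp; ring)
      (coordMetric ψ₀ g 0) (coordEndo ψ₀ N 0) (hK₀.symm 0 ht₀) (hK₀.nondegenerate 0 ht₀)
      (hK₀.sq_zero 0 ht₀) hrank (hK₀.skew 0 ht₀)
    let e := A.toHomeomorph.toOpenPartialHomeomorph
    have he : ContDiffOn ℝ ∞ e e.source := A.contDiff.contDiffOn
    have he' : ContDiffOn ℝ ∞ e.symm e.target := A.symm.contDiff.contDiffOn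
    have hfd : fderiv ℝ e 0 = A := A.fderiv
    have he0 : e 0 = 0 := map_zero A
    have h1 := h₀.coordMetric_trans he he' g ht₀ (mem_univ _)
    have h2 := h₀.coordEndo_trans he he' N ht₀ (mem_univ _)
    rw [hfd, he0] at h1 h2
    refine ⟨ψ₀.trans e, h₀.trans he he', by simp [hp₀, e], by simp [hψ₀, he0], fun v ↦ ?_,
      fun b v ↦ ?_⟩
    · obtain ⟨v, rfl⟩ := A.surjective v
      rw [← hA]
      exact h2 v
    · obtain ⟨v, rfl⟩ := A.surjective v
      rw [← hA', ← h1]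
      simp
  have ht₁ : (0 : Coord n) ∈ ψ₁.target := hψ₁ ▸ ψ₁.map_source hp₁
  have hσ := halfOmega_nondegenerate (n := n)
  -- coordinates in which the two-form is constant
  obtain ⟨ψ₂, h₂, hp₂, hψ₂, hΩ₂⟩ : ∃ ψ : OpenPartialHomeomorph M (Coord n),
      IsCoordinateSystem ψ ∧ p ∈ ψ.source ∧ ψ p = 0 ∧
        ∀ z ∈ ψ.target, ∀ a b, coordMetric ψ g z (coordEndo ψ N z a) b
          = halfOmega n a.1 b.1 := by
    obtain ⟨U, f, hU, h0U, hf, hf0, hf', hfU⟩ :=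
      (h₁.localNullKahler hK).exists_darboux ht₁ hσ hN₁ hG₁
    obtain ⟨e, h0e, heU, hef, hes⟩ := exists_openPartialHomeomorph hU hf h0U
      (f' := ContinuousLinearEquiv.refl ℝ (Coord n)) hf'
    have hfe : ⇑e = f := funext hef
    have he : ContDiffOn ℝ ∞ e e.source := hfe ▸ hf.mono heU
    have he0 : e 0 = 0 := (hef 0).trans hf0
    have h0t : (0 : Coord n) ∈ e.target := he0 ▸ e.map_source h0e
    have hes0 : e.symm 0 = 0 := by rw [← he0, e.left_inv h0e, he0]
    have he'' : ContDiffOn ℝ ∞ e.symm.symm e.symm.target := by simpa using he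
    -- Darboux's map goes from the new coordinates to the old ones, hence the inverse here.
    refine ⟨ψ₁.trans e.symm, h₁.trans hes he'', by simp [hp₁, hψ₁, h0t], by simp [hψ₁, hes0], ?_⟩
    intro z hz a b
    rw [OpenPartialHomeomorph.trans_target] at hz
    obtain ⟨hz1, hz2⟩ := hz
    have hze : z ∈ e.source := by simpa using hz1
    have hz3 : e z ∈ ψ₁.target := by simpa using hz2
    have h1 := h₁.coordMetric_trans hes he'' g hz3 (e.map_source hze)
    have h2 := h₁.coordEndo_trans hes he'' N hz3 (e.map_source hze)
    have h3 := fderiv_symm_fderiv he hes hze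
    rw [e.left_inv hze] at h1 h2
    rw [← h3 a, h2, ← h3 b, h1, h3, h3, hfe]
    exact (hfU z (heU hze)).2 a b
  have ht₂ : (0 : Coord n) ∈ ψ₂.target := hψ₂ ▸ ψ₂.map_source hp₂
  -- coordinates on the fibres
  obtain ⟨ψ₃, h₃, hp₃, hψ₃, hN₃, hG₃⟩ : ∃ ψ : OpenPartialHomeomorph M (Coord n),
      IsCoordinateSystem ψ ∧ p ∈ ψ.source ∧ ψ p = 0 ∧
        (∀ z ∈ ψ.target, ∀ v, coordEndo ψ N z v = (0, v.1)) ∧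
        ∀ z ∈ ψ.target, ∀ b v, coordMetric ψ g z (0, b) v = halfOmega n b v.1 := by
    obtain ⟨U, κ, κ', hU, h0U, hUO, hκ, hκ0, hκ', hκU⟩ :=
      (h₂.localNullKahler hK).exists_fibre_coordinates ht₂ hσ hΩ₂
    obtain ⟨e, h0e, heU, hef, hes⟩ := exists_openPartialHomeomorph hU hκ h0U hκ'
    have hfe : ⇑e = κ := funext hef
    have he : ContDiffOn ℝ ∞ e e.source := hfe ▸ hκ.mono heU
    have he0 : e 0 = 0 := (hef 0).trans hκ0
    have hpt : ∀ y ∈ (ψ₂.trans e).target, ∃ z, y = e z ∧ z ∈ e.source ∧ z ∈ ψ₂.target := by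
      intro y hy
      rw [OpenPartialHomeomorph.trans_target] at hy
      exact ⟨e.symm y, (e.right_inv hy.1).symm, e.map_target hy.1, hy.2⟩
    have hsurj : ∀ z ∈ e.source, ∀ v, ∃ w, v = fderiv ℝ κ z w := by
      intro z hz v
      have := fderiv_symm_fderiv (e := e.symm) hes (by simpa using he) (e.map_source hz) v
      rw [e.left_inv hz, e.symm_symm, hfe] at this
      exact ⟨_, this.symm⟩
    refine ⟨ψ₂.trans e, h₂.trans he hes, by simp [hp₂, hψ₂, h0e], by simp [hψ₂, he0], ?_, ?_⟩
    · intro y hy v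
      obtain ⟨z, rfl, hz, hz2⟩ := hpt y hy
      obtain ⟨hk1, hk2, hk3⟩ := hκU z (heU hz)
      obtain ⟨w, rfl⟩ := hsurj z hz v
      have h1 := h₂.coordEndo_trans he hes N hz2 hz w
      rw [hfe] at h1 ⊢
      rw [h1, hk3, hk1]
    · intro y hy b v
      obtain ⟨z, rfl, hz, hz2⟩ := hpt y hy
      obtain ⟨hk1, hk2, hk3⟩ := hκU z (heU hz)
      obtain ⟨w, rfl⟩ := hsurj z hz v
      obtain ⟨⟨u, c⟩, hu⟩ := hsurj z hz (0, b)
      obtain rfl : u = 0 := by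
        have := hk1 (u, c)
        rw [← hu] at this
        exact this.symm
      have h1 := h₂.coordMetric_trans he hes g hz2 hz (0, c) w
      rw [hfe] at h1 ⊢
      rw [hu, h1, hk2, ← hu, hk1]
  have ht₃ : (0 : Coord n) ∈ ψ₃.target := hψ₃ ▸ ψ₃.map_source hp₃
  obtain ⟨Θ, hΘ, hΘG⟩ := (h₃.localNullKahler hK).exists_potential ht₃ hσ halfOmega_skew hN₃ hG₃
  obtain ⟨V, hV, hVo, h0V⟩ := eventually_nhds_iff.1 hΘG
  -- Restriction of the domain to the open set on which the Hessian identity holds.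
  let e := OpenPartialHomeomorph.ofSet V hVo
  have he : ContDiffOn ℝ ∞ e e.source := contDiffOn_id
  have he' : ContDiffOn ℝ ∞ e.symm e.target := contDiffOn_id
  have hfd : ∀ z, fderiv ℝ e z = ContinuousLinearMap.id ℝ (Coord n) := fun z ↦ fderiv_id
  refine ⟨ψ₃.trans e, Θ, h₃.trans he he', by simp [hp₃, hψ₃, e, h0V], hΘ, fun z hz ↦ ?_⟩
  have hz3 : z ∈ ψ₃.target := by
    rw [OpenPartialHomeomorph.trans_target] at hz; exact hz.2
  have hzV : z ∈ V := by
    rw [OpenPartialHomeomorph.trans_target] at hz; exact hz.1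
  have h1 : ∀ v w, coordMetric (ψ₃.trans e) g z v w = coordMetric ψ₃ g z v w := fun v w ↦ by
    simpa only [hfd] using! h₃.coordMetric_trans he he' g hz3 hzV v w
  have h2 : ∀ v, coordEndo (ψ₃.trans e) N z v = coordEndo ψ₃ N z v := fun v ↦ by
    simpa only [hfd] using! h₃.coordEndo_trans he he' N hz3 hzV v
  refine ⟨fun v ↦ ?_, fun b v ↦ ?_, fun a b ↦ ?_⟩
  · rw [h2, hN₃ z hz3]
  · rw [h1, hG₃ z hz3]
  · rw [h1]
    exact hV z hzV a b

end Coordinates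

/-! ### The normal form as a bilinear form on the coordinate space -/

section Model

variable {n : ℕ}

/-- The second derivative of a function of the coordinates along the fibres. -/
def fibreHess (T : Coord n → ℝ) (z : Coord n) : Coord n →L[ℝ] Coord n →L[ℝ] ℝ :=
  (fderiv ℝ (fderiv ℝ T) z).bilinearComp
    ((ContinuousLinearMap.inr ℝ (Idx n → ℝ) (Idx n → ℝ)).comp (ContinuousLinearMap.fst ℝ _ _))
    ((ContinuousLinearMap.inr ℝ (Idx n → ℝ) (Idx n → ℝ)).comp (ContinuousLinearMap.fst ℝ _ _))

/-- The normal form of the metric, as a bilinear form on `ℝ²ⁿ × ℝ²ⁿ`. -/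
def modelMetric (T : Coord n → ℝ) (z : Coord n) : Coord n →L[ℝ] Coord n →L[ℝ] ℝ :=
  (halfOmega n).bilinearComp (ContinuousLinearMap.snd ℝ _ _) (ContinuousLinearMap.fst ℝ _ _)
    + ((halfOmega n).bilinearComp (ContinuousLinearMap.snd ℝ _ _)
      (ContinuousLinearMap.fst ℝ _ _)).flip
    + fibreHess T z

lemma fibreHess_apply (T : Coord n → ℝ) (z v w : Coord n) :
    fibreHess T z v w = fderiv ℝ (fderiv ℝ T) z (0, v.1) (0, w.1) := rfl

lemma modelMetric_apply (T : Coord n → ℝ) (z v w : Coord n) :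
    modelMetric T z v w = halfOmega n v.2 w.1 + halfOmega n w.2 v.1 + fibreHess T z v w := rfl

lemma fderiv_fderiv_apply {T : Coord n → ℝ} {z : Coord n} (hT : ContDiffAt ℝ ∞ T z)
    (a b : Coord n) :
    fderiv ℝ (fun w ↦ fderiv ℝ T w b) z a = fderiv ℝ (fderiv ℝ T) z a b := by
  have h1 : ContDiffAt ℝ ∞ (fderiv ℝ T) z := hT.fderiv_right (by simp)
  have h2 := (h1.differentiableAt (by simp)).hasFDerivAt.clm_apply (hasFDerivAt_const b z)
  rw [h2.fderiv]
  simp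

lemma fderiv_fderiv_symm {T : Coord n → ℝ} {z : Coord n} (hT : ContDiffAt ℝ 2 T z)
    (a b : Coord n) :
    fderiv ℝ (fderiv ℝ T) z a b = fderiv ℝ (fderiv ℝ T) z b a :=
  (hT.isSymmSndFDerivAt (by simp)).eq a b

lemma inr_eq_sum (a : Idx n → ℝ) :
    ((0, a) : Coord n) = ∑ i, a i • ((0, Pi.single i 1) : Coord n) := by
  ext j <;> simp [Prod.fst_sum, Prod.snd_sum, Finset.sum_apply, Pi.single_apply,
    -Fintype.sum_sum_type]

lemma bilin_inr_sum (B : Coord n →L[ℝ] Coord n →L[ℝ] ℝ) (a b : Idx n → ℝ) :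
    B (0, a) (0, b)
      = ∑ i, ∑ j, B (0, Pi.single i 1) (0, Pi.single j 1) * (a i * b j) := by
  rw [inr_eq_sum a, inr_eq_sum b]
  simp only [map_sum, map_smul, _root_.sum_apply, _root_.smul_apply, smul_eq_mul]
  rw [Finset.sum_comm]
  refine Finset.sum_congr rfl fun i _ ↦ ?_
  rw [Finset.mul_sum]
  exact Finset.sum_congr rfl fun j _ ↦ by ring

end Model

/-! ### The normal form on the manifold -/

section Coordinates

variable {n : ℕ} {M : Type*} [TopologicalSpace M] [ChartedSpace (Model n) M]
  [IsManifold (𝓡 (4 * n)) ∞ M] {φ : OpenPartialHomeomorph M (Coord n)}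

namespace IsCoordinateSystem

lemma dx_apply (h : IsCoordinateSystem φ) {q : M} (hq : q ∈ φ.source) (i : Idx n)
    (v : TangentSpace (𝓡 (4 * n)) q) : dx φ i q v = (coordDiff φ q v).1 i := by
  let pr : Coord n →L[ℝ] ℝ :=
    (ContinuousLinearMap.proj i).comp (ContinuousLinearMap.fst ℝ (Idx n → ℝ) (Idx n → ℝ))
  have h1 : (fun z ↦ (φ (φ.symm z)).1 i) =ᶠ[𝓝 (φ q)] pr := by
    filter_upwards [φ.open_target.mem_nhds (φ.map_source hq)] with z hz
    rw [φ.right_inv hz]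
    rfl
  rw [dx, h.mvfderiv_eq hq (pr.differentiableAt.congr_of_eventuallyEq h1), h1.fderiv_eq, pr.fderiv]
  rfl

lemma dy_apply (h : IsCoordinateSystem φ) {q : M} (hq : q ∈ φ.source) (i : Idx n)
    (v : TangentSpace (𝓡 (4 * n)) q) : dy φ i q v = (coordDiff φ q v).2 i := by
  let pr : Coord n →L[ℝ] ℝ :=
    (ContinuousLinearMap.proj i).comp (ContinuousLinearMap.snd ℝ (Idx n → ℝ) (Idx n → ℝ))
  have h1 : (fun z ↦ (φ (φ.symm z)).2 i) =ᶠ[𝓝 (φ q)] pr := by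
    filter_upwards [φ.open_target.mem_nhds (φ.map_source hq)] with z hz
    rw [φ.right_inv hz]
    rfl
  rw [dy, h.mvfderiv_eq hq (pr.differentiableAt.congr_of_eventuallyEq h1), h1.fderiv_eq, pr.fderiv]
  rfl

lemma contDiffAt_comp_symm (h : IsCoordinateSystem φ) {Θ : M → ℝ}
    (hΘ : ContMDiffOn (𝓡 (4 * n)) 𝓘(ℝ, ℝ) ∞ Θ φ.source) {z : Coord n} (hz : z ∈ φ.target) :
    ContDiffAt ℝ ∞ (fun z ↦ Θ (φ.symm z)) z :=
  ((hΘ.contMDiffAt (φ.open_source.mem_nhds (φ.map_target hz))).comp z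
    (h.contMDiffAt_symm hz)).contDiffAt

lemma normalEndo_apply (h : IsCoordinateSystem φ) {q : M} (hq : q ∈ φ.source)
    (v : TangentSpace (𝓡 (4 * n)) q) :
    normalEndo φ q v = coordLift φ q (0, (coordDiff φ q v).1) := by
  rw [inr_eq_sum (coordDiff φ q v).1, map_sum, normalEndo, _root_.sum_apply]
  refine Finset.sum_congr rfl fun i _ ↦ ?_
  rw [map_smul, ContinuousLinearMap.smulRight_apply, h.dx_apply hq]
  rfl

/-- The two halves of the symmetrized Hessian sum agree because second derivatives commute, so the
factor `½` disappears there; in the mixed part it is absorbed in `halfOmega`. -/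
lemma normalMetric_apply (h : IsCoordinateSystem φ) {Θ : M → ℝ}
    (hΘ : ContMDiffOn (𝓡 (4 * n)) 𝓘(ℝ, ℝ) ∞ Θ φ.source) {q : M} (hq : q ∈ φ.source)
    (v w : TangentSpace (𝓡 (4 * n)) q) :
    normalMetric φ Θ q v w
      = modelMetric (fun z ↦ Θ (φ.symm z)) (φ q) (coordDiff φ q v) (coordDiff φ q w) := by
  have hT := h.contDiffAt_comp_symm hΘ (φ.map_source hq)
  set T : Coord n → ℝ := fun z ↦ Θ (φ.symm z)
  set a := coordDiff φ q v with ha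
  set b := coordDiff φ q w with hb
  have h1 : normalMetric φ Θ q v w = 1 / 2 * ∑ i, ∑ j, (omega n i j * (a.2 i * b.1 j + a.1 j * b.2 i)
      + hessY φ Θ i j q * (a.1 i * b.1 j + a.1 j * b.1 i)) := by
    simp only [normalMetric, _root_.smul_apply, _root_.sum_apply, _root_.add_apply,
      ContinuousLinearMap.smulRight_apply, smul_eq_mul, h.dx_apply hq, h.dy_apply hq, ← ha, ← hb]
  have hh : ∀ i j, hessY φ Θ i j q
      = fderiv ℝ (fderiv ℝ T) (φ q) (0, Pi.single i 1) (0, Pi.single j 1) := fun i j ↦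
    fderiv_fderiv_apply hT _ _
  have h2 := bilin_inr_sum (fderiv ℝ (fderiv ℝ T) (φ q)) a.1 b.1
  have h3 := bilin_inr_sum (fderiv ℝ (fderiv ℝ T) (φ q)) b.1 a.1
  rw [fderiv_fderiv_symm (hT.of_le two_le_infty) (0, b.1)] at h3
  rw [h1, modelMetric_apply, fibreHess_apply, halfOmega_apply, halfOmega_apply]
  have h4 : ∀ i j, (omega n i j * (a.2 i * b.1 j + a.1 j * b.2 i)
      + hessY φ Θ i j q * (a.1 i * b.1 j + a.1 j * b.1 i))
      = omega n i j * (a.2 i * b.1 j) + omega n i j * (b.2 i * a.1 j)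
        + fderiv ℝ (fderiv ℝ T) (φ q) (0, Pi.single i 1) (0, Pi.single j 1) * (a.1 i * b.1 j)
        + fderiv ℝ (fderiv ℝ T) (φ q) (0, Pi.single i 1) (0, Pi.single j 1) * (b.1 i * a.1 j) := by
    intro i j
    rw [hh]
    ring
  simp only [h4, Finset.sum_add_distrib]
  rw [← h2, ← h3]
  ring

end IsCoordinateSystem

/-- A symmetric form is determined by its blocks: the vertical one vanishes, the mixed one is `½ ω`
and the horizontal one is the Hessian. -/
lemma exists_normal_form
    {g : ∀ x : M, TangentSpace (𝓡 (4 * n)) x →L[ℝ] TangentSpace (𝓡 (4 * n)) x →L[ℝ] ℝ}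
    {N : ∀ x : M, TangentSpace (𝓡 (4 * n)) x →L[ℝ] TangentSpace (𝓡 (4 * n)) x}
    (hK : IsNullKahlerOn g N univ) (p : M) :
    ∃ (φ : OpenPartialHomeomorph M (Coord n)) (Θ : M → ℝ),
      IsCoordinateSystem φ ∧ p ∈ φ.source ∧
      ContMDiffOn (𝓡 (4 * n)) 𝓘(ℝ, ℝ) ∞ Θ φ.source ∧
      ∀ q ∈ φ.source, g q = normalMetric φ Θ q ∧ N q = normalEndo φ q := by
  obtain ⟨φ, T, h, hp, hT, hz⟩ := exists_normal_coordinates hK p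
  have hΘ : ContMDiffOn (𝓡 (4 * n)) 𝓘(ℝ, ℝ) ∞ (fun q ↦ T (φ q)) φ.source :=
    hT.contMDiff.comp_contMDiffOn h.smooth
  refine ⟨φ, fun q ↦ T (φ q), h, hp, hΘ, fun q hq ↦ ?_⟩
  obtain ⟨hN, hG, hH⟩ := hz (φ q) (φ.map_source hq)
  have hK' := h.localNullKahler hK
  refine ⟨?_, ?_⟩
  · ext v w
    have h1 : g q v w = coordMetric φ g (φ q) (coordDiff φ q v) (coordDiff φ q w) := by
      rw [coordMetric_apply, φ.left_inv hq, h.coordLift_coordDiff hq, h.coordLift_coordDiff hq]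
    have h2 : (fun z ↦ T (φ (φ.symm z))) =ᶠ[𝓝 (φ q)] T := by
      filter_upwards [φ.open_target.mem_nhds (φ.map_source hq)] with z hz
      rw [φ.right_inv hz]
    rw [h1, h.normalMetric_apply hΘ hq, modelMetric_apply, fibreHess_apply, h2.fderiv.fderiv_eq,
      ← fderiv_fderiv_apply hT.contDiffAt, hH]
    set a := coordDiff φ q v
    set b := coordDiff φ q w
    have ha : a = (a.1, 0) + (0, a.2) := by simp
    have hb : b = (b.1, 0) + (0, b.2) := by simp
    conv_lhs => rw [ha]
    rw [map_add, _root_.add_apply, hG]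
    conv_lhs => rw [hb]
    rw [map_add, hK'.symm (φ q) (φ.map_source hq) (a.1, 0) (0, b.2), hG]
    simp
    ring
  · ext v : 1
    rw [h.normalEndo_apply hq, ← hN (coordDiff φ q v), coordEndo_apply, φ.left_inv hq,
      h.coordLift_coordDiff hq, h.coordLift_coordDiff hq]

end Coordinates

end NullKahler

end

noncomputable section

namespace NullKahler

open Set Filter Topology

set_option linter.unusedSectionVars false

/-! ### Koszul's formula and the connection of the normal form -/

section Generic

variable {Z : Type*} [NormedAddCommGroup Z] [NormedSpace ℝ Z] [FiniteDimensional ℝ Z]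

/-- `C` plays the derivative of the metric. Koszul's formula prescribes the pairing of `Γ v w` with
`u`, and nondegeneracy inverts it. -/
lemma exists_koszul (b : Z →L[ℝ] Z →L[ℝ] ℝ) (hb : ∀ v, (∀ w, b v w = 0) → v = 0)
    (C : Z →L[ℝ] Z →L[ℝ] Z →L[ℝ] ℝ) : ∃ Γ : Z →L[ℝ] Z →L[ℝ] Z, ∀ v w u,
      b (Γ v w) u = 1 / 2 * (C v w u + C w v u - C u v w) := by
  let K : Z → Z → (Z →L[ℝ] ℝ) := fun v w ↦
    (1 / 2 : ℝ) • (C v w + C w v - ((C.flip v).flip w : Z →L[ℝ] ℝ))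
  have hK : ∀ v w u, K v w u = 1 / 2 * (C v w u + C w v u - C u v w) := fun v w u ↦ rfl
  let Γ : Z →ₗ[ℝ] Z →ₗ[ℝ] Z := LinearMap.mk₂ ℝ (fun v w ↦ (musical b hb).symm (K v w))
    (fun v v' w ↦ by
      rw [← map_add]; congr 1; ext u
      simp only [hK, _root_.add_apply, map_add]; ring)
    (fun c v w ↦ by
      rw [← map_smul]; congr 1; ext u
      simp only [hK, _root_.smul_apply, map_smul, smul_eq_mul]; ring)
    (fun v w w' ↦ by
      rw [← map_add]; congr 1; ext u
      simp only [hK, _root_.add_apply, map_add]; ring)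
    (fun c v w ↦ by
      rw [← map_smul]; congr 1; ext u
      simp only [hK, _root_.smul_apply, map_smul, smul_eq_mul]; ring)
  refine ⟨Γ.toContinuousBilinearMap, fun v w u ↦ ?_⟩
  rw [← hK]
  exact congrArg (fun L : Z →L[ℝ] ℝ ↦ L u) (apply_musical_symm b hb (K v w))

end Generic

section Model

variable {n : ℕ}

/-- An isotropic subspace of dimension `m` bounds each index by `2 m - m = m`; without a radical the
indices add up to `2 m`, so both are equal to `m`. -/
lemma sig_eq_of_isotropic {V : Type*} [AddCommGroup V] [Module ℝ V] [FiniteDimensional ℝ V] {m : ℕ}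
    (b : LinearMap.BilinForm ℝ V) (hb : ∀ v w, b v w = b w v)
    (hnd : ∀ v, (∀ w, b v w = 0) → v = 0) (hV : Module.finrank ℝ V = 2 * m)
    (W : Submodule ℝ V) (hW : Module.finrank ℝ W = m) (hiso : ∀ x ∈ W, b x x = 0) :
    sigPos (LinearMap.BilinMap.toQuadraticMap b) = m ∧
      sigNeg (LinearMap.BilinMap.toQuadraticMap b) = m := by
  set Q := LinearMap.BilinMap.toQuadraticMap b with hQ
  have h1 := QuadraticForm.sigPos_add_finrank_le_of_nonpos (Q := Q) (V := W)
    fun x hx ↦ (hiso x hx).le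
  have h2 := QuadraticForm.sigPos_add_finrank_le_of_nonpos (Q := -Q) (V := W)
    fun x hx ↦ (neg_eq_zero.2 (hiso x hx)).le
  rw [sigPos_neg] at h2
  have h3 := QuadraticForm.sigPos_add_sigNeg_add_radical (Q := Q)
  have h4 : Q.radical = ⊥ := by
    rw [eq_bot_iff]
    intro v hv
    refine (Submodule.mem_bot ℝ).2 (hnd v fun w ↦ ?_)
    have := (QuadraticMap.mem_radical_iff'.1 hv).2 w
    have h5 : Q (v + w) = b v v + b v w + b w v + b w w := by
      simp [hQ]; ring
    have h6 : b v v = 0 := (QuadraticMap.mem_radical_iff'.1 hv).1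
    have h7 : Q w = b w w := rfl
    linarith [hb v w]
  rw [h4, finrank_bot] at h3
  omega

lemma modelMetric_symm {T : Coord n → ℝ} {z : Coord n} (hT : ContDiffAt ℝ ∞ T z) (v w : Coord n) :
    modelMetric T z v w = modelMetric T z w v := by
  rw [modelMetric_apply, modelMetric_apply, fibreHess_apply, fibreHess_apply,
    fderiv_fderiv_symm (hT.of_le two_le_infty) (0, v.1)]
  ring

/-- Vertical test vectors detect `v.1` through `ω`; once it is zero the Hessian term drops out and
horizontal ones detect `v.2`. -/
lemma modelMetric_nondegenerate (T : Coord n → ℝ) (z v : Coord n)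
    (h : ∀ w, modelMetric T z v w = 0) : v = 0 := by
  have h1 : v.1 = 0 := halfOmega_nondegenerate _ fun b ↦ by
    have := h (0, b)
    rw [modelMetric_apply, fibreHess_apply, halfOmega_skew b] at this
    simpa [← Prod.zero_eq_mk] using this
  have h2 : v.2 = 0 := halfOmega_nondegenerate _ fun b ↦ by
    have := h (b, 0)
    rw [modelMetric_apply, fibreHess_apply, h1] at this
    simpa [← Prod.zero_eq_mk] using this
  exact Prod.ext h1 h2

lemma contDiffOn_modelMetric {T : Coord n → ℝ} {O : Set (Coord n)}
    (hT : ∀ z ∈ O, ContDiffAt ℝ ∞ T z) : ContDiffOn ℝ ∞ (modelMetric T) O := by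
  refine contDiffOn_clm_apply.2 fun v ↦ contDiffOn_clm_apply.2 fun w z hz ↦ ?_
  have h1 : ContDiffAt ℝ ∞ (fderiv ℝ T) z := (hT z hz).fderiv_right (by simp)
  have h2 : ContDiffAt ℝ ∞ (fderiv ℝ (fderiv ℝ T)) z := h1.fderiv_right (by simp)
  have h3 := (h2.clm_apply (contDiffAt_const (c := ((0, v.1) : Coord n)))).clm_apply
    (contDiffAt_const (c := ((0, w.1) : Coord n)))
  exact ((contDiffAt_const (c := halfOmega n v.2 w.1 + halfOmega n w.2 v.1)).add
    h3).contDiffWithinAt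

lemma fderiv_modelMetric_apply {T : Coord n → ℝ} {z : Coord n} (hT : ContDiffAt ℝ ∞ T z)
    (hd : DifferentiableAt ℝ (modelMetric T) z) (u v w : Coord n) :
    fderiv ℝ (modelMetric T) z u v w
      = fderiv ℝ (fderiv ℝ (fderiv ℝ T)) z u (0, v.1) (0, w.1) := by
  have h1 : ContDiffAt ℝ ∞ (fderiv ℝ T) z := hT.fderiv_right (by simp)
  have h2 : ContDiffAt ℝ ∞ (fderiv ℝ (fderiv ℝ T)) z := h1.fderiv_right (by simp)
  have h3 := hasFDerivAt_bilin_apply (h2.differentiableAt (by simp)) (0, v.1) (0, w.1)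
  have h4 := hasFDerivAt_bilin_apply hd v w
  have h5 := h3.const_add (halfOmega n v.2 w.1 + halfOmega n w.2 v.1)
  exact congrArg (fun L : Coord n →L[ℝ] ℝ ↦ L u) (h4.unique h5)

lemma third_fderiv_symm {T : Coord n → ℝ} {z : Coord n} (hT : ContDiffAt ℝ ∞ T z)
    (u v w : Coord n) :
    fderiv ℝ (fderiv ℝ (fderiv ℝ T)) z u v w = fderiv ℝ (fderiv ℝ (fderiv ℝ T)) z v u w := by
  have h1 : ContDiffAt ℝ ∞ (fderiv ℝ T) z := hT.fderiv_right (by simp)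
  exact congrArg (fun L : Coord n →L[ℝ] ℝ ↦ L w)
    ((h1.isSymmSndFDerivAt (by simpa using two_le_infty)).eq u v)

/-- The symmetry of second derivatives, valid at nearby points too, differentiated once more. -/
lemma third_fderiv_symm' {T : Coord n → ℝ} {z : Coord n} (hT : ContDiffAt ℝ ∞ T z)
    (u v w : Coord n) :
    fderiv ℝ (fderiv ℝ (fderiv ℝ T)) z u v w = fderiv ℝ (fderiv ℝ (fderiv ℝ T)) z u w v := by
  have h1 : ContDiffAt ℝ ∞ (fderiv ℝ T) z := hT.fderiv_right (by simp)
  have h2 : ContDiffAt ℝ ∞ (fderiv ℝ (fderiv ℝ T)) z := h1.fderiv_right (by simp)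
  have h3 := hasFDerivAt_bilin_apply (h2.differentiableAt (by simp)) v w
  have h4 := (hasFDerivAt_bilin_apply (h2.differentiableAt (by simp)) w v).congr_of_eventuallyEq
    (f₁ := fun z ↦ fderiv ℝ (fderiv ℝ T) z v w) (by
      filter_upwards [(hT.of_le two_le_infty).eventually (by simp)] with y hy using fderiv_fderiv_symm hy v w)
  exact congrArg (fun L : Coord n →L[ℝ] ℝ ↦ L u) (h3.unique h4)

/-- The Christoffel symbols of the normal form of the metric. -/
lemma exists_christoffel {T : Coord n → ℝ} {z : Coord n} (hT : ContDiffAt ℝ ∞ T z)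
    (hd : DifferentiableAt ℝ (modelMetric T) z) :
    ∃ Γ : Coord n →L[ℝ] Coord n →L[ℝ] Coord n, (∀ v w, Γ v w = Γ w v) ∧
      (∀ v w u, fderiv ℝ (modelMetric T) z v w u
        = modelMetric T z (Γ v w) u + modelMetric T z w (Γ v u)) ∧
      ∀ v w : Coord n, Γ v (0, w.1) = (0, (Γ v w).1) := by
  set C := fderiv ℝ (modelMetric T) z with hC
  have hCT := fderiv_modelMetric_apply hT hd
  rw [← hC] at hCT
  have hsymm : ∀ u v w, C u v w = C u w v := fun u v w ↦ by
    rw [hCT, hCT, third_fderiv_symm' hT]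
  obtain ⟨Γ, hΓ⟩ := exists_koszul (modelMetric T z) (modelMetric_nondegenerate T z) C
  have hext : ∀ v w, (∀ u, modelMetric T z v u = modelMetric T z w u) → v = w := fun v w h ↦
    sub_eq_zero.1 (modelMetric_nondegenerate T z _ fun u ↦ by
      rw [map_sub, _root_.sub_apply, h u, sub_self])
  have hN : ∀ v w : Coord n, modelMetric T z (0, v.1) w = -modelMetric T z v (0, w.1) := by
    intro v w
    have h0 : ((0 : Idx n → ℝ), (0 : Idx n → ℝ)) = 0 := rfl
    simp only [modelMetric_apply, fibreHess_apply, h0, map_zero, _root_.zero_apply, add_zero,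
      zero_add]
    rw [halfOmega_skew]
  refine ⟨Γ, fun v w ↦ hext _ _ fun u ↦ ?_, fun v w u ↦ ?_, fun v w ↦ hext _ _ fun u ↦ ?_⟩
  · rw [hΓ, hΓ, hsymm u v w]
    ring
  · rw [modelMetric_symm hT w, hΓ, hΓ, hsymm v u w]
    ring
  -- A vertical second or third argument kills `C`, because `C` sees these two only through their
  -- first components. One third fibre derivative of `T` survives on each side, and the two agree by
  -- total symmetry.
  · rw [hN, hΓ, hΓ]
    have h0 : ((0 : Idx n → ℝ), (0 : Idx n → ℝ)) = 0 := rfl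
    simp only [hCT, h0, map_zero, _root_.zero_apply]
    rw [third_fderiv_symm hT (0, w.1), third_fderiv_symm' hT (0, v.1), third_fderiv_symm hT (0, v.1)]
    ring

end Model

end NullKahler

end

noncomputable section

namespace NullKahler

open Set Filter Topology Bundle

set_option linter.unusedSectionVars false

/-! ### The converse on the manifold -/

section Coordinates

variable {n : ℕ} {M : Type*} [TopologicalSpace M] [ChartedSpace (Model n) M]
  [IsManifold (𝓡 (4 * n)) ∞ M] {φ : OpenPartialHomeomorph M (Coord n)}

/-- The derivative operator on vector fields with given Christoffel symbols in a coordinate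
system. -/
def coordConnection (φ : OpenPartialHomeomorph M (Coord n))
    (Γ : Coord n → Coord n →L[ℝ] Coord n →L[ℝ] Coord n)
    (Y : ∀ q : M, TangentSpace (𝓡 (4 * n)) q) (q : M) :
    TangentSpace (𝓡 (4 * n)) q →L[ℝ] TangentSpace (𝓡 (4 * n)) q :=
  (coordLift φ q).comp ((fderiv ℝ (coordField φ Y) (φ q)
    + (Γ (φ q)).flip (coordField φ Y (φ q))).comp (coordDiff φ q))

lemma coordConnection_apply (Γ : Coord n → Coord n →L[ℝ] Coord n →L[ℝ] Coord n)
    (Y : ∀ q : M, TangentSpace (𝓡 (4 * n)) q) (q : M) (v : TangentSpace (𝓡 (4 * n)) q) :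
    coordConnection φ Γ Y q v = coordLift φ q (fderiv ℝ (coordField φ Y) (φ q) (coordDiff φ q v)
      + Γ (φ q) (coordDiff φ q v) (coordField φ Y (φ q))) := rfl

namespace IsCoordinateSystem

lemma differentiableAt_coordField' (h : IsCoordinateSystem φ) {q : M} (hq : q ∈ φ.source)
    {Y : ∀ q : M, TangentSpace (𝓡 (4 * n)) q} (hY : DifferentiableFieldAt Y q) :
    DifferentiableAt ℝ (coordField φ Y) (φ q) :=
  h.differentiableAt_coordField (φ.map_source hq) (by rwa [φ.left_inv hq])

lemma isCovariantDerivativeOn (h : IsCoordinateSystem φ)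
    (Γ : Coord n → Coord n →L[ℝ] Coord n →L[ℝ] Coord n) :
    IsCovariantDerivativeOn (I := 𝓡 (4 * n)) (Model n) (coordConnection φ Γ) φ.source where
  add {Y Z q} hY hZ hq := by
    have hY' := h.differentiableAt_coordField' hq hY
    have hZ' := h.differentiableAt_coordField' hq hZ
    have h1 : coordField φ (Y + Z) = coordField φ Y + coordField φ Z := by
      funext z
      exact map_add _ _ _
    ext v : 1
    rw [_root_.add_apply, coordConnection_apply, coordConnection_apply, coordConnection_apply, h1,
      fderiv_add hY' hZ', ← map_add]
    congr 1
    simp only [_root_.add_apply, Pi.add_apply, map_add]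
    abel
  leibniz {Y f q} hY hf hq := by
    have hY' := h.differentiableAt_coordField' hq hY
    have hf' := h.differentiableAt_comp_symm hq hf
    have h1 : coordField φ (f • Y) = fun z ↦ f (φ.symm z) • coordField φ Y z := by
      funext z
      exact (coordDiff φ (φ.symm z)).map_smul _ _
    ext v : 1
    rw [_root_.add_apply, _root_.smul_apply, ContinuousLinearMap.smulRight_apply,
      coordConnection_apply, coordConnection_apply, h1, fderiv_fun_smul hf' hY',
      h.mvfderiv_eq hq hf', ← h.coordLift_coordDiff hq (Y q), ← map_smul, ← map_smul, ← map_add]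
    congr 1
    simp only [_root_.add_apply, _root_.smul_apply, ContinuousLinearMap.smulRight_apply, map_smul,
      coordField_apply hq, φ.left_inv hq, smul_add]
    abel

lemma coordConnection_torsion_free (h : IsCoordinateSystem φ)
    {Γ : Coord n → Coord n →L[ℝ] Coord n →L[ℝ] Coord n} {q : M} (hq : q ∈ φ.source)
    (hΓ : ∀ v w, Γ (φ q) v w = Γ (φ q) w v) {X Y : ∀ q : M, TangentSpace (𝓡 (4 * n)) q}
    (hX : DifferentiableFieldAt X q) (hY : DifferentiableFieldAt Y q) :
    coordConnection φ Γ Y q (X q) - coordConnection φ Γ X q (Y q)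
      = VectorField.mlieBracket (𝓡 (4 * n)) X Y q := by
  rw [← h.coordLift_coordDiff hq (VectorField.mlieBracket (𝓡 (4 * n)) X Y q),
    h.mlieBracket_eq hq hX hY, coordConnection_apply, coordConnection_apply, ← map_sub,
    coordField_apply hq, coordField_apply hq, hΓ]
  congr 1
  abel

lemma coordConnection_metric (h : IsCoordinateSystem φ)
    {Γ : Coord n → Coord n →L[ℝ] Coord n →L[ℝ] Coord n} {q : M} (hq : q ∈ φ.source)
    {g : ∀ x : M, TangentSpace (𝓡 (4 * n)) x →L[ℝ] TangentSpace (𝓡 (4 * n)) x →L[ℝ] ℝ}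
    {G : Coord n → Coord n →L[ℝ] Coord n →L[ℝ] ℝ} (hG : DifferentiableAt ℝ G (φ q))
    (hg : ∀ q ∈ φ.source, ∀ v w, g q v w = G (φ q) (coordDiff φ q v) (coordDiff φ q w))
    (hΓ : ∀ v w u, fderiv ℝ G (φ q) v w u = G (φ q) (Γ (φ q) v w) u + G (φ q) w (Γ (φ q) v u))
    {Y Z : ∀ q : M, TangentSpace (𝓡 (4 * n)) q}
    (hY : DifferentiableFieldAt Y q) (hZ : DifferentiableFieldAt Z q)
    (v : TangentSpace (𝓡 (4 * n)) q) :
    mvfderiv (𝓡 (4 * n)) (fun z ↦ g z (Y z) (Z z)) q v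
      = g q (coordConnection φ Γ Y q v) (Z q) + g q (Y q) (coordConnection φ Γ Z q v) := by
  have hY' := h.differentiableAt_coordField' hq hY
  have hZ' := h.differentiableAt_coordField' hq hZ
  have h1 : (fun z ↦ g (φ.symm z) (Y (φ.symm z)) (Z (φ.symm z)))
      =ᶠ[𝓝 (φ q)] fun z ↦ G z (coordField φ Y z) (coordField φ Z z) := by
    filter_upwards [φ.open_target.mem_nhds (φ.map_source hq)] with z hz
    rw [hg _ (φ.map_target hz), φ.right_inv hz]
    rfl
  have h2 := (hG.hasFDerivAt.clm_apply hY'.hasFDerivAt).clm_apply hZ'.hasFDerivAt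
  rw [h.mvfderiv_eq hq (f := fun z ↦ g z (Y z) (Z z))
    (h2.differentiableAt.congr_of_eventuallyEq h1), h1.fderiv_eq, h2.fderiv, hg q hq, hg q hq,
    coordConnection_apply, coordConnection_apply, h.coordDiff_coordLift hq,
    h.coordDiff_coordLift hq, ← coordField_apply hq, ← coordField_apply hq]
  simp only [_root_.add_apply, ContinuousLinearMap.comp_apply, ContinuousLinearMap.flip_apply,
    map_add, hΓ]
  ring

/-- In coordinates `N` has constant coefficients, so it commutes with the derivative term and only
its commutation with `Γ` matters. -/
lemma coordConnection_parallel (h : IsCoordinateSystem φ)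
    {Γ : Coord n → Coord n →L[ℝ] Coord n →L[ℝ] Coord n} {q : M} (hq : q ∈ φ.source)
    (hΓ : ∀ v w : Coord n, Γ (φ q) v (0, w.1) = (0, (Γ (φ q) v w).1))
    {Y : ∀ q : M, TangentSpace (𝓡 (4 * n)) q} (hY : DifferentiableFieldAt Y q)
    (v : TangentSpace (𝓡 (4 * n)) q) :
    coordConnection φ Γ (fun z ↦ normalEndo φ z (Y z)) q v
      = normalEndo φ q (coordConnection φ Γ Y q v) := by
  have hY' := h.differentiableAt_coordField' hq hY
  let N₀ : Coord n →L[ℝ] Coord n :=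
    (ContinuousLinearMap.inr ℝ (Idx n → ℝ) (Idx n → ℝ)).comp (ContinuousLinearMap.fst ℝ _ _)
  have h1 : coordField φ (fun z ↦ normalEndo φ z (Y z)) =ᶠ[𝓝 (φ q)]
      fun z ↦ N₀ (coordField φ Y z) := by
    filter_upwards [φ.open_target.mem_nhds (φ.map_source hq)] with z hz
    have hz' := φ.map_target hz
    rw [coordField, h.normalEndo_apply hz', h.coordDiff_coordLift hz']
    rfl
  have h2 := N₀.hasFDerivAt.comp (φ q) hY'.hasFDerivAt
  rw [h.normalEndo_apply hq, coordConnection_apply, coordConnection_apply,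
    h.coordDiff_coordLift hq, h1.fderiv_eq, h1.self_of_nhds,
    HasFDerivAt.fderiv (f := fun z ↦ N₀ (coordField φ Y z)) h2]
  congr 1
  change N₀ _ + Γ (φ q) _ (0, (coordField φ Y (φ q)).1) = _
  rw [hΓ]
  ext <;> simp [N₀]

lemma contMDiffOn_normalEndo (h : IsCoordinateSystem φ) :
    ContMDiffOn (𝓡 (4 * n)) ((𝓡 (4 * n)).prod 𝓘(ℝ, Model n →L[ℝ] Model n)) ∞
      (fun x ↦ TotalSpace.mk' (Model n →L[ℝ] Model n)
        (E := fun x : M ↦ TangentSpace (𝓡 (4 * n)) x →L[ℝ] TangentSpace (𝓡 (4 * n)) x) x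
        (normalEndo φ x)) φ.source := by
  intro q hq
  refine (h.contMDiffAt_hom_section hq fun v ↦ ?_).contMDiffWithinAt
  refine (h.contMDiffAt_liftField hq (w := fun _ ↦ (0, v.1)) contDiffAt_const).congr_of_eventuallyEq
    ?_
  filter_upwards [φ.open_source.mem_nhds hq] with x hx
  rw [h.normalEndo_apply hx, h.coordDiff_coordLift hx]
  rfl

lemma contMDiffOn_normalMetric (h : IsCoordinateSystem φ) {Θ : M → ℝ}
    (hΘ : ContMDiffOn (𝓡 (4 * n)) 𝓘(ℝ, ℝ) ∞ Θ φ.source) :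
    ContMDiffOn (𝓡 (4 * n)) ((𝓡 (4 * n)).prod 𝓘(ℝ, Model n →L[ℝ] Model n →L[ℝ] ℝ)) ∞
      (fun x ↦ TotalSpace.mk' (Model n →L[ℝ] Model n →L[ℝ] ℝ)
        (E := fun x : M ↦
          TangentSpace (𝓡 (4 * n)) x →L[ℝ] TangentSpace (𝓡 (4 * n)) x →L[ℝ] ℝ) x
        (normalMetric φ Θ x)) φ.source := by
  intro q hq
  refine (h.contMDiffAt_hom_section (F := Model n →L[ℝ] ℝ)
    (E := fun x : M ↦ TangentSpace (𝓡 (4 * n)) x →L[ℝ] Bundle.Trivial M ℝ x) hq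
    fun v ↦ ?_).contMDiffWithinAt
  refine h.contMDiffAt_hom_section (F := ℝ) (E := Bundle.Trivial M ℝ) hq fun w ↦ ?_
  refine contMDiffAt_totalSpace.2 ⟨contMDiffAt_id, ?_⟩
  have hs := contDiffOn_modelMetric (T := fun z ↦ Θ (φ.symm z)) (O := φ.target)
    fun z hz ↦ h.contDiffAt_comp_symm hΘ hz
  have h1 := (((hs.contDiffAt (φ.open_target.mem_nhds (φ.map_source hq))).clm_apply
    (contDiffAt_const (c := v))).clm_apply (contDiffAt_const (c := w))).contMDiffAt.comp q
    (h.contMDiffAt hq)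
  refine h1.congr_of_eventuallyEq ?_
  filter_upwards [φ.open_source.mem_nhds hq] with x hx
  change normalMetric φ Θ x (coordLift φ x v) (coordLift φ x w) = _
  rw [h.normalMetric_apply hΘ hx, h.coordDiff_coordLift hx, h.coordDiff_coordLift hx]
  rfl

lemma isNullKahlerOn_normal (h : IsCoordinateSystem φ) {Θ : M → ℝ}
    (hΘ : ContMDiffOn (𝓡 (4 * n)) 𝓘(ℝ, ℝ) ∞ Θ φ.source) :
    IsNullKahlerOn (normalMetric φ Θ) (normalEndo φ) φ.source := by
  set T : Coord n → ℝ := fun z ↦ Θ (φ.symm z)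
  have hT : ∀ z ∈ φ.target, ContDiffAt ℝ ∞ T z := fun z hz ↦ h.contDiffAt_comp_symm hΘ hz
  have hg : ∀ q ∈ φ.source, ∀ v w, normalMetric φ Θ q v w
      = modelMetric T (φ q) (coordDiff φ q v) (coordDiff φ q w) :=
    fun q hq ↦ h.normalMetric_apply hΘ hq
  have hd : ∀ z ∈ φ.target, DifferentiableAt ℝ (modelMetric T) z := fun z hz ↦
    ((contDiffOn_modelMetric hT).contDiffAt (φ.open_target.mem_nhds hz)).differentiableAt (by simp)
  have hsymm : ∀ q ∈ φ.source, ∀ v w, normalMetric φ Θ q v w = normalMetric φ Θ q w v := by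
    intro q hq v w
    rw [hg q hq, hg q hq, modelMetric_symm (hT _ (φ.map_source hq))]
  have hnd : ∀ q ∈ φ.source, ∀ v, (∀ w, normalMetric φ Θ q v w = 0) → v = 0 := by
    intro q hq v hv
    rw [← h.coordLift_coordDiff hq v, modelMetric_nondegenerate T (φ q) (coordDiff φ q v)
      fun w ↦ ?_, map_zero]
    rw [← hv (coordLift φ q w), hg q hq, h.coordDiff_coordLift hq]
  -- The vertical subspace serves twice: as the isotropic subspace for the signature and as the
  -- range of `N`.
  have hrange : ∀ q ∈ φ.source, ∀ W : Submodule ℝ (TangentSpace (𝓡 (4 * n)) q),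
      (∀ v, v ∈ W ↔ (coordDiff φ q v).1 = 0) → Module.finrank ℝ W = 2 * n := by
    intro q hq W hW
    let e : W ≃ₗ[ℝ] (Idx n → ℝ) :=
      { toFun := fun v ↦ (coordDiff φ q v.1).2
        map_add' := fun v w ↦ by simp
        map_smul' := fun c v ↦ by simp
        invFun := fun b ↦ ⟨coordLift φ q (0, b), by rw [hW, h.coordDiff_coordLift hq]⟩
        left_inv := fun v ↦ Subtype.ext (by
          have : ((0, (coordDiff φ q v.1).2) : Coord n) = coordDiff φ q v.1 :=
            Prod.ext ((hW _).1 v.2).symm rfl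
          change coordLift φ q (0, (coordDiff φ q v.1).2) = v.1
          rw [this, h.coordLift_coordDiff hq])
        right_inv := fun b ↦ by
          change (coordDiff φ q (coordLift φ q (0, b))).2 = b
          rw [h.coordDiff_coordLift hq] }
    rw [e.finrank_eq]
    simp
    ring
  have hΓ : ∀ z, ∃ Γ : Coord n →L[ℝ] Coord n →L[ℝ] Coord n, z ∈ φ.target →
      (∀ v w, Γ v w = Γ w v) ∧
      (∀ v w u, fderiv ℝ (modelMetric T) z v w u
        = modelMetric T z (Γ v w) u + modelMetric T z w (Γ v u)) ∧
      ∀ v w : Coord n, Γ v (0, w.1) = (0, (Γ v w).1) := by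
    intro z
    by_cases hz : z ∈ φ.target
    · obtain ⟨Γ, hΓ⟩ := exists_christoffel (hT z hz) (hd z hz)
      exact ⟨Γ, fun _ ↦ hΓ⟩
    -- The value outside the coordinate domain is arbitrary: every condition is imposed on
    -- `φ.source` only.
    · exact ⟨0, fun hz' ↦ absurd hz' hz⟩
  choose Γ hΓ using hΓ
  refine ⟨h.contMDiffOn_normalMetric hΘ, hsymm, hnd, ?_, h.contMDiffOn_normalEndo, ?_, ?_, ?_,
    coordConnection φ Γ, ⟨h.isCovariantDerivativeOn Γ, ?_, ?_⟩, ?_⟩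
  · intro q hq
    let W : Submodule ℝ (TangentSpace (𝓡 (4 * n)) q) :=
      LinearMap.ker ((LinearMap.fst ℝ (Idx n → ℝ) (Idx n → ℝ)).comp (coordDiff φ q).toLinearMap)
    have hW : ∀ v, v ∈ W ↔ (coordDiff φ q v).1 = 0 := fun v ↦ LinearMap.mem_ker
    have : FiniteDimensional ℝ (TangentSpace (𝓡 (4 * n)) q) :=
      inferInstanceAs (FiniteDimensional ℝ (Model n))
    refine sig_eq_of_isotropic (V := TangentSpace (𝓡 (4 * n)) q) (m := 2 * n)
      (normalMetric φ Θ q).toLinearMap₁₂ (hsymm q hq) (hnd q hq) ?_ W (hrange q hq W hW) ?_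
    · change Module.finrank ℝ (Model n) = _
      simp
      ring
    · intro v hv
      change normalMetric φ Θ q v v = 0
      have h0 : ((0 : Idx n → ℝ), (0 : Idx n → ℝ)) = 0 := rfl
      rw [hg q hq, modelMetric_apply, fibreHess_apply, (hW v).1 hv, h0]
      simp
  · intro q hq v
    rw [h.normalEndo_apply hq, h.normalEndo_apply hq, h.coordDiff_coordLift hq]
    exact map_zero _
  · intro q hq
    refine hrange q hq _ fun v ↦ ⟨?_, fun hv ↦ ?_⟩
    · rintro ⟨w, rfl⟩
      change (coordDiff φ q (normalEndo φ q w)).1 = 0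
      rw [h.normalEndo_apply hq, h.coordDiff_coordLift hq]
    · refine ⟨coordLift φ q ((coordDiff φ q v).2, 0), ?_⟩
      change normalEndo φ q _ = v
      rw [h.normalEndo_apply hq, h.coordDiff_coordLift hq, ← hv,
        h.coordLift_coordDiff hq]
  · intro q hq v w
    rw [hg q hq, hg q hq, h.normalEndo_apply hq, h.normalEndo_apply hq, h.coordDiff_coordLift hq,
      h.coordDiff_coordLift hq]
    have h0 : ((0 : Idx n → ℝ), (0 : Idx n → ℝ)) = 0 := rfl
    simp only [modelMetric_apply, fibreHess_apply, h0, map_zero, _root_.zero_apply, add_zero,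
      zero_add]
    rw [halfOmega_skew]
    ring
  · intro q hq X Y hX hY
    exact h.coordConnection_torsion_free hq (hΓ _ (φ.map_source hq)).1 hX hY
  · intro q hq Y Z hY hZ v
    exact h.coordConnection_metric hq (hd _ (φ.map_source hq)) hg (hΓ _ (φ.map_source hq)).2.1
      hY hZ v
  · intro q hq Y hY v
    exact h.coordConnection_parallel hq (hΓ _ (φ.map_source hq)).2.2 hY v

end IsCoordinateSystem

end Coordinates

end NullKahler

end

theorem theorem1 (n : ℕ) (M : Type*) [TopologicalSpace M]
    [ChartedSpace (NullKahler.Model n) M] [IsManifold (𝓡 (4 * n)) ∞ M] :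
    (∀ (g : ∀ x : M, TangentSpace (𝓡 (4 * n)) x →L[ℝ] TangentSpace (𝓡 (4 * n)) x →L[ℝ] ℝ)
        (N : ∀ x : M, TangentSpace (𝓡 (4 * n)) x →L[ℝ] TangentSpace (𝓡 (4 * n)) x),
      NullKahler.IsNullKahlerOn g N Set.univ →
        ∀ p : M, ∃ (φ : OpenPartialHomeomorph M (NullKahler.Coord n)) (Θ : M → ℝ),
          NullKahler.IsCoordinateSystem φ ∧ p ∈ φ.source ∧
          ContMDiffOn (𝓡 (4 * n)) 𝓘(ℝ, ℝ) ∞ Θ φ.source ∧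
          ∀ q ∈ φ.source,
            g q = NullKahler.normalMetric φ Θ q ∧ N q = NullKahler.normalEndo φ q) ∧
    (∀ (φ : OpenPartialHomeomorph M (NullKahler.Coord n)) (Θ : M → ℝ),
      NullKahler.IsCoordinateSystem φ →
      ContMDiffOn (𝓡 (4 * n)) 𝓘(ℝ, ℝ) ∞ Θ φ.source →
        NullKahler.IsNullKahlerOn (NullKahler.normalMetric φ Θ) (NullKahler.normalEndo φ)
          φ.source) := by
  exact ⟨fun _ _ hK p ↦ NullKahler.exists_normal_form hK p,
    fun _ _ h hΘ ↦ h.isNullKahlerOn_normal hΘ⟩
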